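/- Let $K$ be a non-trivially valued complete ultrametric field, $R$ an affinoid $K$-algebra with a fixed Banach norm, and $A$ an affinoid $R$-algebra with a fixed ultrametric Banach $R$-algebra norm ($\|1\|\le 1$, $\|ab\|\le\|a\|\|b\|$, $\|ra\|\le\|r\|\|a\|$). Let $P=A\widehat\otimes_RA$, regarded as an $A$-algebra by the action on the left, $\widetilde z=1\otimes z$, and let $I$ be the kernel of the multiplication $P\to A$. Let $\sigma$ be an $R$-algebra endomorphism of $A$ with $\|\sigma(z)\|\le\|z\|$ for all $z$; extend it to $P$ as $\sigma\widehat\otimes\mathrm{Id}$ and put $I^{(n)}=I\sigma(I)\cdots\sigma^{n-1}(I)$, $P_{(n)}=P/I^{(n+1)}$. Let $x\in A$ be a twisted coordinate for $\sigma$: for all $n$, the map $A[\xi]_{\le n}\to P_{(n)}$, $\xi\mapsto\overline{\widetilde x-x}$, is bijective. Let $\xi^{(k)}=\prod_{i<k}(\xi+x-\sigma^i(x))$, and let $\partial_\sigma^{[k]}:A\to A$ be the standard twisted differential operators, that is, $\partial^{[k]}_\sigma(z)=l_k(\widetilde z)$ where $(l_k)$ is the family of $A$-linear forms dual to $(\xi^{(k)})$,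 $l_k$ factoring through $P_{(k)}$. Let $\eta>0$ be real with $\|x-\sigma(x)\|\le\eta$, let $A\{\xi/\eta\}=\{\sum z_n\xi^n:\ z_n\in A,\ \|z_n\|\eta^n\to0\}$ with norm $\max\|z_n\|\eta^n$, and assume that $A$ is $\eta$-convergent: $\|\partial_\sigma^{[k]}(z)\|\eta^k\to0$ for all $z\in A$. (1) There is a bounded homomorphism of $R$-algebras $\theta_\eta:A\to A\{\xi/\eta\}$ with $\theta_\eta(z)=\sum_k\partial_\sigma^{[k]}(z)\xi^{(k)}$. Let $\otimes'_A$ mean that $A$ acts on the left factor through $\theta_\eta$. There is a unique continuous ring homomorphism $\delta_\eta:A\{\xi/\eta\}\to A\{\xi/\eta\}\widehat\otimes'_AA\{\xi/\eta\}$ with $\delta_\eta(z_1\theta_\eta(z_2))=z_1\otimes'\theta_\eta(z_2)$ for all $z_1,z_2\in A$. (2) (Analytic density.) Let $D^{(\eta)}_\sigma$ be the set of the $R$-linear maps $\varphi:A\to A$ such that $\varphi=\widetilde\varphi_\eta\circ\theta_\eta$ for some continuous $A$-linear map $\widetilde\varphi_\eta:A\{\xi/\eta\}\to A$. Then $\widetilde\varphi_\eta$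 is unique, and $\varphi\mapsto\widetilde\varphi_\eta$ is an isomorphism of Banach $A$-modules $D^{(\eta)}_\sigma\simeq\mathrm{Hom}_{A\text{-cont}}(A\{\xi/\eta\},A)$, isometric for $\|\varphi\|_\eta:=\|\widetilde\varphi_\eta\|$, where $\|\Phi\|=\sup_{f\ne0}\|\Phi(f)\|/\|f\|$. The elements of $D^{(\eta)}_\sigma$ are continuous, and $D^{(\eta)}_\sigma$ contains $\mathrm{Id}_A$ and is stable under composition. (3) For the product $\Phi\Psi=\Phi\circ(\mathrm{Id}\otimes'\Psi)\circ\delta_\eta$, where $(\mathrm{Id}\otimes'\Psi)(f\otimes' g)=f\,\theta_\eta(\Psi(g))$, the $R$-module $\mathrm{Hom}_{A\text{-cont}}(A\{\xi/\eta\},A)$ is an associative unital $R$-algebra (in general not commutative). It is a Banach $R$-algebra for some norm equivalent to $\|\cdot\|$, and $\|\Phi\Psi\|\le M\|\Phi\|\|\Psi\|$ for every $M$ such that $\|\theta_\eta(z)\|\le M\|z\|$ for all $z\in A$ (so $\|\cdot\|$ is itself submultiplicative if $\theta_\eta$ is contractive). The isomorphism of (2) sends composition to this product and $\mathrm{Id}_A$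 to the unit. (4) Assume moreover that $x$ is also a usual (étale) coordinate on $A$, that is, a twisted coordinate for $\mathrm{Id}_A$. Then this ring structure does not depend on $\sigma$: any two endomorphisms $\sigma,\tau$ of $A$ that satisfy all of the above for the same $x$, $\eta$ and norm define the same multiplication on $\mathrm{Hom}_{A\text{-cont}}(A\{\xi/\eta\},A)$. -/

import Mathlib

open Filter Topology
open scoped TensorProduct

noncomputable section

namespace Twisted

/-! ### Affinoid algebras -/

/-- The Tate algebra `K{T₁, …, T_N}`: power series whose coefficients tend to `0`. -/
abbrev Tate (K : Type*) [NormedField K] [IsUltrametricDist K] (N : ℕ) : Type _ :=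
  MvPowerSeries.IsRestricted.subring (R := K) (fun _ : Fin N => (1 : ℝ))

/-- A Banach `K`-algebra `A` is affinoid if it is a quotient of some Tate algebra: there is a
surjective homomorphism of `K`-algebras from a Tate algebra that is bounded for the Gauss norm. -/
def IsAffinoid (K A : Type*) [NormedField K] [IsUltrametricDist K] [NormedCommRing A]
    [NormedAlgebra K A] : Prop :=
  ∃ (N : ℕ) (π : Tate K N →+* A), Function.Surjective π ∧
    (∀ a : K, π ⟨MvPowerSeries.C a, MvPowerSeries.isRestricted_C _ a⟩ = algebraMap K A a) ∧
    ∃ M : ℝ, ∀ f : Tate K N,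
      ‖π f‖ ≤ M * MvPowerSeries.gaussNorm (fun a : K => ‖a‖) (fun _ => (1 : ℝ)) (f : MvPowerSeries (Fin N) K)

/-! ### Completed tensor products -/

section CompletedTensor

variable (S B C : Type*) [CommRing S] [NormedCommRing B] [NormedCommRing C]
  [Algebra S B] [Algebra S C]

/-- The algebraic tensor product, to be endowed with the (ultrametric) tensor seminorm. -/
def PreTensor : Type _ := B ⊗[S] C

instance : CommRing (PreTensor S B C) := inferInstanceAs (CommRing (B ⊗[S] C))

variable {S B C}

/-- The values `max ‖bᵢ‖ ‖cᵢ‖` (and all larger numbers) over the expressions `t = ∑ bᵢ ⊗ cᵢ`. -/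
def tensorBounds (t : B ⊗[S] C) : Set ℝ :=
  {M | 0 ≤ M ∧ ∃ l : List (B × C), t = (l.map fun p => p.1 ⊗ₜ[S] p.2).sum ∧
    ∀ p ∈ l, ‖p.1‖ * ‖p.2‖ ≤ M}

/-- The tensor seminorm `‖t‖ = inf max ‖bᵢ‖ ‖cᵢ‖`, over all expressions `t = ∑ bᵢ ⊗ cᵢ`. -/
def tensorSeminorm (t : B ⊗[S] C) : ℝ := sInf (tensorBounds t)

theorem tensorBounds_bddBelow (t : B ⊗[S] C) : BddBelow (tensorBounds t) :=
  ⟨0, fun _ h => h.1⟩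

theorem tensorBounds_add {t u : B ⊗[S] C} {M M' : ℝ} (ht : M ∈ tensorBounds t)
    (hu : M' ∈ tensorBounds u) : max M M' ∈ tensorBounds (t + u) := by
  obtain ⟨h0, l, rfl, hl⟩ := ht
  obtain ⟨h0', l', rfl, hl'⟩ := hu
  refine ⟨le_max_of_le_left h0, l ++ l', by simp, fun p hp => ?_⟩
  rcases List.mem_append.1 hp with h | h
  · exact (hl p h).trans (le_max_left _ _)
  · exact (hl' p h).trans (le_max_right _ _)

theorem tensorBounds_tmul (b : B) (c : C) : ‖b‖ * ‖c‖ ∈ tensorBounds (b ⊗ₜ[S] c) :=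
  ⟨by positivity, [(b, c)], by simp, by simp⟩

theorem tensorBounds_nonempty (t : B ⊗[S] C) : (tensorBounds t).Nonempty := by
  induction t using TensorProduct.induction_on with
  | zero => exact ⟨0, le_rfl, [], by simp, by simp⟩
  | tmul b c => exact ⟨_, tensorBounds_tmul b c⟩
  | add t u ht hu =>
    obtain ⟨M, hM⟩ := ht
    obtain ⟨M', hM'⟩ := hu
    exact ⟨_, tensorBounds_add hM hM'⟩

theorem tensorBounds_neg {t : B ⊗[S] C} {M : ℝ} (ht : M ∈ tensorBounds t) :
    M ∈ tensorBounds (-t) := by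
  obtain ⟨h0, l, rfl, hl⟩ := ht
  refine ⟨h0, l.map fun p => (-p.1, p.2), ?_, ?_⟩
  · clear hl
    induction l with
    | nil => simp
    | cons a l ih =>
      simp only [List.map_cons, List.sum_cons, neg_add] at ih ⊢
      rw [ih, TensorProduct.neg_tmul]
  · intro p hp
    obtain ⟨q, hq, rfl⟩ := List.mem_map.1 hp
    simpa using hl q hq

theorem tensorBounds_mul {t u : B ⊗[S] C} {M M' : ℝ} (ht : M ∈ tensorBounds t)
    (hu : M' ∈ tensorBounds u) : M * M' ∈ tensorBounds (t * u) := by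
  obtain ⟨h0, l, rfl, hl⟩ := ht
  obtain ⟨h0', l', rfl, hl'⟩ := hu
  refine ⟨by positivity, l.flatMap fun p => l'.map fun q => (p.1 * q.1, p.2 * q.2), ?_, ?_⟩
  · clear hl
    induction l with
    | nil => simp
    | cons a l ih =>
      simp only [List.map_cons, List.sum_cons, add_mul, List.flatMap_cons, List.map_append,
        List.sum_append, ih]
      congr 1
      clear ih hl'
      induction l' with
      | nil => simp
      | cons b l' ih' =>
        simp only [List.map_cons, List.sum_cons, mul_add, ih',
          Algebra.TensorProduct.tmul_mul_tmul]
  · intro p hp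
    obtain ⟨q, hq, hp⟩ := List.mem_flatMap.1 hp
    obtain ⟨r, hr, rfl⟩ := List.mem_map.1 hp
    have h1 := norm_mul_le q.1 r.1
    have h2 := norm_mul_le q.2 r.2
    calc ‖q.1 * r.1‖ * ‖q.2 * r.2‖ ≤ (‖q.1‖ * ‖r.1‖) * (‖q.2‖ * ‖r.2‖) := by gcongr
      _ = (‖q.1‖ * ‖q.2‖) * (‖r.1‖ * ‖r.2‖) := by ring
      _ ≤ M * M' := mul_le_mul (hl q hq) (hl' r hr) (by positivity) h0

theorem tensorSeminorm_nonneg (t : B ⊗[S] C) : 0 ≤ tensorSeminorm t :=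
  Real.sInf_nonneg fun _ h => h.1

theorem tensorSeminorm_le {t : B ⊗[S] C} {M : ℝ} (h : M ∈ tensorBounds t) :
    tensorSeminorm t ≤ M :=
  csInf_le (tensorBounds_bddBelow t) h

theorem exists_bound_lt (t : B ⊗[S] C) {ε : ℝ} (hε : 0 < ε) :
    ∃ M ∈ tensorBounds t, M < tensorSeminorm t + ε :=
  exists_lt_of_csInf_lt (tensorBounds_nonempty t) (by unfold tensorSeminorm; linarith)

theorem tensorSeminorm_tmul_le (b : B) (c : C) :
    tensorSeminorm (b ⊗ₜ[S] c) ≤ ‖b‖ * ‖c‖ :=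
  tensorSeminorm_le (tensorBounds_tmul b c)

variable (S B C) in
/-- The tensor seminorm is a ring seminorm. -/
def tensorRingSeminorm : RingSeminorm (PreTensor S B C) where
  toFun t := tensorSeminorm (S := S) (B := B) (C := C) t
  map_zero' := le_antisymm
    (tensorSeminorm_le (S := S) (B := B) (C := C) ⟨le_rfl, [], rfl, by simp⟩)
    (tensorSeminorm_nonneg _)
  add_le' t u := by
    refine le_of_forall_pos_le_add fun ε hε => ?_
    obtain ⟨M, hM, h⟩ := exists_bound_lt (S := S) (B := B) (C := C) t (half_pos hε)
    obtain ⟨M', hM', h'⟩ := exists_bound_lt (S := S) (B := B) (C := C) u (half_pos hε)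
    have h2 := tensorSeminorm_le (tensorBounds_add hM hM')
    have h3 : max M M' ≤ M + M' := max_le (by linarith [hM'.1]) (by linarith [hM.1])
    exact h2.trans (by linarith)
  neg' t := le_antisymm
    (le_csInf (tensorBounds_nonempty (S := S) (B := B) (C := C) t)
      fun _ h => tensorSeminorm_le (tensorBounds_neg h))
    (le_csInf (tensorBounds_nonempty (S := S) (B := B) (C := C) (-t)) fun M h => by
      have h' : M ∈ tensorBounds (S := S) (B := B) (C := C) (- -t) := tensorBounds_neg h
      have e : (- -t : PreTensor S B C) = t := neg_neg t
      exact tensorSeminorm_le (e ▸ h'))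
  mul_le' t u := by
    have key : ∀ ε : ℝ, 0 < ε → tensorSeminorm (S := S) (B := B) (C := C) (t * u) ≤
        (tensorSeminorm (S := S) (B := B) (C := C) t + ε) *
          (tensorSeminorm (S := S) (B := B) (C := C) u + ε) := by
      intro ε hε
      obtain ⟨M, hM, h⟩ := exists_bound_lt (S := S) (B := B) (C := C) t hε
      obtain ⟨M', hM', h'⟩ := exists_bound_lt (S := S) (B := B) (C := C) u hε
      exact (tensorSeminorm_le (tensorBounds_mul hM hM')).trans
        (mul_le_mul h.le h'.le hM'.1 (hM.1.trans h.le))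
    have hlim : Tendsto (fun ε : ℝ => (tensorSeminorm (S := S) (B := B) (C := C) t + ε) *
        (tensorSeminorm (S := S) (B := B) (C := C) u + ε)) (𝓝[>] 0)
        (𝓝 ((tensorSeminorm (S := S) (B := B) (C := C) t + 0) *
          (tensorSeminorm (S := S) (B := B) (C := C) u + 0))) :=
      (Continuous.tendsto (by fun_prop) 0).mono_left nhdsWithin_le_nhds
    have := ge_of_tendsto hlim (eventually_nhdsWithin_of_forall key)
    simpa using this

instance : SeminormedCommRing (PreTensor S B C) where
  __ := (tensorRingSeminorm S B C).toSeminormedRing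
  mul_comm := mul_comm

variable (S B C) in
/-- The identity map from the tensor product to its seminormed copy. -/
def toPre : B ⊗[S] C ≃+* PreTensor S B C := RingEquiv.refl (B ⊗[S] C)

variable (S B C) in
/-- The completed tensor product `B ⊗̂_S C`. -/
abbrev CTensor : Type _ := UniformSpace.Completion (PreTensor S B C)

variable (S) in
/-- The element `b ⊗ c` of `B ⊗̂_S C`. -/
def ctmul (b : B) (c : C) : CTensor S B C :=
  ((toPre S B C (b ⊗ₜ[S] c) : PreTensor S B C) : CTensor S B C)

variable (S B C) in
/-- The ring homomorphism `b ↦ b ⊗ 1` from `B` to `B ⊗̂_S C`. -/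
def inclLeft : B →+* CTensor S B C :=
  (UniformSpace.Completion.coeRingHom (α := PreTensor S B C)).comp
    ((toPre S B C : B ⊗[S] C →+* PreTensor S B C).comp
      Algebra.TensorProduct.includeLeftRingHom)

end CompletedTensor

/-! ### Twisted principal parts -/

section Principal

variable {R A : Type*} [CommRing R] [NormedCommRing A] [Algebra R A]

/-- The norm of `A` is contractive for the endomorphism `σ`. -/
def Contractive (σ : A →ₐ[R] A) : Prop := ∀ z, ‖σ z‖ ≤ ‖z‖

theorem contractive_id : Contractive (AlgHom.id R A) := fun _ => le_rfl

variable (R A) in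
/-- `P = A ⊗̂_R A`, an `A`-algebra by the action on the left. -/
abbrev PP : Type _ := CTensor R A A

/-- The multiplication `A ⊗_R A → A`. -/
def preMul : PreTensor R A A →+* A :=
  ((Algebra.TensorProduct.lmul' R (S := A) : A ⊗[R] A →ₐ[R] A) : A ⊗[R] A →+* A).comp
    ((toPre R A A).symm : PreTensor R A A →+* A ⊗[R] A)

theorem preMul_norm_le [IsUltrametricDist A] (t : PreTensor R A A) : ‖preMul t‖ ≤ ‖t‖ := by
  refine le_csInf (tensorBounds_nonempty (S := R) (B := A) (C := A) t) ?_
  rintro M ⟨h0, l, rfl, hl⟩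
  change ‖Algebra.TensorProduct.lmul' R (S := A) (l.map fun p => p.1 ⊗ₜ[R] p.2).sum‖ ≤ M
  induction l with
  | nil => simpa using h0
  | cons p l ih =>
    rw [List.map_cons, List.sum_cons, map_add, Algebra.TensorProduct.lmul'_apply_tmul]
    refine (IsUltrametricDist.norm_add_le_max _ _).trans (max_le ?_ ?_)
    · exact (norm_mul_le _ _).trans (hl p (by simp))
    · exact ih fun q hq => hl q (by simp [hq])

theorem continuous_preMul [IsUltrametricDist A] : Continuous (preMul (R := R) (A := A)) :=
  AddMonoidHomClass.continuous_of_bound _ 1 fun t => by simpa using preMul_norm_le t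

variable (R A) in
/-- The ideal `I` of `P`: the kernel of the multiplication `P → A`. -/
def diagIdeal [IsUltrametricDist A] [CompleteSpace A] : Ideal (PP R A) :=
  RingHom.ker (UniformSpace.Completion.extensionHom (preMul (R := R) (A := A)) continuous_preMul)

/-- `σ ⊗ Id` on `A ⊗_R A`. -/
def preSigma (σ : A →ₐ[R] A) : PreTensor R A A →+* PreTensor R A A :=
  (toPre R A A : A ⊗[R] A →+* PreTensor R A A).comp <|
    ((Algebra.TensorProduct.map σ (AlgHom.id R A) : A ⊗[R] A →ₐ[R] A ⊗[R] A) :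
      A ⊗[R] A →+* A ⊗[R] A).comp ((toPre R A A).symm : PreTensor R A A →+* A ⊗[R] A)

theorem preSigma_norm_le {σ : A →ₐ[R] A} (hσ : Contractive σ) (t : PreTensor R A A) :
    ‖preSigma σ t‖ ≤ ‖t‖ := by
  refine le_csInf (tensorBounds_nonempty (S := R) (B := A) (C := A) t) ?_
  rintro M ⟨h0, l, rfl, hl⟩
  refine tensorSeminorm_le (S := R) (B := A) (C := A)
    ⟨h0, l.map fun p => (σ p.1, p.2), ?_, ?_⟩
  · change Algebra.TensorProduct.map σ (AlgHom.id R A) (l.map fun p => p.1 ⊗ₜ[R] p.2).sum = _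
    rw [map_list_sum, List.map_map, List.map_map]
    rfl
  · intro p hp
    obtain ⟨q, hq, rfl⟩ := List.mem_map.1 hp
    exact (mul_le_mul_of_nonneg_right (hσ q.1) (norm_nonneg _)).trans (hl q hq)

theorem continuous_preSigma {σ : A →ₐ[R] A} (hσ : Contractive σ) : Continuous (preSigma σ) :=
  AddMonoidHomClass.continuous_of_bound _ 1 fun t => by simpa using preSigma_norm_le hσ t

/-- The extension `σ_P = σ ⊗̂ Id` of `σ` to `P`. -/
def sigmaP (σ : A →ₐ[R] A) (hσ : Contractive σ) : PP R A →+* PP R A :=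
  UniformSpace.Completion.mapRingHom (preSigma σ) (continuous_preSigma hσ)

variable [IsUltrametricDist A] [CompleteSpace A]

/-- The twisted product `I^{(n)} = I σ(I) ⋯ σ^{n-1}(I)`, a product of ideals of `P`. -/
def twistedPower (σ : A →ₐ[R] A) (hσ : Contractive σ) (n : ℕ) : Ideal (PP R A) :=
  ∏ i ∈ Finset.range n, (diagIdeal R A).map (sigmaP σ hσ ^ i)

/-- `x` is a twisted coordinate: for every `n`, the `A`-linear map `ξ ↦ x̃ - x` from the polynomials
in `ξ` of degree at most `n` to `P_{(n)} = P / I^{(n+1)}` is bijective; here `x̃ = 1 ⊗ x`. -/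
def IsTwistedCoordinate (σ : A →ₐ[R] A) (hσ : Contractive σ) (x : A) : Prop :=
  ∀ n : ℕ, Function.Bijective fun p : Polynomial.degreeLT A (n + 1) =>
    Ideal.Quotient.mk (twistedPower σ hσ (n + 1))
      (Polynomial.eval₂ (inclLeft R A A) (ctmul R 1 x - ctmul R x 1) (p : Polynomial A))

/-- `ξ^{(k)} = ξ σ(ξ) ⋯ σ^{k-1}(ξ)` in `P`, for `ξ = x̃ - x`. -/
def xiP (σ : A →ₐ[R] A) (hσ : Contractive σ) (x : A) (k : ℕ) : PP R A :=
  ∏ i ∈ Finset.range k, (sigmaP σ hσ ^ i) (ctmul R 1 x - ctmul R x 1)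

/-- `l` is the element `∂_σ^{[k]}` of the basis dual to `{ξ^{(j)}}`: it is an `A`-linear form on `P`
that factors through `P_{(k)} = P / I^{(k+1)}`, and `l (ξ^{(j)})` is `1` if `j = k`, and `0` for the
other `j ≤ k` (for `j > k` it vanishes since `ξ^{(j)}` lies in `I^{(k+1)}`). -/
structure IsDualBasisForm (σ : A →ₐ[R] A) (hσ : Contractive σ) (x : A) (k : ℕ)
    (l : PP R A →+ A) : Prop where
  map_smul : ∀ (a : A) (f : PP R A), l (inclLeft R A A a * f) = a * l f
  factors : ∀ f ∈ twistedPower σ hσ (k + 1), l f = 0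
  dual : ∀ j ≤ k, l (xiP σ hσ x j) = if j = k then 1 else 0

open Classical in
/-- The standard twisted differential operator `∂_σ^{[k]} : A → A`, that is `z ↦ l (1 ⊗ z)` for
the linear form `l` of the dual basis. That form exists and is unique if `x` is a twisted coordinate;
without it the value is `0`. -/
def stdOp (σ : A →ₐ[R] A) (hσ : Contractive σ) (x : A) (k : ℕ) (z : A) : A :=
  if h : ∃ l : PP R A →+ A, IsDualBasisForm σ hσ x k l then h.choose (ctmul R 1 z) else 0

/-- Standing hypotheses on `σ`: the norm is contractive for `σ`, `x` is a twisted coordinate,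
`η ≥ ρ = ‖x - σ(x)‖`, and `A` is `η`-convergent. -/
structure IsConvergent (σ : A →ₐ[R] A) (x : A) (η : ℝ) : Prop where
  contractive : Contractive σ
  coordinate : IsTwistedCoordinate σ contractive x
  radius_le : ‖x - σ x‖ ≤ η
  convergent : ∀ z : A, Tendsto (fun k => ‖stdOp σ contractive x k z‖ * η ^ k) atTop (𝓝 0)

end Principal

/-! ### The Banach algebra `A{ξ/η}` -/

section Disk

variable (A : Type*) [NormedCommRing A] [IsUltrametricDist A] (η : ℝ)

/-- The power series `∑ zₙ ξⁿ` with `‖zₙ‖ ηⁿ → 0`. -/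
def diskSubalgebra : Subalgebra A (PowerSeries A) where
  __ := PowerSeries.IsRestricted.subring (R := A) η
  algebraMap_mem' a := PowerSeries.isRestricted_C η a

/-- The algebra `A{ξ/η}`. -/
abbrev Disk : Type _ := diskSubalgebra A η

variable {A η}

/-- The variable `ξ` of `A{ξ/η}`. -/
def Disk.xi : Disk A η :=
  ⟨PowerSeries.X, PowerSeries.isRestricted_monomial η 1 1⟩

theorem Disk.tendsto (f : Disk A η) :
    Tendsto (fun n => ‖PowerSeries.coeff n (f : PowerSeries A)‖ * η ^ n) atTop (𝓝 0) :=
  (PowerSeries.isRestricted_iff' η _).1 f.2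

theorem Disk.hasGaussNorm (f : Disk A η) :
    PowerSeries.HasGaussNorm (fun a : A => ‖a‖) η (f : PowerSeries A) :=
  f.tendsto.bddAbove_range

variable (A η) in
/-- The norm `‖∑ zₙ ξⁿ‖_η = max ‖zₙ‖ ηⁿ`. -/
def diskRingNorm [hη : Fact (0 < η)] : RingNorm (Disk A η) where
  toFun f := PowerSeries.gaussNorm (fun a : A => ‖a‖) η (f : PowerSeries A)
  map_zero' := PowerSeries.gaussNorm_zero _ _ norm_zero
  add_le' f g := by
    refine (PowerSeries.gaussNorm_add_le_max _ η _ _ hη.out.le (fun a => norm_nonneg a)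
      (fun a b => IsUltrametricDist.norm_add_le_max a b) f.hasGaussNorm g.hasGaussNorm).trans ?_
    exact max_le_add_of_nonneg (PowerSeries.gaussNorm_nonneg _ _ _ fun a => norm_nonneg a)
      (PowerSeries.gaussNorm_nonneg _ _ _ fun a => norm_nonneg a)
  neg' f := MvPowerSeries.gaussNorm_neg _ _ (fun a => norm_neg a) _
  mul_le' f g := MvPowerSeries.gaussNorm_mul_le _ _ _ _ (fun _ => hη.out.le)
    (fun a => norm_nonneg a) norm_mul_le (fun a b => IsUltrametricDist.norm_add_le_max a b)
    norm_zero f.hasGaussNorm.hasMvGaussNorm g.hasGaussNorm.hasMvGaussNorm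
  eq_zero_of_map_eq_zero' f hf := Subtype.ext <|
    (PowerSeries.gaussNorm_eq_zero_iff _ η _ norm_zero (fun a => norm_nonneg a)
      (fun _ h => norm_eq_zero.1 h) hη.out f.hasGaussNorm).1 hf

instance [Fact (0 < η)] : NormedCommRing (Disk A η) where
  __ := (diskRingNorm A η).toNormedRing
  mul_comm := mul_comm

theorem Disk.norm_eq [Fact (0 < η)] (f : Disk A η) :
    ‖f‖ = ⨆ n : ℕ, ‖PowerSeries.coeff n (f : PowerSeries A)‖ * η ^ n :=
  PowerSeries.gaussNorm_eq _ _ _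

end Disk

/-! ### Predicates on norms -/

/-- `ν` is an ultrametric norm that makes the `S`-module `E` a Banach `S`-module. -/
structure IsBanachModule (S : Type*) {E : Type*} [NormedCommRing S] [AddCommGroup E] [Module S E]
    (ν : E → ℝ) : Prop where
  nonneg : ∀ u, 0 ≤ ν u
  eq_zero_iff : ∀ u, ν u = 0 ↔ u = 0
  neg : ∀ u, ν (-u) = ν u
  add_le : ∀ u v, ν (u + v) ≤ max (ν u) (ν v)
  smul_le : ∀ (s : S) (u : E), ν (s • u) ≤ ‖s‖ * ν u
  complete : ∀ w : ℕ → E, (∀ ε > 0, ∃ N, ∀ m ≥ N, ∀ n ≥ N, ν (w m - w n) < ε) →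
    ∃ u, Tendsto (fun n => ν (w n - u)) atTop (𝓝 0)

/-- The product `mul`, the unit `one` and the norm `ν` turn the `S`-module `E` into a (not
necessarily commutative) Banach `S`-algebra. -/
structure IsBanachAlgebra (S : Type*) {E : Type*} [NormedCommRing S] [AddCommGroup E] [Module S E]
    (mul : E → E → E) (one : E) (ν : E → ℝ) : Prop extends IsBanachModule S ν where
  add_mul : ∀ u v w, mul (u + v) w = mul u w + mul v w
  mul_add : ∀ u v w, mul u (v + w) = mul u v + mul u w
  smul_mul : ∀ (s : S) (u v : E), mul (s • u) v = s • mul u v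
  mul_smul : ∀ (s : S) (u v : E), mul u (s • v) = s • mul u v
  assoc : ∀ u v w, mul (mul u v) w = mul u (mul v w)
  one_mul : ∀ u, mul one u = u
  mul_one : ∀ u, mul u one = u
  norm_one_le : ν one ≤ 1
  norm_mul_le : ∀ u v, ν (mul u v) ≤ ν u * ν v

/-! ### Twisted differential operators of finite level -/

/-- The ring `B` seen as an `A`-algebra through `θ`. -/
def RightStr {A B : Type*} [CommRing A] [NormedCommRing B] (_θ : A →+* B) : Type _ := B

instance {A B : Type*} [CommRing A] [NormedCommRing B] (θ : A →+* B) :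
    NormedCommRing (RightStr θ) := inferInstanceAs (NormedCommRing B)

instance {A B : Type*} [CommRing A] [NormedCommRing B] (θ : A →+* B) :
    Algebra A (RightStr θ) := RingHom.toAlgebra (show A →+* RightStr θ from θ)

/-- The identity map from `B` to its copy. -/
def toRight {A B : Type*} [CommRing A] [NormedCommRing B] (θ : A →+* B) : B ≃+* RightStr θ :=
  RingEquiv.refl B

section Level

variable {R A : Type*} [CommRing R] [NormedCommRing A] [IsUltrametricDist A] [Algebra R A]
  {η : ℝ} [Fact (0 < η)]

/-- `ξ^{(k)} = ∏_{i < k} (ξ + x - σ^i(x))` in `A{ξ/η}`. -/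
def xiDisk (σ : A →ₐ[R] A) (x : A) (k : ℕ) : Disk A η :=
  ∏ i ∈ Finset.range k, (Disk.xi + algebraMap A (Disk A η) (x - (σ ^ i) x))

/-- `θ` is the twisted Taylor map of radius `η`: `θ z = ∑ ∂_σ^{[k]}(z) ξ^{(k)}`. -/
def IsTaylorMap [CompleteSpace A] (σ : A →ₐ[R] A) (hσ : Contractive σ) (x : A)
    (θ : A →ₐ[R] Disk A η) : Prop :=
  ∀ z : A, HasSum (fun k => stdOp σ hσ x k z • xiDisk σ x k) (θ z)

variable (A η) in
/-- `Hom_{A-cont}(A{ξ/η}, A)`. -/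
abbrev Dual : Type _ := Disk A η →L[A] A

/-- The norm `‖Φ‖ = sup ‖Φ(f)‖ / ‖f‖`. -/
def dualNorm (Φ : Dual A η) : ℝ := ⨆ f : Disk A η, ‖Φ f‖ / ‖f‖

/-- The twisted differential operators of level `η`: the `R`-linear maps `φ : A → A` that extend
along `θ` to a continuous `A`-linear map `A{ξ/η} → A`. -/
def LevelOps (θ : A →ₐ[R] Disk A η) : Submodule A (A →ₗ[R] A) where
  carrier := {φ | ∃ Φ : Dual A η, ∀ z, φ z = Φ (θ z)}
  zero_mem' := ⟨0, fun _ => rfl⟩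
  add_mem' := by
    rintro φ ψ ⟨Φ, hΦ⟩ ⟨Ψ, hΨ⟩
    exact ⟨Φ + Ψ, fun z => by simp [hΦ, hΨ]⟩
  smul_mem' := by
    rintro a φ ⟨Φ, hΦ⟩
    exact ⟨a • Φ, fun z => by simp [hΦ]⟩

/-- The norm `‖φ‖_η = ‖Φ‖`, for the (unique) `Φ` that extends `φ`. -/
def levelNorm (θ : A →ₐ[R] Disk A η) (φ : LevelOps θ) : ℝ :=
  sInf {c | ∃ Φ : Dual A η, (∀ z, φ.1 z = Φ (θ z)) ∧ c = dualNorm Φ}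

/-- `A{ξ/η} ⊗̂'_A A{ξ/η}`, where `A` acts on the left factor through `θ`. -/
abbrev DiskTensor (θ : A →ₐ[R] Disk A η) : Type _ :=
  CTensor A (RightStr (θ : A →+* Disk A η)) (Disk A η)

/-- The element `f ⊗' g` of `A{ξ/η} ⊗̂'_A A{ξ/η}`. -/
def dtmul (θ : A →ₐ[R] Disk A η) (f g : Disk A η) : DiskTensor θ :=
  ctmul A (toRight (θ : A →+* Disk A η) f) g

/-- `δ` is the comultiplication of `A{ξ/η}`: the continuous ring homomorphism that is compatible with
`δ (z₁ ⊗ z₂) = z₁ ⊗ 1 ⊗ z₂ = (z₁ ⊗ 1) ⊗' (1 ⊗ z₂)` on `A ⊗̂_R A`, through `z₁ ⊗ z₂ ↦ z₁ θ(z₂)`. -/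
structure IsComul (θ : A →ₐ[R] Disk A η) (δ : Disk A η →+* DiskTensor θ) : Prop where
  continuous : Continuous δ
  compat : ∀ z₁ z₂ : A, δ (algebraMap A (Disk A η) z₁ * θ z₂) =
    dtmul θ (algebraMap A (Disk A η) z₁) (θ z₂)

/-- `Id ⊗' Ψ` on the algebraic tensor product: `f ⊗' g ↦ f θ(Ψ(g))`. -/
def preIdTensor (θ : A →ₐ[R] Disk A η) (Ψ : Dual A η) :
    RightStr (θ : A →+* Disk A η) ⊗[A] Disk A η →ₗ[A] RightStr (θ : A →+* Disk A η) :=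
  TensorProduct.lift <| LinearMap.mk₂ A
    (fun f g => f * algebraMap A (RightStr (θ : A →+* Disk A η)) (Ψ g))
    (fun f f' g => add_mul _ _ _)
    (fun a f g => by rw [smul_mul_assoc])
    (fun f g g' => by rw [map_add, map_add, mul_add])
    (fun a f g => by rw [map_smul, smul_eq_mul, map_mul, Algebra.smul_def]; ring)

/-- `Id ⊗' Ψ : A{ξ/η} ⊗̂'_A A{ξ/η} → A{ξ/η}`, the extension by continuity. -/
def idTensor (θ : A →ₐ[R] Disk A η) (Ψ : Dual A η) : DiskTensor θ → Disk A η :=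
  UniformSpace.Completion.extension fun t =>
    (toRight (θ : A →+* Disk A η)).symm
      (preIdTensor θ Ψ ((toPre A (RightStr (θ : A →+* Disk A η)) (Disk A η)).symm t))

/-- `mul` is the multiplication `Φ Ψ = Φ ∘ (Id ⊗' Ψ) ∘ δ` of `Hom_{A-cont}(A{ξ/η}, A)`. -/
def IsDualProduct (θ : A →ₐ[R] Disk A η) (δ : Disk A η →+* DiskTensor θ)
    (mul : Dual A η → Dual A η → Dual A η) : Prop :=
  ∀ (Φ Ψ : Dual A η) (f : Disk A η), mul Φ Ψ f = Φ (idTensor θ Ψ (δ f))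

/-- The norms `ν` and `ν'` are equivalent. -/
def EquivNorms {E : Type*} (ν ν' : E → ℝ) : Prop :=
  ∃ c > 0, ∀ u, ν u ≤ c * ν' u ∧ ν' u ≤ c * ν u

end Level

end Twisted

end

/-! The Taylor map is a completed form of z ↦ 1 ⊗ z. Since x is a twisted coordinate, P/I^{(n)} is
free over A on the ξ^{(k)} with k < n; this gives dual forms l_k on P, and I^{(n)} is the common
kernel of l_0, …, l_{n-1} (`mem_twistedPower_iff`). In A{ξ/η}, the bound ‖x - σⁱ(x)‖ ≤ η makes the
Newton products ξ^{(k)} as good a basis as the powers ξᵏ, and the series whose first n Newton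
coordinates vanish form an ideal. In both rings the polynomials in ξ represent every class modulo
the n-th step of the filtration, with the same coordinates. Hence θ, defined by the coordinates
l_k(1 ⊗ z), is multiplicative (`taylorFun_mul`).

The analytic input is the continuity of the l_k (`exists_dualForm_bound`). Because A is affinoid, I
is finitely generated and P = A ⊗ 1 + σⁱ(I)P for every i (`IsAffinoid.exists_span_diagIdeal`); an
induction on k with the open mapping theorem then bounds l_k. The closed graph theorem bounds θ,
which extends to a ring map P → A{ξ/η} compatible with the two filtrations.

Since θ(x) = x + ξ, the comultiplication must send ξ to ξ ⊗' 1 + 1 ⊗' ξ, and it is defined by that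
formula. What needs proof is δ(θ(z)) = 1 ⊗' θ(z) (`comul_taylor`). This is clear on polynomials in
ξ, and the error is small: both sides, seen as maps on P, send I^{(N)} to elements whose coordinates
of total index < N vanish. Coordinates separate the points of the completed tensor product
(`eq_zero_of_tensorCoord`).

Density holds because ξ = θ(x) - x, so the A-span of the image of θ contains every ξᵏ and a
continuous A-linear form is determined on that image (`dual_ext`). There the product of forms is
composition of operators (`dualMul_taylor`), so the ring axioms are those of composition. The
submultiplicative norm is the operator norm of left multiplication. For an étale coordinate, θ sends
I into (ξ), so the coefficients of θ(z) below ξⁿ can be read off from 1 ⊗ z modulo Iⁿ, where σ does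
not appear (`taylor_eq_taylor`); and θ determines δ and the product. -/

noncomputable section

set_option linter.unusedSectionVars false

namespace Twisted

/-! ### The Banach algebra A{ξ/η}: norm, completeness, expansion in powers of ξ -/

section DiskAnalysis

variable {A : Type*} [NormedCommRing A] [IsUltrametricDist A] {η : ℝ} [hη : Fact (0 < η)]

theorem Disk.coeff_norm_le (f : Disk A η) (k : ℕ) :
    ‖PowerSeries.coeff k (f : PowerSeries A)‖ * η ^ k ≤ ‖f‖ := by
  rw [Disk.norm_eq]
  exact le_ciSup f.tendsto.bddAbove_range k

theorem Disk.norm_le {f : Disk A η} {C : ℝ}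
    (h : ∀ k, ‖PowerSeries.coeff k (f : PowerSeries A)‖ * η ^ k ≤ C) : ‖f‖ ≤ C := by
  rw [Disk.norm_eq]
  exact ciSup_le h

theorem Disk.ext_coeff {f g : Disk A η}
    (h : ∀ k, PowerSeries.coeff k (f : PowerSeries A) = PowerSeries.coeff k (g : PowerSeries A)) :
    f = g :=
  Subtype.ext (PowerSeries.ext h)

instance : IsUltrametricDist (Disk A η) :=
  IsUltrametricDist.isUltrametricDist_of_forall_norm_add_le_max_norm fun f g => by
    refine Disk.norm_le fun k => ?_
    have h0 : (0 : ℝ) ≤ η ^ k := pow_nonneg hη.out.le k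
    rw [show ((f + g : Disk A η) : PowerSeries A) = f + g from rfl, map_add]
    refine (mul_le_mul_of_nonneg_right (IsUltrametricDist.norm_add_le_max _ _) h0).trans ?_
    rw [max_mul_of_nonneg _ _ h0]
    exact max_le_max (f.coeff_norm_le k) (g.coeff_norm_le k)

theorem Disk.coeff_smul (a : A) (f : Disk A η) (k : ℕ) :
    PowerSeries.coeff k ((a • f : Disk A η) : PowerSeries A) =
      a * PowerSeries.coeff k (f : PowerSeries A) := by
  rw [show ((a • f : Disk A η) : PowerSeries A) = a • (f : PowerSeries A) from rfl]
  simp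

theorem Disk.coeff_algebraMap_mul (a : A) (f : Disk A η) (k : ℕ) :
    PowerSeries.coeff k ((algebraMap A (Disk A η) a * f : Disk A η) : PowerSeries A) =
      a * PowerSeries.coeff k (f : PowerSeries A) := by
  rw [← Algebra.smul_def, Disk.coeff_smul]

theorem Disk.coeff_xi_pow (n k : ℕ) :
    PowerSeries.coeff k (((Disk.xi : Disk A η) ^ n : Disk A η) : PowerSeries A) =
      if k = n then 1 else 0 := by
  rw [show (((Disk.xi : Disk A η) ^ n : Disk A η) : PowerSeries A) = PowerSeries.X ^ n from rfl,
    PowerSeries.coeff_X_pow]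

theorem Disk.coeff_algebraMap (a : A) (k : ℕ) :
    PowerSeries.coeff k ((algebraMap A (Disk A η) a : Disk A η) : PowerSeries A) =
      if k = 0 then a else 0 := by
  have := Disk.coeff_algebraMap_mul (η := η) a (Disk.xi ^ 0) k
  rw [Disk.coeff_xi_pow, pow_zero, mul_one] at this
  rw [this]; split_ifs <;> simp

theorem Disk.norm_algebraMap (a : A) : ‖algebraMap A (Disk A η) a‖ = ‖a‖ := by
  apply le_antisymm
  · refine Disk.norm_le fun k => ?_
    rw [Disk.coeff_algebraMap]
    split_ifs with h <;> simp [h]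
  · have := Disk.coeff_norm_le (algebraMap A (Disk A η) a) 0
    rwa [Disk.coeff_algebraMap, if_pos rfl, pow_zero, mul_one] at this

theorem Disk.norm_xi_pow_le (h1 : ‖(1 : A)‖ ≤ 1) (n : ℕ) : ‖(Disk.xi : Disk A η) ^ n‖ ≤ η ^ n := by
  have h0 : (0 : ℝ) ≤ η ^ n := pow_nonneg hη.out.le n
  refine Disk.norm_le fun k => ?_
  rw [Disk.coeff_xi_pow]
  split_ifs with h
  · subst h; exact mul_le_of_le_one_left h0 h1
  · simpa using h0

theorem Disk.norm_xi_le (h1 : ‖(1 : A)‖ ≤ 1) : ‖(Disk.xi : Disk A η)‖ ≤ η := by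
  simpa using Disk.norm_xi_pow_le (η := η) h1 1

theorem Disk.norm_one_le (h1 : ‖(1 : A)‖ ≤ 1) : ‖(1 : Disk A η)‖ ≤ 1 := by
  simpa using Disk.norm_xi_pow_le (η := η) h1 0

/-- The element of `A{ξ/η}` with given coefficients. -/
def Disk.mk (u : ℕ → A) (hu : Tendsto (fun k => ‖u k‖ * η ^ k) atTop (𝓝 0)) : Disk A η :=
  ⟨PowerSeries.mk u, (PowerSeries.isRestricted_iff' η _).2 (by simpa using hu)⟩

theorem Disk.coeff_mk (u : ℕ → A) (hu : Tendsto (fun k => ‖u k‖ * η ^ k) atTop (𝓝 0)) (k : ℕ) :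
    PowerSeries.coeff k ((Disk.mk u hu : Disk A η) : PowerSeries A) = u k :=
  PowerSeries.coeff_mk _ _

theorem Disk.coeff_sub (f g : Disk A η) (k : ℕ) :
    PowerSeries.coeff k ((f - g : Disk A η) : PowerSeries A) =
      PowerSeries.coeff k (f : PowerSeries A) - PowerSeries.coeff k (g : PowerSeries A) := by
  rw [show ((f - g : Disk A η) : PowerSeries A) = f - g from rfl, map_sub]

theorem Disk.tendsto_of_forall {u : ℕ → A}
    (h : ∀ ε > 0, ∃ g : Disk A η, ∀ k, ‖u k - PowerSeries.coeff k (g : PowerSeries A)‖ * η ^ k ≤ ε) :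
    Tendsto (fun k => ‖u k‖ * η ^ k) atTop (𝓝 0) := by
  rw [Metric.tendsto_atTop]
  intro ε hε
  obtain ⟨g, hg⟩ := h (ε / 2) (half_pos hε)
  obtain ⟨N, hN⟩ := Metric.tendsto_atTop.1 g.tendsto (ε / 2) (half_pos hε)
  refine ⟨N, fun k hk => ?_⟩
  have h0 : (0 : ℝ) ≤ η ^ k := pow_nonneg hη.out.le k
  have h1 := hg k
  have h2 := hN k hk
  rw [Real.dist_0_eq_abs, abs_of_nonneg (by positivity)] at h2 ⊢
  have h3 : ‖u k‖ ≤ ‖u k - PowerSeries.coeff k (g : PowerSeries A)‖ +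
      ‖PowerSeries.coeff k (g : PowerSeries A)‖ := by
    simpa using norm_add_le (u k - PowerSeries.coeff k (g : PowerSeries A))
      (PowerSeries.coeff k (g : PowerSeries A))
  nlinarith [mul_le_mul_of_nonneg_right h3 h0]

/-- Each coefficient of a Cauchy sequence converges. The weighted error is uniform in the index,
which makes the limit coefficients restricted and the convergence one of norms. -/
instance [CompleteSpace A] : CompleteSpace (Disk A η) := by
  refine Metric.complete_of_cauchySeq_tendsto fun w hw => ?_
  have hpos : ∀ k, (0 : ℝ) < η ^ k := fun k => pow_pos hη.out k
  have hc : ∀ k, CauchySeq fun n => PowerSeries.coeff k (w n : PowerSeries A) := fun k => by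
    rw [Metric.cauchySeq_iff] at hw ⊢
    intro ε hε
    obtain ⟨N, hN⟩ := hw (ε * η ^ k) (mul_pos hε (hpos k))
    refine ⟨N, fun m hm n hn => ?_⟩
    have h := hN m hm n hn
    rw [dist_eq_norm] at h ⊢
    have h' := Disk.coeff_norm_le (w m - w n) k
    rw [Disk.coeff_sub] at h'
    exact lt_of_mul_lt_mul_right (h'.trans_lt h) (hpos k).le
  choose u hu using fun k => cauchySeq_tendsto_of_complete (hc k)
  have key : ∀ ε > 0, ∃ N, ∀ n ≥ N, ∀ k,
      ‖u k - PowerSeries.coeff k (w n : PowerSeries A)‖ * η ^ k ≤ ε := by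
    intro ε hε
    obtain ⟨N, hN⟩ := Metric.cauchySeq_iff.1 hw ε hε
    refine ⟨N, fun n hn k => ?_⟩
    have hlim : Tendsto (fun m => ‖PowerSeries.coeff k (w m : PowerSeries A) -
        PowerSeries.coeff k (w n : PowerSeries A)‖ * η ^ k) atTop
        (𝓝 (‖u k - PowerSeries.coeff k (w n : PowerSeries A)‖ * η ^ k)) :=
      (((hu k).sub_const _).norm).mul_const _
    refine le_of_tendsto hlim (eventually_atTop.2 ⟨N, fun m hm => ?_⟩)
    have h := hN m hm n hn
    rw [dist_eq_norm] at h
    have h' := Disk.coeff_norm_le (w m - w n) k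
    rw [Disk.coeff_sub] at h'
    exact h'.trans h.le
  refine ⟨Disk.mk u (Disk.tendsto_of_forall fun ε hε => ?_), ?_⟩
  · obtain ⟨N, hN⟩ := key ε hε
    exact ⟨w N, hN N le_rfl⟩
  · rw [Metric.tendsto_atTop]
    intro ε hε
    obtain ⟨N, hN⟩ := key (ε / 2) (half_pos hε)
    refine ⟨N, fun n hn => ?_⟩
    rw [dist_comm, dist_eq_norm]
    refine (Disk.norm_le fun k => ?_).trans_lt (half_lt_self hε)
    rw [Disk.coeff_sub, Disk.coeff_mk]
    exact hN n hn k

/-- The coefficient of `ξᵏ`. -/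
def Disk.coeffHom (k : ℕ) : Disk A η →+ A :=
  AddMonoidHom.mk' (fun f : Disk A η => PowerSeries.coeff k (f : PowerSeries A)) fun a b => by
    rw [show ((a + b : Disk A η) : PowerSeries A) = a + b from rfl, map_add]

theorem Disk.coeffHom_apply (k : ℕ) (f : Disk A η) :
    Disk.coeffHom k f = PowerSeries.coeff k (f : PowerSeries A) := rfl

theorem Disk.continuous_coeffHom (k : ℕ) : Continuous (Disk.coeffHom k : Disk A η →+ A) :=
  AddMonoidHomClass.continuous_of_bound _ (η ^ k)⁻¹ fun g => by
    have h0 : 0 < η ^ k := pow_pos hη.out k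
    rw [← div_eq_inv_mul, le_div_iff₀ h0]
    exact g.coeff_norm_le k

theorem Disk.hasSum_coeff [CompleteSpace A] (h1 : ‖(1 : A)‖ ≤ 1) (f : Disk A η) :
    HasSum (fun k => algebraMap A (Disk A η) (PowerSeries.coeff k (f : PowerSeries A)) *
      Disk.xi ^ k) f := by
  have hs : Summable (fun k => algebraMap A (Disk A η) (PowerSeries.coeff k (f : PowerSeries A)) *
      Disk.xi ^ k) := by
    refine NonarchimedeanAddGroup.summable_of_tendsto_cofinite_zero ?_
    rw [Nat.cofinite_eq_atTop, tendsto_zero_iff_norm_tendsto_zero]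
    refine squeeze_zero (fun _ => norm_nonneg _) (fun k => ?_) f.tendsto
    refine (norm_mul_le _ _).trans ?_
    rw [Disk.norm_algebraMap]
    exact mul_le_mul_of_nonneg_left (Disk.norm_xi_pow_le h1 k) (norm_nonneg _)
  obtain ⟨g, hg⟩ := hs
  have : g = f := by
    refine Disk.ext_coeff fun k => ?_
    have h2 := hg.map (Disk.coeffHom k) (Disk.continuous_coeffHom k)
    have h3 : HasSum (Disk.coeffHom k ∘ fun k => algebraMap A (Disk A η)
        (PowerSeries.coeff k (f : PowerSeries A)) * Disk.xi ^ k)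
        (PowerSeries.coeff k (f : PowerSeries A)) := by
      convert hasSum_single k (f := Disk.coeffHom k ∘ fun k => algebraMap A (Disk A η)
        (PowerSeries.coeff k (f : PowerSeries A)) * Disk.xi ^ k) fun j hj => ?_ using 1
      · simp only [Function.comp, Disk.coeffHom_apply]
        rw [Disk.coeff_algebraMap_mul, Disk.coeff_xi_pow, if_pos rfl, mul_one]
      · simp only [Function.comp, Disk.coeffHom_apply]
        rw [Disk.coeff_algebraMap_mul, Disk.coeff_xi_pow, if_neg hj.symm, mul_zero]
    exact h2.unique h3
  rwa [this] at hg

/-- Every element is the sum of its monomials, so identities between continuous additive maps need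
only be checked on a ξᵏ. Most identities below are proved this way. -/
theorem Disk.addHom_ext [CompleteSpace A] (h1 : ‖(1 : A)‖ ≤ 1) {E : Type*} [AddCommMonoid E]
    [TopologicalSpace E] [T2Space E] {φ ψ : Disk A η →+ E} (hφ : Continuous φ) (hψ : Continuous ψ)
    (h : ∀ a k, φ (algebraMap A (Disk A η) a * Disk.xi ^ k) =
      ψ (algebraMap A (Disk A η) a * Disk.xi ^ k)) : φ = ψ := by
  ext f
  have h2 := (Disk.hasSum_coeff h1 f).map φ hφ
  have h3 := (Disk.hasSum_coeff h1 f).map ψ hψ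
  have h4 : (φ ∘ fun k => algebraMap A (Disk A η) (PowerSeries.coeff k (f : PowerSeries A)) *
      Disk.xi ^ k) = ψ ∘ fun k => algebraMap A (Disk A η)
        (PowerSeries.coeff k (f : PowerSeries A)) * Disk.xi ^ k := funext fun k => h _ _
  rw [h4] at h2
  exact h2.unique h3

end DiskAnalysis

/-! ### Maps out of A{ξ/η} given by the images of the powers of ξ -/

section DiskLift

variable {A : Type*} [NormedCommRing A] [IsUltrametricDist A] {η : ℝ} [hη : Fact (0 < η)]
  {B : Type*} [NormedCommRing B] [IsUltrametricDist B] [CompleteSpace B]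

theorem Disk.summable_lift (ι : A →+* B) (hι : ∀ a, ‖ι a‖ ≤ ‖a‖) {u : ℕ → B} {C : ℝ}
    (hu : ∀ k, ‖u k‖ ≤ C * η ^ k) (f : Disk A η) :
    Summable fun k => ι (PowerSeries.coeff k (f : PowerSeries A)) * u k := by
  refine NonarchimedeanAddGroup.summable_of_tendsto_cofinite_zero ?_
  rw [Nat.cofinite_eq_atTop, tendsto_zero_iff_norm_tendsto_zero]
  have := f.tendsto.const_mul C
  rw [mul_zero] at this
  refine squeeze_zero (fun _ => norm_nonneg _) (fun k => ?_) this
  refine (norm_mul_le _ _).trans ?_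
  rw [mul_left_comm]
  exact mul_le_mul (hι _) (hu k) (norm_nonneg _) (norm_nonneg _)

/-- The additive map `∑ aₖ ξᵏ ↦ ∑ ι(aₖ) uₖ`. -/
def Disk.lift (ι : A →+* B) (hι : ∀ a, ‖ι a‖ ≤ ‖a‖) {u : ℕ → B} {C : ℝ}
    (hu : ∀ k, ‖u k‖ ≤ C * η ^ k) : Disk A η →+ B :=
  AddMonoidHom.mk' (fun f => ∑' k, ι (PowerSeries.coeff k (f : PowerSeries A)) * u k) fun f g => by
    rw [← (Disk.summable_lift ι hι hu f).tsum_add (Disk.summable_lift ι hι hu g)]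
    refine tsum_congr fun k => ?_
    rw [show ((f + g : Disk A η) : PowerSeries A) = f + g from rfl, map_add, map_add, add_mul]

variable (ι : A →+* B) (hι : ∀ a, ‖ι a‖ ≤ ‖a‖) {u : ℕ → B} {C : ℝ}
    (hu : ∀ k, ‖u k‖ ≤ C * η ^ k)

theorem Disk.hasSum_lift (f : Disk A η) :
    HasSum (fun k => ι (PowerSeries.coeff k (f : PowerSeries A)) * u k) (Disk.lift ι hι hu f) :=
  (Disk.summable_lift ι hι hu f).hasSum

theorem Disk.norm_lift_le (f : Disk A η) : ‖Disk.lift ι hι hu f‖ ≤ C * ‖f‖ := by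
  have hC : 0 ≤ C := by simpa using (norm_nonneg _).trans (hu 0)
  refine IsUltrametricDist.norm_tsum_le_of_forall_le_of_nonneg (by positivity) fun k => ?_
  refine (norm_mul_le _ _).trans ((mul_le_mul (hι _) (hu k) (norm_nonneg _) (norm_nonneg _)).trans ?_)
  rw [mul_left_comm]
  exact mul_le_mul_of_nonneg_left (f.coeff_norm_le k) hC

theorem Disk.continuous_lift : Continuous (Disk.lift ι hι hu : Disk A η →+ B) :=
  AddMonoidHomClass.continuous_of_bound _ C (Disk.norm_lift_le ι hι hu)

theorem Disk.lift_algebraMap_mul (a : A) (f : Disk A η) :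
    Disk.lift ι hι hu (algebraMap A (Disk A η) a * f) = ι a * Disk.lift ι hι hu f := by
  have h := Disk.hasSum_lift ι hι hu (algebraMap A (Disk A η) a * f)
  simp only [Disk.coeff_algebraMap_mul, map_mul, mul_assoc] at h
  exact h.unique ((Disk.hasSum_lift ι hι hu f).mul_left (ι a))

theorem Disk.lift_xi_pow (n : ℕ) : Disk.lift ι hι hu ((Disk.xi : Disk A η) ^ n) = u n := by
  refine (Disk.hasSum_lift ι hι hu _).unique ?_
  convert hasSum_single n (f := fun k => ι (PowerSeries.coeff k
    (((Disk.xi : Disk A η) ^ n : Disk A η) : PowerSeries A)) * u k) fun j hj => ?_ using 1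
  · rw [Disk.coeff_xi_pow, if_pos rfl, map_one, one_mul]
  · simp only [Disk.coeff_xi_pow, if_neg hj, map_zero, zero_mul]

theorem Disk.lift_algebraMap_mul_xi_pow (a : A) (n : ℕ) :
    Disk.lift ι hι hu (algebraMap A (Disk A η) a * Disk.xi ^ n) = ι a * u n := by
  rw [Disk.lift_algebraMap_mul, Disk.lift_xi_pow]

end DiskLift

/-! ### Newton bases of A{ξ/η} and their filtration -/

section Newton

variable {A : Type*} [NormedCommRing A] [IsUltrametricDist A] {η : ℝ} [hη : Fact (0 < η)]

/-- The Newton basis `∏_{i < k} (ξ + yᵢ)`. -/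
def newton (y : ℕ → A) (k : ℕ) : Disk A η :=
  ∏ i ∈ Finset.range k, (Disk.xi + algebraMap A (Disk A η) (y i))

theorem norm_sub_le_max' {E : Type*} [SeminormedAddCommGroup E] [IsUltrametricDist E] (a b : E) :
    ‖a - b‖ ≤ max ‖a‖ ‖b‖ := by
  simpa [sub_eq_add_neg] using IsUltrametricDist.norm_add_le_max a (-b)

theorem newton_zero (y : ℕ → A) : (newton y 0 : Disk A η) = 1 := by simp [newton]

theorem newton_succ (y : ℕ → A) (k : ℕ) :
    (newton y (k + 1) : Disk A η) = newton y k * (Disk.xi + algebraMap A (Disk A η) (y k)) :=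
  Finset.prod_range_succ _ _

/-- This recursion is the formula by which `newtonStep` acts on ξᵏ. -/
theorem xi_mul_newton (y : ℕ → A) (k : ℕ) :
    (Disk.xi * newton y k : Disk A η) =
      newton y (k + 1) - algebraMap A (Disk A η) (y k) * newton y k := by
  rw [newton_succ]; ring

variable {y : ℕ → A} (h1 : ‖(1 : A)‖ ≤ 1) (hy : ∀ i, ‖y i‖ ≤ η)

include h1 hy in
theorem norm_newton_le (k : ℕ) : ‖(newton y k : Disk A η)‖ ≤ 1 * η ^ k := by
  rw [one_mul]
  induction k with
  | zero => simpa [newton_zero] using Disk.norm_one_le (η := η) h1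
  | succ k ih =>
    rw [newton_succ, pow_succ]
    refine (norm_mul_le _ _).trans (mul_le_mul ih ?_ (norm_nonneg _) (pow_nonneg hη.out.le _))
    refine (IsUltrametricDist.norm_add_le_max _ _).trans (max_le (Disk.norm_xi_le h1) ?_)
    rw [Disk.norm_algebraMap]
    exact hy k

theorem norm_algebraMap_le (a : A) : ‖algebraMap A (Disk A η) a‖ ≤ ‖a‖ :=
  (Disk.norm_algebraMap a).le

include h1 hy in
theorem norm_newtonStep_le (k : ℕ) :
    ‖(Disk.xi ^ (k + 1) - algebraMap A (Disk A η) (y k) * Disk.xi ^ k : Disk A η)‖ ≤ η * η ^ k := by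
  refine (norm_sub_le_max' _ _).trans (max_le ?_ ?_)
  · rw [mul_comm, ← pow_succ]; exact Disk.norm_xi_pow_le h1 _
  · refine (norm_mul_le _ _).trans ?_
    rw [Disk.norm_algebraMap]
    exact mul_le_mul (hy k) (Disk.norm_xi_pow_le h1 _) (norm_nonneg _) hη.out.le

variable [CompleteSpace A]

/-- The map `ξᵏ ↦ ∏_{i < k} (ξ + yᵢ)`. -/
def newtonT : Disk A η →+ Disk A η :=
  Disk.lift (algebraMap A (Disk A η)) norm_algebraMap_le (norm_newton_le h1 hy)

/-- Multiplication by `ξ`, in Newton coordinates. -/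
def newtonStep : Disk A η →+ Disk A η :=
  Disk.lift (algebraMap A (Disk A η)) norm_algebraMap_le (norm_newtonStep_le h1 hy)

/-- The Newton coordinates of `ξᵏ`. -/
def newtonPow (k : ℕ) : Disk A η := (newtonStep h1 hy)^[k] 1

theorem newtonPow_succ (k : ℕ) :
    newtonPow h1 hy (k + 1) = newtonStep h1 hy (newtonPow h1 hy k) :=
  Function.iterate_succ_apply' _ _ _

theorem norm_newtonPow_le (k : ℕ) : ‖newtonPow h1 hy k‖ ≤ 1 * η ^ k := by
  rw [one_mul]
  induction k with
  | zero => simpa [newtonPow] using Disk.norm_one_le (η := η) h1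
  | succ k ih =>
    rw [newtonPow_succ, pow_succ']
    exact (Disk.norm_lift_le _ _ _ _).trans (mul_le_mul_of_nonneg_left ih hη.out.le)

/-- The inverse of `newtonT`. -/
def newtonS : Disk A η →+ Disk A η :=
  Disk.lift (algebraMap A (Disk A η)) norm_algebraMap_le (norm_newtonPow_le h1 hy)

theorem continuous_newtonT : Continuous (newtonT h1 hy : Disk A η →+ Disk A η) :=
  Disk.continuous_lift _ _ _

theorem continuous_newtonStep : Continuous (newtonStep h1 hy : Disk A η →+ Disk A η) :=
  Disk.continuous_lift _ _ _

theorem continuous_newtonS : Continuous (newtonS h1 hy : Disk A η →+ Disk A η) :=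
  Disk.continuous_lift _ _ _

theorem norm_newtonS_le (f : Disk A η) : ‖newtonS h1 hy f‖ ≤ ‖f‖ := by
  rw [newtonS]
  refine (Disk.norm_lift_le _ _ _ _).trans ?_
  rw [one_mul]

/-- On monomials this is `xi_mul_newton`: the change of basis turns `newtonStep` into multiplication
by ξ. Iterating from 1 shows that `newtonPow` really gives the Newton coordinates of ξᵏ. -/
theorem newtonT_step (f : Disk A η) :
    newtonT h1 hy (newtonStep h1 hy f) = Disk.xi * newtonT h1 hy f := by
  refine DFunLike.congr_fun (Disk.addHom_ext (φ := (newtonT h1 hy).comp (newtonStep h1 hy))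
    (ψ := (AddMonoidHom.mulLeft Disk.xi).comp (newtonT h1 hy)) h1
    ((continuous_newtonT h1 hy).comp (continuous_newtonStep h1 hy))
    ((continuous_const_mul _).comp (continuous_newtonT h1 hy)) fun a k => ?_) f
  simp only [AddMonoidHom.comp_apply, AddMonoidHom.coe_mulLeft]
  rw [newtonStep, newtonT, Disk.lift_algebraMap_mul_xi_pow, Disk.lift_algebraMap_mul_xi_pow,
    Disk.lift_algebraMap_mul, map_sub, Disk.lift_xi_pow, Disk.lift_algebraMap_mul_xi_pow,
    mul_left_comm, xi_mul_newton]

theorem newtonS_xi_mul (f : Disk A η) :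
    newtonS h1 hy (Disk.xi * f) = newtonStep h1 hy (newtonS h1 hy f) := by
  refine DFunLike.congr_fun (Disk.addHom_ext (ψ := (newtonStep h1 hy).comp (newtonS h1 hy))
    (φ := (newtonS h1 hy).comp (AddMonoidHom.mulLeft Disk.xi)) h1
    ((continuous_newtonS h1 hy).comp (continuous_const_mul _))
    ((continuous_newtonStep h1 hy).comp (continuous_newtonS h1 hy)) fun a k => ?_) f
  simp only [AddMonoidHom.comp_apply, AddMonoidHom.coe_mulLeft]
  rw [mul_left_comm, ← pow_succ', newtonS, Disk.lift_algebraMap_mul_xi_pow,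
    Disk.lift_algebraMap_mul_xi_pow, newtonPow_succ]
  exact (Disk.lift_algebraMap_mul _ _ _ _ _).symm

theorem newtonT_pow (k : ℕ) : newtonT h1 hy (newtonPow h1 hy k) = Disk.xi ^ k := by
  induction k with
  | zero =>
    have := Disk.lift_xi_pow (algebraMap A (Disk A η)) norm_algebraMap_le (norm_newton_le h1 hy) 0
    rwa [pow_zero, newton_zero] at this
  | succ k ih => rw [newtonPow_succ, newtonT_step, ih, pow_succ']

theorem newtonT_newtonS (f : Disk A η) : newtonT h1 hy (newtonS h1 hy f) = f := by
  refine DFunLike.congr_fun (Disk.addHom_ext (φ := (newtonT h1 hy).comp (newtonS h1 hy))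
    (ψ := AddMonoidHom.id _) h1 ((continuous_newtonT h1 hy).comp (continuous_newtonS h1 hy))
    continuous_id fun a k => ?_) f
  simp only [AddMonoidHom.comp_apply, AddMonoidHom.id_apply]
  rw [newtonS, Disk.lift_algebraMap_mul_xi_pow, newtonT, Disk.lift_algebraMap_mul]
  exact congrArg _ (newtonT_pow h1 hy k)

/-- Multiplying by ξ + y_k becomes applying `newtonStep` and adding y_k times the argument. On ξᵏ
the two terms in y_k cancel and ξ^{k+1} is left. -/
theorem newtonS_newton (k : ℕ) : newtonS h1 hy (newton y k) = Disk.xi ^ k := by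
  induction k with
  | zero =>
    have := Disk.lift_xi_pow (algebraMap A (Disk A η)) norm_algebraMap_le
      (norm_newtonPow_le h1 hy) 0
    rw [pow_zero] at this
    rwa [newton_zero, pow_zero]
  | succ k ih =>
    rw [newton_succ, mul_comm, add_mul, map_add, newtonS_xi_mul, ih]
    rw [newtonS, Disk.lift_algebraMap_mul, ← newtonS, ih, newtonStep, Disk.lift_xi_pow,
      sub_add_cancel]

theorem newtonS_newtonT (f : Disk A η) : newtonS h1 hy (newtonT h1 hy f) = f := by
  refine DFunLike.congr_fun (Disk.addHom_ext (φ := (newtonS h1 hy).comp (newtonT h1 hy))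
    (ψ := AddMonoidHom.id _) h1 ((continuous_newtonS h1 hy).comp (continuous_newtonT h1 hy))
    continuous_id fun a k => ?_) f
  simp only [AddMonoidHom.comp_apply, AddMonoidHom.id_apply]
  rw [newtonT, Disk.lift_algebraMap_mul_xi_pow, newtonS, Disk.lift_algebraMap_mul, ← newtonS,
    newtonS_newton]

/-- The coordinates of an element of `A{ξ/η}` in the Newton basis. -/
def newtonCoord (k : ℕ) : Disk A η →+ A := (Disk.coeffHom k).comp (newtonS h1 hy)

theorem newtonCoord_algebraMap_mul (k : ℕ) (a : A) (f : Disk A η) :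
    newtonCoord h1 hy k (algebraMap A (Disk A η) a * f) = a * newtonCoord h1 hy k f := by
  simp only [newtonCoord, AddMonoidHom.comp_apply, newtonS, Disk.lift_algebraMap_mul,
    Disk.coeffHom_apply, Disk.coeff_algebraMap_mul]

theorem newtonCoord_newtonT (k : ℕ) (f : Disk A η) :
    newtonCoord h1 hy k (newtonT h1 hy f) = PowerSeries.coeff k (f : PowerSeries A) := by
  rw [newtonCoord, AddMonoidHom.comp_apply, newtonS_newtonT, Disk.coeffHom_apply]

theorem newtonCoord_newton (k j : ℕ) :
    newtonCoord h1 hy k (newton y j) = if k = j then 1 else 0 := by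
  rw [newtonCoord, AddMonoidHom.comp_apply, newtonS_newton, Disk.coeffHom_apply,
    Disk.coeff_xi_pow]

theorem norm_newtonCoord_le (k : ℕ) (f : Disk A η) : ‖newtonCoord h1 hy k f‖ * η ^ k ≤ ‖f‖ := by
  exact (Disk.coeff_norm_le _ k).trans (norm_newtonS_le h1 hy f)

theorem continuous_newtonCoord (k : ℕ) :
    Continuous (newtonCoord h1 hy k : Disk A η →+ A) :=
  (Disk.continuous_coeffHom k).comp (continuous_newtonS h1 hy)

theorem hasSum_newton (f : Disk A η) :
    HasSum (fun k => algebraMap A (Disk A η) (newtonCoord h1 hy k f) * newton y k) f := by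
  have := Disk.hasSum_lift (algebraMap A (Disk A η)) norm_algebraMap_le (norm_newton_le h1 hy)
    (newtonS h1 hy f)
  rwa [show Disk.lift _ _ _ (newtonS h1 hy f) = f from newtonT_newtonS h1 hy f] at this

theorem newtonCoord_ext {f g : Disk A η}
    (h : ∀ k, newtonCoord h1 hy k f = newtonCoord h1 hy k g) : f = g := by
  have h2 := hasSum_newton h1 hy f
  simp only [h] at h2
  exact h2.unique (hasSum_newton h1 hy g)

/-- The series whose first `n` Newton coordinates vanish. -/
def newtonIdeal (n : ℕ) : Ideal (Disk A η) where
  carrier := {f | ∀ k < n, newtonCoord h1 hy k f = 0}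
  add_mem' hf hg k hk := by rw [map_add, hf k hk, hg k hk, add_zero]
  zero_mem' k _ := map_zero _
  smul_mem' g f hf k hk := by
    -- The product of ξ with the j-th basis element involves only the indices j and j + 1, so
    -- multiplication by ξ never lowers the index. Powers of ξ follow by induction, and arbitrary
    -- multipliers by continuity.
    have hxi : ∀ f : Disk A η, (∀ k < n, newtonCoord h1 hy k f = 0) →
        ∀ k < n, newtonCoord h1 hy k (Disk.xi * f) = 0 := by
      intro f hf k hk
      have h2 := ((hasSum_newton h1 hy f).mul_left Disk.xi).map _ (continuous_newtonCoord h1 hy k)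
      refine h2.unique ?_
      convert hasSum_zero with j
      simp only [Function.comp]
      rw [mul_left_comm, newtonCoord_algebraMap_mul, xi_mul_newton, map_sub,
        newtonCoord_algebraMap_mul, newtonCoord_newton, newtonCoord_newton]
      by_cases hj : j < n
      · rw [hf j hj, zero_mul]
      · rw [if_neg (by omega), if_neg (by omega)]; simp
    have hpow : ∀ j, ∀ k < n, newtonCoord h1 hy k (Disk.xi ^ j * f) = 0 := by
      intro j
      induction j with
      | zero => simpa using hf
      | succ j ih => simpa only [pow_succ', mul_assoc] using hxi _ ih
    have := DFunLike.congr_fun (Disk.addHom_ext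
      (φ := (newtonCoord h1 hy k).comp (AddMonoidHom.mulRight f)) (ψ := 0) h1
      ((continuous_newtonCoord h1 hy k).comp (continuous_id.mul continuous_const))
      continuous_const fun a j => by
        simp only [AddMonoidHom.comp_apply, AddMonoidHom.coe_mulRight, AddMonoidHom.zero_apply]
        rw [mul_assoc, newtonCoord_algebraMap_mul, hpow j k hk, mul_zero]) g
    simpa using this

end Newton

/-! ### Completed tensor products: ultrametric inequality and universal property -/

section CompletedTensorLemmas

universe u v

variable {S : Type v} {B C D : Type u} [CommRing S] [NormedCommRing B] [NormedCommRing C]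
  [Algebra S B] [Algebra S C]

instance : IsUltrametricDist (PreTensor S B C) :=
  IsUltrametricDist.isUltrametricDist_of_forall_norm_add_le_max_norm fun t u => by
    refine le_of_forall_pos_le_add fun ε hε => ?_
    obtain ⟨M, hM, h⟩ := exists_bound_lt (S := S) (B := B) (C := C) t hε
    obtain ⟨M', hM', h'⟩ := exists_bound_lt (S := S) (B := B) (C := C) u hε
    refine (tensorSeminorm_le (tensorBounds_add hM hM')).trans ?_
    rw [← max_add_add_right]
    exact max_le_max h.le h'.le

theorem isUltrametricDist_completion (E : Type*) [SeminormedAddCommGroup E] [IsUltrametricDist E] :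
    IsUltrametricDist (UniformSpace.Completion E) :=
  IsUltrametricDist.isUltrametricDist_of_forall_norm_add_le_max_norm fun x y => by
    induction x, y using UniformSpace.Completion.induction_on₂ with
    | hp =>
      exact isClosed_le (by fun_prop) (by fun_prop)
    | ih a b =>
      rw [← UniformSpace.Completion.coe_add, UniformSpace.Completion.norm_coe,
        UniformSpace.Completion.norm_coe, UniformSpace.Completion.norm_coe]
      exact IsUltrametricDist.norm_add_le_max a b

instance : IsUltrametricDist (CTensor S B C) := isUltrametricDist_completion _

theorem ctmul_mul_ctmul (b b' : B) (c c' : C) :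
    ctmul S b c * ctmul S b' c' = ctmul S (b * b') (c * c') := by
  rw [ctmul, ctmul, ctmul, ← UniformSpace.Completion.coe_mul, ← map_mul,
    Algebra.TensorProduct.tmul_mul_tmul]

theorem ctmul_add (b : B) (c c' : C) : ctmul S b (c + c') = ctmul S b c + ctmul S b c' := by
  rw [ctmul, ctmul, ctmul, ← UniformSpace.Completion.coe_add, ← map_add, TensorProduct.tmul_add]

theorem smul_ctmul (s : S) (b : B) (c : C) : ctmul S (s • b) c = ctmul S b (s • c) := by
  rw [ctmul, ctmul, TensorProduct.smul_tmul]

theorem norm_ctmul_le (b : B) (c : C) : ‖ctmul S b c‖ ≤ ‖b‖ * ‖c‖ := by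
  rw [ctmul, UniformSpace.Completion.norm_coe]
  exact tensorSeminorm_tmul_le b c

variable (S) in
/-- The additive map `c ↦ b ⊗ c`. -/
def ctmulLeft (b : B) : C →+ CTensor S B C := AddMonoidHom.mk' (ctmul S b) (ctmul_add b)

variable (S B) in
/-- The ring homomorphism `c ↦ 1 ⊗ c` from `C` to `B ⊗̂_S C`. -/
def inclRight : C →+* CTensor S B C where
  toFun := ctmul S 1
  map_one' := rfl
  map_mul' c c' := by rw [ctmul_mul_ctmul, mul_one]
  map_zero' := (ctmulLeft S (1 : B)).map_zero
  map_add' := ctmul_add 1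

theorem inclRight_apply (c : C) : inclRight S B c = ctmul S 1 c := rfl

theorem inclLeft_apply (b : B) : inclLeft S B C b = ctmul S b 1 := rfl

theorem inclLeft_mul_ctmul (a b : B) (c : C) :
    inclLeft S B C a * ctmul S b c = ctmul S (a * b) c := by
  rw [inclLeft_apply, ctmul_mul_ctmul, one_mul]

theorem inclLeft_mul_inclRight (b : B) (c : C) :
    inclLeft S B C b * inclRight S B c = ctmul S b c := by
  rw [inclRight_apply, inclLeft_mul_ctmul, mul_one]

theorem inclLeft_algebraMap (s : S) :
    inclLeft S B C (algebraMap S B s) = inclRight S B (algebraMap S C s) := by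
  rw [inclLeft_apply, inclRight_apply, Algebra.algebraMap_eq_smul_one,
    Algebra.algebraMap_eq_smul_one, smul_ctmul]

theorem norm_inclLeft_le (hC : ‖(1 : C)‖ ≤ 1) (b : B) : ‖inclLeft S B C b‖ ≤ ‖b‖ :=
  (norm_ctmul_le b 1).trans (mul_le_of_le_one_right (norm_nonneg _) hC)

theorem norm_inclRight_le (hB : ‖(1 : B)‖ ≤ 1) (c : C) : ‖inclRight S B c‖ ≤ ‖c‖ :=
  (norm_ctmul_le 1 c).trans (mul_le_of_le_one_left (norm_nonneg _) hB)

theorem CTensor.addHom_ext {E : Type*} [AddCommGroup E] [TopologicalSpace E] [T2Space E]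
    {φ ψ : CTensor S B C →+ E} (hφ : Continuous φ) (hψ : Continuous ψ)
    (h : ∀ b c, φ (ctmul S b c) = ψ (ctmul S b c)) : φ = ψ := by
  refine DFunLike.coe_injective (UniformSpace.Completion.ext hφ hψ fun t => ?_)
  change B ⊗[S] C at t
  induction t using TensorProduct.induction_on with
  | zero => exact (map_zero φ).trans (map_zero ψ).symm
  | tmul b c => exact h b c
  | add t u ht hu =>
    have e : ((toPre S B C (t + u) : PreTensor S B C) : CTensor S B C) =
        ((toPre S B C t : PreTensor S B C) : CTensor S B C) +
          ((toPre S B C u : PreTensor S B C) : CTensor S B C) := by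
      rw [map_add, UniformSpace.Completion.coe_add]
    exact (congrArg φ e).trans ((map_add φ _ _).trans
      ((congrArg₂ _ ht hu).trans ((map_add ψ _ _).symm.trans (congrArg ψ e).symm)))

theorem CTensor.ringHom_ext {E : Type*} [CommRing E] [TopologicalSpace E] [T2Space E]
    {φ ψ : CTensor S B C →+* E} (hφ : Continuous φ) (hψ : Continuous ψ)
    (h : ∀ b c, φ (ctmul S b c) = ψ (ctmul S b c)) : φ = ψ := by
  have : (φ : CTensor S B C →+ E) = ψ := CTensor.addHom_ext hφ hψ h
  ext t
  exact DFunLike.congr_fun this t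

theorem norm_le_mul_tensorSeminorm {E : Type*} [SeminormedAddCommGroup E] [IsUltrametricDist E]
    (φ : B ⊗[S] C →+ E) {M : ℝ} (hM : 0 ≤ M)
    (h : ∀ b c, ‖φ (b ⊗ₜ c)‖ ≤ M * (‖b‖ * ‖c‖)) (t : B ⊗[S] C) :
    ‖φ t‖ ≤ M * tensorSeminorm t := by
  have key : ∀ c ∈ tensorBounds t, ‖φ t‖ ≤ M * c := by
    rintro c ⟨h0, l, rfl, hl⟩
    induction l with
    | nil => simpa using mul_nonneg hM h0
    | cons p l ih =>
      rw [List.map_cons, List.sum_cons, map_add]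
      refine (IsUltrametricDist.norm_add_le_max _ _).trans (max_le ?_ ?_)
      · exact (h _ _).trans (mul_le_mul_of_nonneg_left (hl p (by simp)) hM)
      · exact ih fun q hq => hl q (by simp [hq])
  -- Passing to the infimum divides by M; when M = 0, any single expression of the tensor already
  -- gives the bound.
  rcases hM.eq_or_lt with rfl | hM
  · obtain ⟨c, hc⟩ := tensorBounds_nonempty t
    simpa using key c hc
  · rw [← div_le_iff₀' hM]
    exact le_csInf (tensorBounds_nonempty t) fun c hc => (div_le_iff₀' hM).2 (key c hc)

variable [NormedCommRing D] [IsUltrametricDist D]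

/-- The ring homomorphism `b ⊗ c ↦ f(b) g(c)` on the algebraic tensor product. -/
def preLift (f : B →+* D) (g : C →+* D)
    (hfg : ∀ s, f (algebraMap S B s) = g (algebraMap S C s)) : PreTensor S B C →+* D :=
  letI := (f.comp (algebraMap S B)).toAlgebra
  (Algebra.TensorProduct.productMap
    (AlgHom.mk f (fun _ => rfl) : B →ₐ[S] D)
    (AlgHom.mk g (fun s => (hfg s).symm) : C →ₐ[S] D) : B ⊗[S] C →+* D).comp
    ((toPre S B C).symm : PreTensor S B C →+* B ⊗[S] C)

theorem preLift_tmul (f : B →+* D) (g : C →+* D)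
    (hfg : ∀ s, f (algebraMap S B s) = g (algebraMap S C s)) (b : B) (c : C) :
    preLift f g hfg (toPre S B C (b ⊗ₜ c)) = f b * g c :=
  letI := (f.comp (algebraMap S B)).toAlgebra
  Algebra.TensorProduct.productMap_apply_tmul _ _ _ _

theorem norm_preLift_le (f : B →+* D) (g : C →+* D)
    (hfg : ∀ s, f (algebraMap S B s) = g (algebraMap S C s)) {M : ℝ} (hM : 0 ≤ M)
    (h : ∀ b c, ‖f b * g c‖ ≤ M * (‖b‖ * ‖c‖)) (t : PreTensor S B C) :
    ‖preLift f g hfg t‖ ≤ M * ‖t‖ :=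
  norm_le_mul_tensorSeminorm (((preLift f g hfg).comp
    (toPre S B C : B ⊗[S] C →+* PreTensor S B C) : B ⊗[S] C →+* D) : B ⊗[S] C →+ D) hM
    (fun b c => by
      have := h b c
      rwa [← preLift_tmul f g hfg b c] at this) t

variable [CompleteSpace D]

/-- The ring homomorphism `b ⊗ c ↦ f(b) g(c)` on the completed tensor product. -/
def CTensor.lift (f : B →+* D) (g : C →+* D)
    (hfg : ∀ s, f (algebraMap S B s) = g (algebraMap S C s)) {M : ℝ} (hM : 0 ≤ M)
    (h : ∀ b c, ‖f b * g c‖ ≤ M * (‖b‖ * ‖c‖)) : CTensor S B C →+* D :=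
  UniformSpace.Completion.extensionHom (preLift f g hfg)
    (AddMonoidHomClass.continuous_of_bound _ M (norm_preLift_le f g hfg hM h))

section

variable (f : B →+* D) (g : C →+* D)
    (hfg : ∀ s, f (algebraMap S B s) = g (algebraMap S C s)) {M : ℝ} (hM : 0 ≤ M)
    (h : ∀ b c, ‖f b * g c‖ ≤ M * (‖b‖ * ‖c‖))

theorem CTensor.lift_ctmul (b : B) (c : C) : CTensor.lift f g hfg hM h (ctmul S b c) = f b * g c :=
  (UniformSpace.Completion.extensionHom_coe _ _ _).trans (preLift_tmul f g hfg b c)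

theorem CTensor.continuous_lift : Continuous (CTensor.lift f g hfg hM h) :=
  UniformSpace.Completion.continuous_extension

theorem CTensor.norm_lift_le (t : CTensor S B C) : ‖CTensor.lift f g hfg hM h t‖ ≤ M * ‖t‖ := by
  induction t using UniformSpace.Completion.induction_on with
  | hp =>
    exact isClosed_le (CTensor.continuous_lift f g hfg hM h).norm
      (continuous_const.mul continuous_norm)
  | ih t =>
    rw [UniformSpace.Completion.norm_coe]
    refine le_trans (le_of_eq ?_) (norm_preLift_le f g hfg hM h t)
    exact congrArg _ (UniformSpace.Completion.extensionHom_coe _ _ _)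

end

end CompletedTensorLemmas

/-! ### Expansions in an affinoid algebra with control of the coefficients -/

section Affinoid

variable {K A : Type*} [NontriviallyNormedField K] [IsUltrametricDist K] [CompleteSpace K]
  [NormedCommRing A] [IsUltrametricDist A] [CompleteSpace A] [NormedAlgebra K A]

theorem summable_smul_of_bounded {ι E : Type*} [NormedAddCommGroup E] [IsUltrametricDist E]
    [CompleteSpace E] [NormedSpace K E] {t : ι → E} {M : ℝ} (ht : ∀ i, ‖t i‖ ≤ M) {f : ι → K}
    (hf : Tendsto f cofinite (𝓝 0)) : Summable fun i => f i • t i := by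
  refine NonarchimedeanAddGroup.summable_of_tendsto_cofinite_zero ?_
  rw [tendsto_zero_iff_norm_tendsto_zero] at hf ⊢
  have := hf.mul_const M
  rw [zero_mul] at this
  refine squeeze_zero (fun _ => norm_nonneg _) (fun i => ?_) this
  rw [norm_smul]
  exact mul_le_mul_of_nonneg_left (ht i) (norm_nonneg _)

/-- Bounded coefficients for a family that spans a Banach space with coefficients tending to `0`. -/
theorem exists_bounded_expansion {ι E : Type*} [NormedAddCommGroup E] [IsUltrametricDist E]
    [CompleteSpace E] [NormedSpace K E] {t : ι → E} {M : ℝ} (hM : 0 ≤ M) (ht : ∀ i, ‖t i‖ ≤ M)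
    (h : ∀ b : E, ∃ f : ι → K, Tendsto f cofinite (𝓝 0) ∧ HasSum (fun i => f i • t i) b) :
    ∃ C : ℝ, 0 ≤ C ∧ ∀ b : E, ∃ f : ι → K, (∀ i, ‖f i‖ ≤ C * ‖b‖) ∧
      Tendsto f cofinite (𝓝 0) ∧ HasSum (fun i => f i • t i) b := by
  -- For the discrete topology, functions vanishing at infinity are families tending to 0, so the
  -- coefficient families form the Banach space c₀(ι, K).
  let _ : TopologicalSpace ι := ⊥
  have : DiscreteTopology ι := ⟨rfl⟩
  have hz : ∀ f : ZeroAtInftyContinuousMap ι K, Tendsto f cofinite (𝓝 0) := fun f => by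
    have := f.zero_at_infty'
    rwa [cocompact_eq_cofinite] at this
  have hn : ∀ (f : ZeroAtInftyContinuousMap ι K) i, ‖f i‖ ≤ ‖f‖ := fun f i => by
    rw [← ZeroAtInftyContinuousMap.norm_toBCF_eq_norm]
    exact f.toBCF.norm_coe_le_norm i
  let Λ₀ : ZeroAtInftyContinuousMap ι K →ₗ[K] E :=
    { toFun := fun f => ∑' i, f i • t i
      map_add' := fun f g => by
        rw [← (summable_smul_of_bounded ht (hz f)).tsum_add (summable_smul_of_bounded ht (hz g))]
        simp only [ZeroAtInftyContinuousMap.add_apply, add_smul]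
      map_smul' := fun c f => by
        rw [RingHom.id_apply, ← (summable_smul_of_bounded ht (hz f)).tsum_const_smul]
        simp only [ZeroAtInftyContinuousMap.smul_apply, smul_eq_mul, mul_smul] }
  let Λ : ZeroAtInftyContinuousMap ι K →L[K] E := Λ₀.mkContinuous M fun f => by
    refine IsUltrametricDist.norm_tsum_le_of_forall_le_of_nonneg (by positivity) fun i => ?_
    rw [norm_smul, mul_comm]
    exact mul_le_mul (ht i) (hn f i) (norm_nonneg _) hM
  have hsurj : Function.Surjective Λ := fun b => by
    obtain ⟨f, hf, hs⟩ := h b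
    refine ⟨⟨⟨f, continuous_of_discreteTopology⟩, ?_⟩, hs.tsum_eq⟩
    rwa [cocompact_eq_cofinite]
  -- The open mapping theorem supplies the constant C.
  obtain ⟨C, hC, hΛ⟩ := Λ.exists_preimage_norm_le hsurj
  refine ⟨C, hC.le, fun b => ?_⟩
  obtain ⟨f, rfl, hf⟩ := hΛ b
  exact ⟨f, fun i => (hn f i).trans hf, hz f, (summable_smul_of_bounded ht (hz f)).hasSum⟩

theorem finsupp_prod_one_pow {N : ℕ} (α : Fin N →₀ ℕ) :
    α.prod (fun _ x => (1 : ℝ) ^ x) = 1 := by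
  simp [Finsupp.prod]

/-- In an affinoid algebra every element is a series of monomials, with bounded coefficients. -/
theorem IsAffinoid.exists_expansion (h : IsAffinoid K A) :
    ∃ (N : ℕ) (t : (Fin N →₀ ℕ) → A) (M C : ℝ), 0 ≤ M ∧ 0 ≤ C ∧ t 0 = 1 ∧
      (∀ α β, t (α + β) = t α * t β) ∧ (∀ α, ‖t α‖ ≤ M) ∧
      ∀ b, ∃ f : (Fin N →₀ ℕ) → K, (∀ α, ‖f α‖ ≤ C * ‖b‖) ∧ Tendsto f cofinite (𝓝 0) ∧
        HasSum (fun α => f α • t α) b := by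
  obtain ⟨N, π, hπ, hπK, M₀, hM₀⟩ := h
  set M := max M₀ 0
  have hM0 : 0 ≤ M := le_max_right _ _
  have hM : ∀ (F : Tate K N) (c : ℝ), (∀ α, ‖MvPowerSeries.coeff α (F : MvPowerSeries (Fin N) K)‖ ≤ c) →
      ‖π F‖ ≤ M * c := fun F c hc => by
    have h1 : MvPowerSeries.gaussNorm (fun a : K => ‖a‖) (fun _ => (1 : ℝ))
        (F : MvPowerSeries (Fin N) K) ≤ c := ciSup_le fun α => by
      rw [finsupp_prod_one_pow, mul_one]; exact hc α
    refine (hM₀ F).trans ((mul_le_mul_of_nonneg_right (le_max_left _ _)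
      (MvPowerSeries.gaussNorm_nonneg _ _ _ fun a => norm_nonneg a)).trans
        (mul_le_mul_of_nonneg_left h1 hM0))
  let mono : (Fin N →₀ ℕ) → K → Tate K N := fun α a =>
    ⟨MvPowerSeries.monomial α a, MvPowerSeries.isRestricted_monomial _ α a⟩
  let t : (Fin N →₀ ℕ) → A := fun α => π (mono α 1)
  have htmul : ∀ α β, t (α + β) = t α * t β := fun α β => by
    rw [← map_mul]
    refine congrArg π (Subtype.ext ?_)
    change MvPowerSeries.monomial (α + β) (1 : K) =
      MvPowerSeries.monomial α 1 * MvPowerSeries.monomial β 1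
    rw [MvPowerSeries.monomial_mul_monomial, one_mul]
  have htM : ∀ α, ‖t α‖ ≤ M := fun α => by
    classical
    refine (hM (mono α 1) 1 fun β => ?_).trans_eq (mul_one _)
    change ‖MvPowerSeries.coeff β (MvPowerSeries.monomial α (1 : K))‖ ≤ 1
    rw [MvPowerSeries.coeff_monomial]
    split_ifs <;> simp
  have hsmul : ∀ α (c : K), c • t α = π (mono α c) := fun α c => by
    rw [Algebra.smul_def, ← hπK, ← map_mul]
    refine congrArg π (Subtype.ext ?_)
    change MvPowerSeries.C c * MvPowerSeries.monomial α 1 = MvPowerSeries.monomial α c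
    rw [← MvPowerSeries.monomial_zero_eq_C_apply, MvPowerSeries.monomial_mul_monomial, zero_add,
      mul_one]
  obtain ⟨C, hC0, hC⟩ := exists_bounded_expansion (K := K) hM0 htM fun b => by
    classical
    obtain ⟨F, rfl⟩ := hπ b
    have hF : Tendsto (fun α => MvPowerSeries.coeff α (F : MvPowerSeries (Fin N) K)) cofinite
        (𝓝 0) := by
      rw [tendsto_zero_iff_norm_tendsto_zero]
      have h2 : MvPowerSeries.IsRestricted (fun _ => (1 : ℝ)) (F : MvPowerSeries (Fin N) K) := F.2
      unfold MvPowerSeries.IsRestricted at h2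
      refine h2.congr fun α => ?_
      rw [finsupp_prod_one_pow, mul_one]
    refine ⟨_, hF, ?_⟩
    simp only [hsmul]
    refine Metric.tendsto_nhds.2 fun ε hε => ?_
    obtain ⟨δ, hδ, hδε⟩ : ∃ δ > 0, M * δ < ε :=
      ⟨ε / (M + 1), by positivity, by
        rw [← mul_div_assoc, div_lt_iff₀ (by positivity)]; nlinarith⟩
    -- Once a partial sum contains these finitely many large terms, the rest of F has Gauss norm at
    -- most δ, and its image under π has norm at most M δ < ε.
    have hfin : {α | ¬ ‖MvPowerSeries.coeff α (F : MvPowerSeries (Fin N) K)‖ < δ}.Finite := by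
      have := (Metric.tendsto_nhds.1 hF) δ hδ
      simp only [dist_zero_right] at this
      exact Filter.eventually_cofinite.1 this
    refine (eventually_ge_atTop hfin.toFinset).mono fun s hs => ?_
    rw [dist_comm, dist_eq_norm, ← map_sum, ← map_sub]
    refine (hM _ δ fun β => ?_).trans_lt hδε
    have hcoe : ((F - ∑ α ∈ s, mono α (MvPowerSeries.coeff α (F : MvPowerSeries (Fin N) K)) :
        Tate K N) : MvPowerSeries (Fin N) K) = F - ∑ α ∈ s, MvPowerSeries.monomial α
          (MvPowerSeries.coeff α (F : MvPowerSeries (Fin N) K)) := by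
      rw [AddSubgroupClass.coe_sub, AddSubmonoidClass.coe_finsetSum]
    rw [hcoe, map_sub, map_sum]
    simp only [MvPowerSeries.coeff_monomial]
    rw [Finset.sum_ite_eq]
    split_ifs with hβ
    · simpa using hδ.le
    · rw [sub_zero]
      by_contra hcon
      exact hβ (hs (hfin.mem_toFinset.2 fun h => hcon h.le))
  refine ⟨N, t, M, C, hM0, hC0, ?_, htmul, htM, hC⟩
  rw [← map_one π]
  rfl

end Affinoid

/-! ### The action of σ on P and the evaluations a ⊗ b ↦ a ρ(b) -/

section Sigma

universe u v

variable {R : Type v} {A : Type u} [CommRing R] [NormedCommRing A] [Algebra R A]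

theorem sigmaP_ctmul (σ : A →ₐ[R] A) (hσ : Contractive σ) (a b : A) :
    sigmaP σ hσ (ctmul R a b) = ctmul R (σ a) b := by
  refine (UniformSpace.Completion.mapRingHom_coe (continuous_preSigma hσ) _).trans ?_
  refine congrArg _ ?_
  exact congrArg (toPre R A A) (Algebra.TensorProduct.map_tmul σ (AlgHom.id R A) a b)

theorem continuous_sigmaP (σ : A →ₐ[R] A) (hσ : Contractive σ) : Continuous (sigmaP σ hσ) :=
  UniformSpace.Completion.continuous_map

theorem norm_sigmaP_le (σ : A →ₐ[R] A) (hσ : Contractive σ) (p : PP R A) :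
    ‖sigmaP σ hσ p‖ ≤ ‖p‖ := by
  induction p using UniformSpace.Completion.induction_on with
  | hp => exact isClosed_le (continuous_sigmaP σ hσ).norm continuous_norm
  | ih t =>
    refine le_trans (le_of_eq ?_) ((preSigma_norm_le hσ t).trans_eq
      (UniformSpace.Completion.norm_coe t).symm)
    rw [← UniformSpace.Completion.norm_coe (preSigma σ t)]
    exact congrArg _ (UniformSpace.Completion.mapRingHom_coe (continuous_preSigma hσ) t)

theorem sigmaP_pow_ctmul (σ : A →ₐ[R] A) (hσ : Contractive σ) (i : ℕ) (a b : A) :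
    (sigmaP σ hσ ^ i) (ctmul R a b) = ctmul R ((σ ^ i) a) b := by
  induction i with
  | zero => rfl
  | succ i ih =>
    rw [pow_succ', RingHom.mul_def, RingHom.comp_apply, ih, sigmaP_ctmul, pow_succ']
    rfl

theorem norm_sigmaP_pow_le (σ : A →ₐ[R] A) (hσ : Contractive σ) (i : ℕ) (p : PP R A) :
    ‖(sigmaP σ hσ ^ i) p‖ ≤ ‖p‖ := by
  induction i with
  | zero => exact le_rfl
  | succ i ih =>
    rw [pow_succ', RingHom.mul_def, RingHom.comp_apply]
    exact (norm_sigmaP_le σ hσ _).trans ih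

theorem Contractive.pow {σ : A →ₐ[R] A} (hσ : Contractive σ) (i : ℕ) : Contractive (σ ^ i) := by
  induction i with
  | zero => exact fun z => le_rfl
  | succ i ih =>
    intro z
    rw [pow_succ']
    exact (hσ _).trans (ih z)

variable [IsUltrametricDist A] [CompleteSpace A]

/-- The ring homomorphism `a ⊗ b ↦ a ρ(b)` from `P` to `A`. -/
def evalAt (ρ : A →ₐ[R] A) (hρ : Contractive ρ) : PP R A →+* A :=
  CTensor.lift (RingHom.id A) (ρ : A →+* A) (fun s => (ρ.commutes s).symm) zero_le_one fun b c => by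
    rw [one_mul]
    exact (norm_mul_le _ _).trans (mul_le_mul_of_nonneg_left (hρ c) (norm_nonneg _))

theorem evalAt_ctmul (ρ : A →ₐ[R] A) (hρ : Contractive ρ) (a b : A) :
    evalAt ρ hρ (ctmul R a b) = a * ρ b :=
  CTensor.lift_ctmul _ _ _ _ _ _ _

theorem continuous_evalAt (ρ : A →ₐ[R] A) (hρ : Contractive ρ) : Continuous (evalAt ρ hρ) :=
  CTensor.continuous_lift _ _ _ _ _

theorem norm_evalAt_le (ρ : A →ₐ[R] A) (hρ : Contractive ρ) (p : PP R A) :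
    ‖evalAt ρ hρ p‖ ≤ ‖p‖ :=
  (CTensor.norm_lift_le _ _ _ _ _ p).trans_eq (one_mul _)

theorem mem_diagIdeal_iff {p : PP R A} :
    p ∈ diagIdeal R A ↔ evalAt (AlgHom.id R A) contractive_id p = 0 := by
  have : UniformSpace.Completion.extensionHom (preMul (R := R) (A := A)) continuous_preMul =
      evalAt (AlgHom.id R A) contractive_id := by
    refine CTensor.ringHom_ext UniformSpace.Completion.continuous_extension
      (continuous_evalAt _ _) fun a b => ?_
    rw [evalAt_ctmul]
    refine (UniformSpace.Completion.extensionHom_coe _ continuous_preMul _).trans ?_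
    exact Algebra.TensorProduct.lmul'_apply_tmul a b
  rw [diagIdeal, RingHom.mem_ker, this]

theorem inclRight_sub_inclLeft_mem (a : A) :
    inclRight R A a - inclLeft R A A a ∈ diagIdeal R A := by
  rw [mem_diagIdeal_iff, map_sub, inclRight_apply, inclLeft_apply, evalAt_ctmul, evalAt_ctmul]
  simp

theorem sigmaP_pow_inclRight_sub (σ : A →ₐ[R] A) (hσ : Contractive σ) (i : ℕ) (a b : A) :
    (sigmaP σ hσ ^ i) (inclRight R A a - inclLeft R A A b) =
      inclRight R A a - inclLeft R A A ((σ ^ i) b) := by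
  rw [map_sub, inclRight_apply, inclLeft_apply, sigmaP_pow_ctmul, sigmaP_pow_ctmul, map_one]
  rfl

end Sigma

/-! ### Finite generation of I, and P modulo the ideal of σⁱ(I) -/

section Generators

universe u v

variable {K : Type*} {R : Type v} {A : Type u} [NontriviallyNormedField K] [IsUltrametricDist K]
  [CompleteSpace K] [CommRing R] [Algebra K R] [NormedCommRing A] [IsUltrametricDist A]
  [CompleteSpace A] [NormedAlgebra K A] [Algebra R A] [IsScalarTower K R A]

/-- `A ⊗̂_R A` is a normed space over `K`, by the action on the left. -/
abbrev normedSpacePP (K : Type*) {R : Type v} {A : Type u} [NontriviallyNormedField K] [CommRing R]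
    [NormedCommRing A] [NormedAlgebra K A] [Algebra R A] (hA1 : ‖(1 : A)‖ ≤ 1) :
    NormedSpace K (PP R A) where
  __ := Module.compHom (PP R A) ((inclLeft R A A).comp (algebraMap K A))
  norm_smul_le k p := by
    change ‖inclLeft R A A (algebraMap K A k) * p‖ ≤ _
    refine (norm_mul_le _ _).trans (mul_le_mul_of_nonneg_right ?_ (norm_nonneg _))
    refine (norm_inclLeft_le hA1 _).trans ?_
    rw [norm_algebraMap]
    exact mul_le_of_le_one_right (norm_nonneg _) hA1

/-- Induction on the exponent, by 1 ⊗ uv - uv ⊗ 1 = (1 ⊗ v)(1 ⊗ u - u ⊗ 1) + (u ⊗ 1)(1 ⊗ v - v ⊗ 1).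
The coefficients stay in the additive group generated by tensors of monomials; by the ultrametric
inequality they are then bounded uniformly in α, however many terms occur. -/
theorem exists_diff_decomposition {N : ℕ} {t : (Fin N →₀ ℕ) → A} (ht0 : t 0 = 1)
    (ht : ∀ α β, t (α + β) = t α * t β) (α : Fin N →₀ ℕ) :
    ∃ q : Fin N → PP R A,
      (∀ j, q j ∈ AddSubgroup.closure (Set.range fun p : (Fin N →₀ ℕ) × (Fin N →₀ ℕ) =>
        ctmul R (t p.1) (t p.2))) ∧
      inclRight R A (t α) - inclLeft R A A (t α) = ∑ j, (inclRight R A (t (Finsupp.single j 1)) -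
        inclLeft R A A (t (Finsupp.single j 1))) * q j := by
  set G := AddSubgroup.closure (Set.range fun p : (Fin N →₀ ℕ) × (Fin N →₀ ℕ) =>
        ctmul R (t p.1) (t p.2))
  have hG : ∀ β γ, ∀ g ∈ G, ctmul R (t β) (t γ) * g ∈ G := fun β γ g hg => by
    induction hg using AddSubgroup.closure_induction with
    | mem x hx =>
      obtain ⟨p, rfl⟩ := hx
      exact AddSubgroup.subset_closure
        ⟨(β + p.1, γ + p.2), by simp only [ht, ctmul_mul_ctmul]⟩
    | zero => rw [mul_zero]; exact zero_mem _
    | add x y _ _ hx hy => rw [mul_add]; exact add_mem hx hy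
    | neg x _ hx => rw [mul_neg]; exact neg_mem hx
  have hadd : ∀ α β : Fin N →₀ ℕ,
      (∃ q : Fin N → PP R A, (∀ j, q j ∈ G) ∧
      inclRight R A (t α) - inclLeft R A A (t α) = ∑ j, (inclRight R A (t (Finsupp.single j 1)) -
        inclLeft R A A (t (Finsupp.single j 1))) * q j) →
      (∃ q : Fin N → PP R A, (∀ j, q j ∈ G) ∧
      inclRight R A (t β) - inclLeft R A A (t β) = ∑ j, (inclRight R A (t (Finsupp.single j 1)) -
        inclLeft R A A (t (Finsupp.single j 1))) * q j) →
      ∃ q : Fin N → PP R A, (∀ j, q j ∈ G) ∧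
      inclRight R A (t (α + β)) - inclLeft R A A (t (α + β)) =
        ∑ j, (inclRight R A (t (Finsupp.single j 1)) -
        inclLeft R A A (t (Finsupp.single j 1))) * q j := by
    rintro α β ⟨q, hq, hq'⟩ ⟨r, hr, hr'⟩
    refine ⟨fun j => inclRight R A (t β) * q j + inclLeft R A A (t α) * r j, fun j => ?_, ?_⟩
    · refine add_mem ?_ ?_
      · have := hG 0 β _ (hq j)
        rwa [ht0] at this
      · have := hG α 0 _ (hr j)
        rwa [ht0] at this
    · have e : ∀ j, (inclRight R A (t (Finsupp.single j 1)) -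
          inclLeft R A A (t (Finsupp.single j 1))) *
          (inclRight R A (t β) * q j + inclLeft R A A (t α) * r j) =
          inclRight R A (t β) * ((inclRight R A (t (Finsupp.single j 1)) -
          inclLeft R A A (t (Finsupp.single j 1))) * q j) +
          inclLeft R A A (t α) * ((inclRight R A (t (Finsupp.single j 1)) -
          inclLeft R A A (t (Finsupp.single j 1))) * r j) := fun j => by ring
      simp only [e]
      rw [Finset.sum_add_distrib, ← Finset.mul_sum, ← Finset.mul_sum, ← hq', ← hr', ht, map_mul,
        map_mul]
      ring
  have hzero : ∃ q : Fin N → PP R A, (∀ j, q j ∈ G) ∧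
      inclRight R A (t 0) - inclLeft R A A (t 0) = ∑ j, (inclRight R A (t (Finsupp.single j 1)) -
        inclLeft R A A (t (Finsupp.single j 1))) * q j :=
    ⟨0, fun j => zero_mem _, by simp [ht0]⟩
  induction α using Finsupp.induction_linear with
  | zero => exact hzero
  | add α β hα hβ => exact hadd α β hα hβ
  | single i n =>
    induction n with
    | zero => rwa [Finsupp.single_zero]
    | succ n ih =>
      rw [Finsupp.single_add]
      refine hadd _ _ ih ⟨Pi.single i 1, fun j => ?_, ?_⟩
      · by_cases h : j = i
        · subst h
          rw [Pi.single_eq_same]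
          exact AddSubgroup.subset_closure ⟨(0, 0), by simp only [ht0]; rfl⟩
        · rw [Pi.single_eq_of_ne h]; exact zero_mem _
      · rw [Finset.sum_eq_single i]
        · simp
        · intro j _ hj; rw [Pi.single_eq_of_ne hj, mul_zero]
        · simp

/-- The differences `1 ⊗ b - b ⊗ 1` are combinations, with bounded coefficients, of finitely many. -/
theorem IsAffinoid.exists_diff_generators (h : IsAffinoid K A) (hA1 : ‖(1 : A)‖ ≤ 1) :
    ∃ (N : ℕ) (t : Fin N → A) (D : ℝ), 0 ≤ D ∧ ∀ b : A, ∃ q : Fin N → PP R A,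
      (∀ j, ‖q j‖ ≤ D * ‖b‖) ∧ inclRight R A b - inclLeft R A A b =
        ∑ j, (inclRight R A (t j) - inclLeft R A A (t j)) * q j := by
  obtain ⟨N, t, M, C, hM, hC, ht0, htmul, htM, hexp⟩ := h.exists_expansion
  let _ := normedSpacePP K (R := R) hA1
  have hsmul : ∀ (k : K) (p : PP R A), k • p = inclLeft R A A (algebraMap K A k) * p :=
    fun _ _ => rfl
  choose q hqG hq using exists_diff_decomposition (R := R) ht0 htmul
  have hqM : ∀ α j, ‖q α j‖ ≤ M * M := fun α j => by
    have hg := hqG α j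
    generalize q α j = g at hg
    induction hg using AddSubgroup.closure_induction with
    | mem x hx =>
      obtain ⟨p, rfl⟩ := hx
      exact (norm_ctmul_le _ _).trans (mul_le_mul (htM _) (htM _) (norm_nonneg _) hM)
    | zero => rw [norm_zero]; positivity
    | add x y _ _ hx hy => exact (IsUltrametricDist.norm_add_le_max _ _).trans (max_le hx hy)
    | neg x _ hx => rwa [norm_neg]
  refine ⟨N, fun j => t (Finsupp.single j 1), C * (M * M), by positivity, fun b => ?_⟩
  obtain ⟨f, hfC, hf0, hfb⟩ := hexp b
  have hsum : ∀ j, Summable fun α => f α • q α j := fun j =>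
    summable_smul_of_bounded (fun α => hqM α j) hf0
  refine ⟨fun j => ∑' α, f α • q α j, fun j => ?_, ?_⟩
  · refine IsUltrametricDist.norm_tsum_le_of_forall_le_of_nonneg (by positivity) fun α => ?_
    rw [norm_smul]
    refine (mul_le_mul (hfC α) (hqM α j) (norm_nonneg _) (by positivity)).trans_eq (by ring)
  · let Δ : A →+ PP R A := ((inclRight R A : A →+* PP R A) : A →+ PP R A) -
      ((inclLeft R A A : A →+* PP R A) : A →+ PP R A)
    have hΔ : Continuous Δ := AddMonoidHomClass.continuous_of_bound Δ 1 fun a => by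
      rw [one_mul]
      exact (norm_sub_le_max' _ _).trans
        (max_le (norm_inclRight_le hA1 a) (norm_inclLeft_le hA1 a))
    have h1 := hfb.map Δ hΔ
    have h2 : HasSum (fun α => ∑ j, (inclRight R A (t (Finsupp.single j 1)) -
        inclLeft R A A (t (Finsupp.single j 1))) * (f α • q α j))
        (∑ j, (inclRight R A (t (Finsupp.single j 1)) -
        inclLeft R A A (t (Finsupp.single j 1))) * ∑' α, f α • q α j) :=
      hasSum_sum fun j _ => (hsum j).hasSum.mul_left _
    refine h1.unique ?_
    convert h2 using 2 with α
    change inclRight R A (f α • t α) - inclLeft R A A (f α • t α) = _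
    -- Scalars from K come from R, hence cross the tensor sign.
    have h3 : inclRight R A (algebraMap K A (f α)) = inclLeft R A A (algebraMap K A (f α)) := by
      rw [IsScalarTower.algebraMap_apply K R A, inclLeft_algebraMap]
    rw [Algebra.smul_def, map_mul, map_mul, h3, ← mul_sub, hq, Finset.mul_sum]
    refine Finset.sum_congr rfl fun j _ => ?_
    rw [hsmul]; ring

/-- `q - μ(q) ⊗ 1` lies in the ideal generated by finitely many differences `1 ⊗ t - ρ(t) ⊗ 1`, for
`ρ = σⁱ` and `μ (a ⊗ b) = a ρ(b)`. -/
theorem IsAffinoid.exists_generators (h : IsAffinoid K A) (hA1 : ‖(1 : A)‖ ≤ 1) :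
    ∃ (N : ℕ) (t : Fin N → A), ∀ (σ : A →ₐ[R] A) (hσ : Contractive σ) (i : ℕ) (p : PP R A),
      p - inclLeft R A A (evalAt (σ ^ i) (hσ.pow i) p) ∈
        Ideal.span (Set.range fun j => inclRight R A (t j) - inclLeft R A A ((σ ^ i) (t j))) := by
  obtain ⟨N, t, D, hD, hdec⟩ := IsAffinoid.exists_diff_generators (R := R) h hA1
  refine ⟨N, t, fun σ hσ i p => ?_⟩
  set μ := evalAt (σ ^ i) (hσ.pow i) with hμ
  set τ : Fin N → PP R A := fun j => inclRight R A (t j) - inclLeft R A A ((σ ^ i) (t j)) with hτ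
  -- Apply the contraction σ_P iterated i times to the decomposition of 1 ⊗ b - b ⊗ 1: the constant
  -- D survives.
  have hdec' : ∀ b : A, ∃ q : Fin N → PP R A, (∀ j, ‖q j‖ ≤ D * ‖b‖) ∧
      inclRight R A b - inclLeft R A A ((σ ^ i) b) = ∑ j, τ j * q j := fun b => by
    obtain ⟨q, hq, hq'⟩ := hdec b
    refine ⟨fun j => (sigmaP σ hσ ^ i) (q j),
      fun j => (norm_sigmaP_pow_le σ hσ i _).trans (hq j), ?_⟩
    rw [← sigmaP_pow_inclRight_sub σ hσ, hq', map_sum]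
    refine Finset.sum_congr rfl fun j _ => ?_
    rw [map_mul, sigmaP_pow_inclRight_sub]
  -- The bound does not depend on the length of the list, again because the norm is ultrametric.
  have hlist : ∀ (M : ℝ), 0 ≤ M → ∀ l : List (A × A), (∀ p ∈ l, ‖p.1‖ * ‖p.2‖ ≤ M) →
      ∃ r : Fin N → PP R A, (∀ j, ‖r j‖ ≤ D * M) ∧
        (l.map fun p => ctmul R p.1 p.2).sum -
          inclLeft R A A (μ (l.map fun p => ctmul R p.1 p.2).sum) = ∑ j, τ j * r j := by
    intro M hM l hl
    induction l with
    | nil => exact ⟨0, fun j => by simpa using mul_nonneg hD hM, by simp⟩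
    | cons p l ih =>
      obtain ⟨r, hr, hr'⟩ := ih fun q hq => hl q (by simp [hq])
      obtain ⟨q, hq, hq'⟩ := hdec' p.2
      refine ⟨fun j => inclLeft R A A p.1 * q j + r j, fun j => ?_, ?_⟩
      · refine (IsUltrametricDist.norm_add_le_max _ _).trans (max_le ?_ (hr j))
        refine (norm_mul_le _ _).trans ?_
        calc _ ≤ ‖p.1‖ * (D * ‖p.2‖) := mul_le_mul (norm_inclLeft_le hA1 _) (hq j)
              (norm_nonneg _) (norm_nonneg _)
          _ = D * (‖p.1‖ * ‖p.2‖) := by ring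
          _ ≤ D * M := mul_le_mul_of_nonneg_left (hl p (by simp)) hD
      · rw [List.map_cons, List.sum_cons, map_add, map_add, add_sub_add_comm, hr']
        simp only [mul_add, Finset.sum_add_distrib]
        congr 1
        rw [hμ, evalAt_ctmul, map_mul, ← inclLeft_mul_inclRight, ← mul_sub, hq', Finset.mul_sum]
        exact Finset.sum_congr rfl fun j _ => by ring
  -- The decomposition is so far known only for algebraic tensors. With norm control on that dense
  -- subgroup, F hits every element of its closure, which is all of P.
  let F : NormedAddGroupHom ((Fin N → PP R A) × A) (PP R A) :=
    AddMonoidHom.mkNormedAddGroupHom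
      (AddMonoidHom.mk' (fun g => ∑ j, τ j * g.1 j + inclLeft R A A g.2) fun g g' => by
        simp only [Prod.fst_add, Prod.snd_add, Pi.add_apply, mul_add, map_add,
          Finset.sum_add_distrib]
        ring) (∑ j, ‖τ j‖ + 1) fun g => by
      rw [AddMonoidHom.mk'_apply, add_mul, one_mul, Finset.sum_mul]
      refine (norm_add_le _ _).trans (add_le_add ((norm_sum_le _ _).trans
        (Finset.sum_le_sum fun j _ => ?_)) ((norm_inclLeft_le hA1 _).trans (norm_snd_le g)))
      exact (norm_mul_le _ _).trans (mul_le_mul_of_nonneg_left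
        ((norm_le_pi_norm g.1 j).trans (norm_fst_le g)) (norm_nonneg _))
  let Q : AddSubgroup (PP R A) := (UniformSpace.Completion.coeRingHom
    (α := PreTensor R A A)).toAddMonoidHom.range
  -- The tensor seminorm is an infimum, so it is approximated within an error ‖s‖: this gives the
  -- factor 2, and requires ‖s‖ > 0. The constant 1 handles the component in A, by contractivity of
  -- μ.
  have hsurj : F.SurjectiveOnWith Q (max (D * 2) 1) := by
    rintro _ ⟨s, rfl⟩
    change ∃ g, F g = (s : PP R A) ∧ ‖g‖ ≤ max (D * 2) 1 * ‖(s : PP R A)‖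
    rcases eq_or_ne (s : PP R A) 0 with h0 | h0
    · exact ⟨0, by rw [h0, map_zero], by simp⟩
    have hpos : 0 < ‖(s : PP R A)‖ := norm_pos_iff.2 h0
    obtain ⟨M, ⟨hM0, l, hl, hlM⟩, hM⟩ := exists_bound_lt (S := R) (B := A) (C := A) s
      (ε := ‖(s : PP R A)‖) hpos
    have hM' : M ≤ 2 * ‖(s : PP R A)‖ := by
      have : tensorSeminorm (S := R) (B := A) (C := A) s = ‖(s : PP R A)‖ :=
        (UniformSpace.Completion.norm_coe s).symm
      rw [this] at hM
      linarith
    have hs : (s : PP R A) = (l.map fun p => ctmul R p.1 p.2).sum := by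
      have : s = (l.map fun p => toPre R A A (p.1 ⊗ₜ[R] p.2)).sum := hl
      rw [this]
      refine (map_list_sum (UniformSpace.Completion.coeRingHom (α := PreTensor R A A)) _).trans ?_
      rw [List.map_map]
      rfl
    obtain ⟨r, hr, hr'⟩ := hlist M hM0 l hlM
    refine ⟨(r, μ (s : PP R A)), ?_, ?_⟩
    · change ∑ j, τ j * r j + inclLeft R A A (μ (s : PP R A)) = _
      rw [← hr', hs, sub_add_cancel]
    · rw [Prod.norm_def]
      refine max_le ((pi_norm_le_iff_of_nonneg (by positivity)).2 fun j => ?_) ?_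
      · refine (hr j).trans ((mul_le_mul_of_nonneg_left hM' hD).trans ?_)
        rw [← mul_assoc]
        exact mul_le_mul_of_nonneg_right (le_max_left _ _) (norm_nonneg _)
      · refine (norm_evalAt_le _ _ _).trans ?_
        exact le_mul_of_one_le_left (norm_nonneg _) (le_max_right _ _)
  have hcl := controlled_closure_of_complete (lt_max_of_lt_right one_pos) one_pos hsurj
  have hdense : p ∈ Q.topologicalClosure := by
    have := UniformSpace.Completion.denseRange_coe (α := PreTensor R A A) p
    exact this
  obtain ⟨g, hg, -⟩ := hcl p hdense
  have hg' : p = ∑ j, τ j * g.1 j + inclLeft R A A g.2 := hg.symm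
  -- As μ kills each τ j, the component of the preimage in A must be μ(p).
  have hτμ : ∀ j, μ (τ j) = 0 := fun j => by
    rw [hμ, hτ]
    simp only [map_sub, inclRight_apply, inclLeft_apply, evalAt_ctmul, map_one, one_mul, mul_one,
      sub_self]
  have hμp : μ p = g.2 := by
    rw [hg', map_add, map_sum, Finset.sum_eq_zero, zero_add, inclLeft_apply, hμ, evalAt_ctmul,
      map_one, mul_one]
    intro j _
    rw [map_mul, hτμ, zero_mul]
  rw [hμp]
  nth_rewrite 1 [hg']
  rw [add_sub_cancel_right]
  exact Ideal.sum_mem _ fun j _ => Ideal.mul_mem_right _ _ (Ideal.subset_span ⟨j, rfl⟩)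

/-- The identity endomorphism gives finitely many generators of I. For general σ and i, the
generators 1 ⊗ t - σⁱ(t) ⊗ 1 are images of elements of I, so modulo σⁱ(I)P an element of P is
represented by its value under a ⊗ b ↦ a σⁱ(b). -/
theorem IsAffinoid.exists_span_diagIdeal (h : IsAffinoid K A) (hA1 : ‖(1 : A)‖ ≤ 1) :
    ∃ (N : ℕ) (t : Fin N → A), diagIdeal R A =
      Ideal.span (Set.range fun j => inclRight R A (t j) - inclLeft R A A (t j)) ∧
      ∀ (σ : A →ₐ[R] A) (hσ : Contractive σ) (i : ℕ) (p : PP R A),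
        p - inclLeft R A A (evalAt (σ ^ i) (hσ.pow i) p) ∈
          (diagIdeal R A).map (sigmaP σ hσ ^ i) := by
  obtain ⟨N, t, ht⟩ := IsAffinoid.exists_generators (R := R) h hA1
  refine ⟨N, t, le_antisymm (fun p hp => ?_) (Ideal.span_le.2 ?_), fun σ hσ i p => ?_⟩
  · have := ht (AlgHom.id R A) contractive_id 0 p
    rw [mem_diagIdeal_iff] at hp
    rw [show evalAt (AlgHom.id R A ^ 0) (contractive_id.pow 0) p = 0 from hp, map_zero,
      sub_zero] at this
    exact this
  · rintro _ ⟨j, rfl⟩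
    exact inclRight_sub_inclLeft_mem _
  · refine Ideal.span_le.2 ?_ (ht σ hσ i p)
    rintro _ ⟨j, rfl⟩
    change inclRight R A (t j) - inclLeft R A A ((σ ^ i) (t j)) ∈ _
    rw [← sigmaP_pow_inclRight_sub σ hσ]
    exact Ideal.mem_map_of_mem _ (inclRight_sub_inclLeft_mem _)

end Generators

/-! ### Newton bases of polynomial rings -/

section PolyNewton

variable {A : Type*} [CommRing A]

/-- The Newton basis of the polynomial ring. -/
def polyNewton (y : ℕ → A) (k : ℕ) : Polynomial A :=
  ∏ i ∈ Finset.range k, (Polynomial.X + Polynomial.C (y i))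

theorem polyNewton_succ (y : ℕ → A) (k : ℕ) :
    polyNewton y (k + 1) = polyNewton y k * (Polynomial.X + Polynomial.C (y k)) :=
  Finset.prod_range_succ _ _

theorem degree_polyNewton_le (y : ℕ → A) (k : ℕ) : (polyNewton y k).degree ≤ k := by
  induction k with
  | zero => simp [polyNewton]
  | succ k ih =>
    rw [polyNewton_succ]
    refine (Polynomial.degree_mul_le _ _).trans ?_
    rw [Nat.cast_succ]
    refine add_le_add ih ((Polynomial.degree_add_le _ _).trans (max_le Polynomial.degree_X_le ?_))
    exact Polynomial.degree_C_le.trans (by norm_num)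

theorem coeff_polyNewton_self (y : ℕ → A) (k : ℕ) : (polyNewton y k).coeff k = 1 := by
  induction k with
  | zero => simp [polyNewton]
  | succ k ih =>
    rw [polyNewton_succ, mul_add, Polynomial.coeff_add, Polynomial.coeff_mul_X, ih,
      Polynomial.coeff_mul_C, Polynomial.coeff_eq_zero_of_degree_lt, zero_mul, add_zero]
    exact (degree_polyNewton_le y k).trans_lt (by exact_mod_cast Nat.lt_succ_self k)

theorem degree_sum_polyNewton_lt (y a : ℕ → A) (n : ℕ) :
    (∑ k ∈ Finset.range n, Polynomial.C (a k) * polyNewton y k).degree < n := by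
  refine (Polynomial.degree_sum_le _ _).trans_lt
    ((Finset.sup_lt_iff (by exact_mod_cast WithBot.bot_lt_coe n)).2 fun k hk => ?_)
  rw [← Polynomial.smul_eq_C_mul]
  refine (Polynomial.degree_smul_le _ _).trans_lt ((degree_polyNewton_le y k).trans_lt ?_)
  exact_mod_cast Finset.mem_range.1 hk

/-- The k-th basis element has degree at most k and leading coefficient 1, so the top coefficient
can be peeled off. -/
theorem exists_eq_sum_polyNewton (y : ℕ → A) (n : ℕ) (p : Polynomial A) (hp : p.degree < n) :
    ∃ a : ℕ → A, p = ∑ k ∈ Finset.range n, Polynomial.C (a k) * polyNewton y k := by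
  induction n generalizing p with
  | zero =>
    refine ⟨0, ?_⟩
    rw [Finset.sum_range_zero, ← Polynomial.degree_eq_bot]
    simpa using hp
  | succ n ih =>
    obtain ⟨a, ha⟩ := ih (p - Polynomial.C (p.coeff n) * polyNewton y n) (by
      rw [Polynomial.degree_lt_iff_coeff_zero] at hp ⊢
      intro m hm
      rw [Polynomial.coeff_sub, Polynomial.coeff_C_mul]
      rcases hm.eq_or_lt with rfl | hm
      · rw [coeff_polyNewton_self, mul_one, sub_self]
      · rw [hp m hm, Polynomial.coeff_eq_zero_of_degree_lt
          ((degree_polyNewton_le y n).trans_lt (by exact_mod_cast hm)), mul_zero, sub_zero])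
    refine ⟨Function.update a n (p.coeff n), ?_⟩
    rw [Finset.sum_range_succ, Function.update_self, Finset.sum_congr rfl fun k hk => by
      rw [Function.update_of_ne (Finset.mem_range.1 hk).ne], ← ha, sub_add_cancel]

theorem sum_polyNewton_eq_zero (y a : ℕ → A) (n : ℕ)
    (h : ∑ k ∈ Finset.range n, Polynomial.C (a k) * polyNewton y k = 0) : ∀ k < n, a k = 0 := by
  induction n with
  | zero => intro k hk; omega
  | succ n ih =>
    have hn : a n = 0 := by
      have h2 := congrArg (fun p => Polynomial.coeff p n) h
      simp only [Finset.sum_range_succ, Polynomial.coeff_add, Polynomial.coeff_C_mul,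
        coeff_polyNewton_self, mul_one, Polynomial.coeff_zero] at h2
      rwa [Polynomial.coeff_eq_zero_of_degree_lt (degree_sum_polyNewton_lt y a n), zero_add] at h2
    rw [Finset.sum_range_succ, hn, Polynomial.C_0, zero_mul, add_zero] at h
    intro k hk
    rcases Nat.lt_succ_iff_lt_or_eq.1 hk with h' | rfl
    · exact ih h k h'
    · exact hn

end PolyNewton

/-! ### The linear forms on P dual to the ξ^{(k)} -/

section Forms

universe u v

variable {R : Type v} {A : Type u} [CommRing R] [NormedCommRing A] [Algebra R A]

/-- The shifts `x - σⁱ(x)`. -/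
def shift (σ : A →ₐ[R] A) (x : A) (i : ℕ) : A := x - (σ ^ i) x

/-- The evaluation of polynomials at `ξ = x̃ - x` in `P`. -/
def evalP (R : Type v) {A : Type u} [CommRing R] [NormedCommRing A] [Algebra R A] (x : A) :
    Polynomial A →+* PP R A :=
  Polynomial.eval₂RingHom (inclLeft R A A) (ctmul R 1 x - ctmul R x 1)

theorem evalP_C (x a : A) : evalP R x (Polynomial.C a) = inclLeft R A A a :=
  Polynomial.eval₂_C _ _

theorem evalP_X (x : A) : evalP R x Polynomial.X = inclRight R A x - inclLeft R A A x :=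
  Polynomial.eval₂_X _ _

variable [IsUltrametricDist A] [CompleteSpace A]

/-- The i-th iterate of σ_P fixes x̃ and moves x, so it sends ξ to x̃ - σⁱ(x) = ξ + (x - σⁱ(x)). -/
theorem evalP_polyNewton (σ : A →ₐ[R] A) (hσ : Contractive σ) (x : A) (k : ℕ) :
    evalP R x (polyNewton (shift σ x) k) = xiP σ hσ x k := by
  rw [polyNewton, xiP, map_prod]
  refine Finset.prod_congr rfl fun i _ => ?_
  rw [map_add, evalP_X, evalP_C, shift, map_sub]
  refine Eq.trans ?_ (sigmaP_pow_inclRight_sub σ hσ i x x).symm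
  ring

theorem twistedPower_zero (σ : A →ₐ[R] A) (hσ : Contractive σ) : twistedPower σ hσ 0 = ⊤ := by
  rw [twistedPower, Finset.prod_range_zero]
  exact Ideal.one_eq_top

theorem twistedPower_succ (σ : A →ₐ[R] A) (hσ : Contractive σ) (n : ℕ) :
    twistedPower σ hσ (n + 1) = twistedPower σ hσ n * (diagIdeal R A).map (sigmaP σ hσ ^ n) :=
  Finset.prod_range_succ _ _

theorem twistedPower_succ_le (σ : A →ₐ[R] A) (hσ : Contractive σ) (n : ℕ) :
    twistedPower σ hσ (n + 1) ≤ twistedPower σ hσ n := by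
  rw [twistedPower_succ]
  exact Ideal.mul_le_left (I := twistedPower σ hσ n)

theorem xiP_mem (σ : A →ₐ[R] A) (hσ : Contractive σ) (x : A) (n : ℕ) :
    xiP σ hσ x n ∈ twistedPower σ hσ n :=
  Ideal.prod_mem_prod fun i _ => Ideal.mem_map_of_mem (sigmaP σ hσ ^ i)
    (inclRight_sub_inclLeft_mem (R := R) x)

theorem twistedPower_antitone (σ : A →ₐ[R] A) (hσ : Contractive σ) :
    Antitone (twistedPower σ hσ) :=
  antitone_nat_of_succ_le (twistedPower_succ_le σ hσ)

variable {σ : A →ₐ[R] A} {hσ : Contractive σ} {x : A} (hx : IsTwistedCoordinate σ hσ x)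

include hx

theorem IsTwistedCoordinate.exists_expansion (n : ℕ) (p : PP R A) :
    ∃ a : ℕ → A, p - ∑ k ∈ Finset.range (n + 1), inclLeft R A A (a k) * xiP σ hσ x k ∈
      twistedPower σ hσ (n + 1) := by
  obtain ⟨⟨f, hf⟩, h⟩ := (hx n).2 (Ideal.Quotient.mk _ p)
  obtain ⟨a, rfl⟩ := exists_eq_sum_polyNewton (shift σ x) (n + 1) f
    (Polynomial.mem_degreeLT.1 hf)
  refine ⟨a, ?_⟩
  rw [← Ideal.Quotient.eq, ← h]
  refine congrArg (Ideal.Quotient.mk (twistedPower σ hσ (n + 1))) ?_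
  change evalP R x (∑ k ∈ Finset.range (n + 1), Polynomial.C (a k) * polyNewton (shift σ x) k) = _
  rw [map_sum]
  exact Finset.sum_congr rfl fun k _ => by rw [map_mul, evalP_C, evalP_polyNewton σ hσ]

theorem IsTwistedCoordinate.eq_zero_of_mem (n : ℕ) (a : ℕ → A)
    (h : ∑ k ∈ Finset.range n, inclLeft R A A (a k) * xiP σ hσ x k ∈ twistedPower σ hσ n) :
    ∀ k < n, a k = 0 := by
  -- The coordinate hypothesis at n concerns I^{(n+1)}, so the index is shifted by one and 0 is
  -- treated apart.
  obtain _ | n := n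
  · intro k hk; omega
  have h0 : (0 : Polynomial A) ∈ Polynomial.degreeLT A (n + 1) := zero_mem _
  have h1 : ∑ k ∈ Finset.range (n + 1), Polynomial.C (a k) * polyNewton (shift σ x) k ∈
      Polynomial.degreeLT A (n + 1) :=
    Polynomial.mem_degreeLT.2 (degree_sum_polyNewton_lt _ _ _)
  have h2 := @(hx n).1 ⟨_, h1⟩ ⟨0, h0⟩ (by
    change Ideal.Quotient.mk _ (evalP R x _) = Ideal.Quotient.mk _ (evalP R x 0)
    rw [map_zero, map_zero, Ideal.Quotient.eq_zero_iff_mem, map_sum]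
    convert h using 1
    exact Finset.sum_congr rfl fun k _ => by rw [map_mul, evalP_C, evalP_polyNewton σ hσ])
  exact sum_polyNewton_eq_zero _ _ _ (congrArg Subtype.val h2)

/-- The coordinates of an element of `P`. -/
def coordP (k : ℕ) (p : PP R A) : A := (hx.exists_expansion k p).choose k

/-- Each `coordP` is chosen from an expansion of a different length. Uniqueness of expansions modulo
I^{(n)} makes the choices compatible, so that one sequence of coordinates serves every n. -/
theorem sub_sum_coordP_mem (n : ℕ) (p : PP R A) :
    p - ∑ k ∈ Finset.range n, inclLeft R A A (coordP hx k p) * xiP σ hσ x k ∈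
      twistedPower σ hσ n := by
  induction n with
  | zero => rw [twistedPower_zero]; trivial
  | succ n ih =>
    have ha := (hx.exists_expansion n p).choose_spec
    set a := (hx.exists_expansion n p).choose with ha'
    have h1 : p - ∑ k ∈ Finset.range n, inclLeft R A A (a k) * xiP σ hσ x k ∈
        twistedPower σ hσ n := by
      have h2 := add_mem (twistedPower_succ_le σ hσ n ha)
        ((twistedPower σ hσ n).mul_mem_left (inclLeft R A A (a n)) (xiP_mem σ hσ x n))
      rw [Finset.sum_range_succ] at h2
      convert h2 using 1
      ring
    have h3 := hx.eq_zero_of_mem n (fun k => a k - coordP hx k p) (by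
      have h4 := sub_mem ih h1
      convert h4 using 1
      rw [sub_sub_sub_cancel_left, ← Finset.sum_sub_distrib]
      exact Finset.sum_congr rfl fun k _ => by rw [map_sub, sub_mul])
    convert ha using 2
    refine Finset.sum_congr rfl fun k hk => ?_
    rcases Nat.lt_succ_iff_lt_or_eq.1 (Finset.mem_range.1 hk) with h | rfl
    · rw [sub_eq_zero.1 (h3 k h)]
    · rfl

/-- This uniqueness is the source of the additivity and A-linearity of the coordinates and of their
values on ξ^{(j)}. -/
theorem eq_coordP {n : ℕ} {p : PP R A} {a : ℕ → A}
    (h : p - ∑ k ∈ Finset.range n, inclLeft R A A (a k) * xiP σ hσ x k ∈ twistedPower σ hσ n)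
    {k : ℕ} (hk : k < n) : coordP hx k p = a k := by
  have h3 := hx.eq_zero_of_mem n (fun k => a k - coordP hx k p) (by
    have h4 := sub_mem (sub_sum_coordP_mem hx n p) h
    convert h4 using 1
    rw [sub_sub_sub_cancel_left, ← Finset.sum_sub_distrib]
    exact Finset.sum_congr rfl fun k _ => by rw [map_sub, sub_mul])
  exact (sub_eq_zero.1 (h3 k hk)).symm

/-- The linear forms dual to the basis `ξ^{(k)}`. -/
def dualForm (k : ℕ) : PP R A →+ A :=
  AddMonoidHom.mk' (coordP hx k) fun p q => by
    refine eq_coordP hx (n := k + 1) (a := fun k => coordP hx k p + coordP hx k q) ?_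
      (Nat.lt_succ_self k)
    convert add_mem (sub_sum_coordP_mem hx (k + 1) p) (sub_sum_coordP_mem hx (k + 1) q) using 1
    simp only [map_add, add_mul, Finset.sum_add_distrib]
    ring

theorem sub_sum_dualForm_mem (n : ℕ) (p : PP R A) :
    p - ∑ k ∈ Finset.range n, inclLeft R A A (dualForm hx k p) * xiP σ hσ x k ∈
      twistedPower σ hσ n :=
  sub_sum_coordP_mem hx n p

theorem dualForm_inclLeft_mul (k : ℕ) (a : A) (p : PP R A) :
    dualForm hx k (inclLeft R A A a * p) = a * dualForm hx k p := by
  refine eq_coordP hx (n := k + 1) (a := fun k => a * dualForm hx k p) ?_ (Nat.lt_succ_self k)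
  convert (twistedPower σ hσ (k + 1)).mul_mem_left (inclLeft R A A a)
    (sub_sum_dualForm_mem hx (k + 1) p) using 1
  rw [mul_sub, Finset.mul_sum]
  simp only [map_mul, mul_assoc]

theorem dualForm_eq_zero {n k : ℕ} (hk : k < n) {p : PP R A} (hp : p ∈ twistedPower σ hσ n) :
    dualForm hx k p = 0 :=
  eq_coordP hx (n := n) (a := 0) (by simpa using hp) hk

/-- Although defined as a product of ideals, I^{(n)} is cut out by linear equations. It is therefore
closed as soon as these forms are continuous. -/
theorem mem_twistedPower_iff {n : ℕ} {p : PP R A} :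
    p ∈ twistedPower σ hσ n ↔ ∀ k < n, dualForm hx k p = 0 := by
  refine ⟨fun hp k hk => dualForm_eq_zero hx hk hp, fun h => ?_⟩
  have := sub_sum_dualForm_mem hx n p
  rwa [Finset.sum_eq_zero fun k hk => by rw [h k (Finset.mem_range.1 hk), map_zero, zero_mul],
    sub_zero] at this

theorem dualForm_xiP (k j : ℕ) : dualForm hx k (xiP σ hσ x j) = if j = k then 1 else 0 := by
  refine eq_coordP hx (n := k + 1) (a := fun k => if j = k then 1 else 0) ?_ (Nat.lt_succ_self k)
  by_cases hj : j < k + 1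
  · rw [Finset.sum_eq_single j]
    · rw [if_pos rfl, map_one, one_mul, sub_self]
      exact zero_mem _
    · intro i _ hi
      rw [if_neg hi.symm, map_zero, zero_mul]
    · intro h; exact absurd (Finset.mem_range.2 hj) h
  · rw [Finset.sum_eq_zero, sub_zero]
    · exact twistedPower_antitone σ hσ (not_lt.1 hj) (xiP_mem σ hσ x j)
    · intro i hi
      rw [if_neg, map_zero, zero_mul]
      have := Finset.mem_range.1 hi
      omega

theorem isDualBasisForm_dualForm (k : ℕ) : IsDualBasisForm σ hσ x k (dualForm hx k) where
  map_smul := dualForm_inclLeft_mul hx k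
  factors _ hf := dualForm_eq_zero hx (Nat.lt_succ_self k) hf
  dual j _ := dualForm_xiP hx k j

/-- The defining properties determine the form, so the choice made in `stdOp` is harmless. -/
theorem IsDualBasisForm.eq_dualForm {k : ℕ} {l : PP R A →+ A} (hl : IsDualBasisForm σ hσ x k l) :
    l = dualForm hx k := by
  ext p
  have h := hl.factors _ (sub_sum_dualForm_mem hx (k + 1) p)
  rw [map_sub, sub_eq_zero, map_sum] at h
  rw [h, Finset.sum_eq_single k]
  · rw [hl.map_smul, hl.dual k le_rfl, if_pos rfl, mul_one]
  · intro j hj hjk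
    rw [hl.map_smul, hl.dual j (Nat.lt_succ_iff.1 (Finset.mem_range.1 hj)), if_neg hjk, mul_zero]
  · intro h; exact absurd (Finset.self_mem_range_succ k) h

theorem stdOp_eq (k : ℕ) (z : A) : stdOp σ hσ x k z = dualForm hx k (inclRight R A z) := by
  have h : ∃ l : PP R A →+ A, IsDualBasisForm σ hσ x k l := ⟨_, isDualBasisForm_dualForm hx k⟩
  rw [stdOp, dif_pos h, h.choose_spec.eq_dualForm hx]
  rfl

end Forms

/-! ### Continuity of the dual forms -/

section Continuity

universe u v

variable {K : Type*} {R : Type v} {A : Type u} [NontriviallyNormedField K] [IsUltrametricDist K]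
  [CompleteSpace K] [CommRing R] [Algebra K R] [NormedCommRing A] [IsUltrametricDist A]
  [CompleteSpace A] [NormedAlgebra K A] [Algebra R A] [IsScalarTower K R A]

/-- A closed, finitely generated ideal of `P`: bounded coefficients. -/
theorem exists_bounded_coefficients (K : Type*) [NontriviallyNormedField K] [CompleteSpace K]
    [NormedAlgebra K A] (hA1 : ‖(1 : A)‖ ≤ 1) {n : ℕ}
    (g : Fin n → PP R A) (hg : IsClosed (Ideal.span (Set.range g) : Set (PP R A))) :
    ∃ C : ℝ, 0 ≤ C ∧ ∀ p ∈ Ideal.span (Set.range g), ∃ q : Fin n → PP R A,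
      p = ∑ i, g i * q i ∧ ∀ i, ‖q i‖ ≤ C * ‖p‖ := by
  let _ := normedSpacePP K (R := R) hA1
  have hsmul : ∀ (k : K) (p : PP R A), k • p = inclLeft R A A (algebraMap K A k) * p :=
    fun _ _ => rfl
  let W : Submodule K (PP R A) :=
    { carrier := Ideal.span (Set.range g)
      add_mem' := fun h h' => add_mem h h'
      zero_mem' := zero_mem _
      smul_mem' := fun k p hp => by
        rw [hsmul]; exact Ideal.mul_mem_left _ _ hp }
  have : CompleteSpace W := IsClosed.completeSpace_coe (hs := hg)
  let T₀ : (Fin n → PP R A) →ₗ[K] PP R A :=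
    { toFun := fun q => ∑ i, g i * q i
      map_add' := fun q r => by simp only [Pi.add_apply, mul_add, Finset.sum_add_distrib]
      map_smul' := fun k q => by
        rw [RingHom.id_apply, hsmul, Finset.mul_sum]
        refine Finset.sum_congr rfl fun i _ => ?_
        rw [Pi.smul_apply, hsmul]
        ring }
  let T₁ : (Fin n → PP R A) →L[K] PP R A := T₀.mkContinuous (∑ i, ‖g i‖) fun q => by
    rw [Finset.sum_mul]
    change ‖∑ i, g i * q i‖ ≤ _
    refine (norm_sum_le _ _).trans (Finset.sum_le_sum fun i _ => ?_)
    exact (norm_mul_le _ _).trans (mul_le_mul_of_nonneg_left (norm_le_pi_norm q i) (norm_nonneg _))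
  have hmem : ∀ q, T₁ q ∈ W := fun q => by
    change ∑ i, g i * q i ∈ Ideal.span (Set.range g)
    exact Ideal.sum_mem _ fun i _ => Ideal.mul_mem_right _ _ (Ideal.subset_span ⟨i, rfl⟩)
  let T : (Fin n → PP R A) →L[K] W := T₁.codRestrict W hmem
  have hT : Function.Surjective T := fun ⟨p, hp⟩ => by
    obtain ⟨c, hc⟩ := (Ideal.mem_span_range_iff_exists_fun).1 hp
    refine ⟨c, Subtype.ext ?_⟩
    change ∑ i, g i * c i = p
    rw [← hc]
    exact Finset.sum_congr rfl fun i _ => mul_comm _ _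
  -- Closedness makes the ideal a Banach space over K, so the open mapping theorem applies to the
  -- presentation by the generators g.
  obtain ⟨C, hC, h⟩ := T.exists_preimage_norm_le hT
  refine ⟨C, hC.le, fun p hp => ?_⟩
  obtain ⟨q, hq, hqn⟩ := h ⟨p, hp⟩
  refine ⟨q, (congrArg Subtype.val hq).symm, fun i => (norm_le_pi_norm q i).trans hqn⟩

variable {σ : A →ₐ[R] A} {hσ : Contractive σ} {x : A} (hx : IsTwistedCoordinate σ hσ x)

include hx

theorem isClosed_twistedPower {n : ℕ} (h : ∀ k < n, Continuous (dualForm hx k)) :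
    IsClosed (twistedPower σ hσ n : Set (PP R A)) := by
  have : (twistedPower σ hσ n : Set (PP R A)) = ⋂ k, ⋂ (_ : k < n), {p | dualForm hx k p = 0} := by
    ext p
    simp only [SetLike.mem_coe, mem_twistedPower_iff hx, Set.mem_iInter, Set.mem_ofPred_eq]
  rw [this]
  exact isClosed_iInter fun k => isClosed_iInter fun hk => isClosed_eq (h k hk) continuous_const

/-- The form l_n kills I^{(n+1)} = I^{(n)} σⁿ(I), so on I^{(n)} a multiplier q matters only modulo
σⁿ(I), where it is the scalar given by a ⊗ b ↦ a σⁿ(b). -/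
theorem dualForm_mul_of_mem
    (hI : ∀ (i : ℕ) (p : PP R A), p - inclLeft R A A (evalAt (σ ^ i) (hσ.pow i) p) ∈
      (diagIdeal R A).map (sigmaP σ hσ ^ i)) {n : ℕ} {g : PP R A}
    (hg : g ∈ twistedPower σ hσ n) (q : PP R A) :
    dualForm hx n (g * q) = dualForm hx n g * evalAt (σ ^ n) (hσ.pow n) q := by
  have h1 : g * (q - inclLeft R A A (evalAt (σ ^ n) (hσ.pow n) q)) ∈ twistedPower σ hσ (n + 1) := by
    rw [twistedPower_succ]
    exact Ideal.mul_mem_mul hg (hI n q)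
  have h2 := dualForm_eq_zero hx (Nat.lt_succ_self n) h1
  rw [mul_sub, map_sub, sub_eq_zero, mul_comm g (inclLeft R A A _), dualForm_inclLeft_mul] at h2
  rw [h2, mul_comm]

/-- If the forms of index < n are bounded, I^{(n)} is closed, and it is finitely generated because I
is. Subtracting the first n terms of its expansion moves p into I^{(n)} without changing l_n(p).
There p is a combination of generators with bounded coefficients, and `dualForm_mul_of_mem` computes
l_n on it. -/
theorem exists_dualForm_bound (hA : IsAffinoid K A) (hA1 : ‖(1 : A)‖ ≤ 1) (n : ℕ) :
    ∃ C : ℝ, 0 ≤ C ∧ ∀ k < n, ∀ p, ‖dualForm hx k p‖ ≤ C * ‖p‖ := by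
  obtain ⟨N, t, ht, hI⟩ := IsAffinoid.exists_span_diagIdeal (R := R) hA hA1
  have hfg : (diagIdeal R A).FG := by
    rw [ht]; exact (Submodule.fg_span (Set.finite_range _))
  induction n with
  | zero => exact ⟨0, le_rfl, fun k hk => by omega⟩
  | succ n ih =>
    obtain ⟨C, hC, hCb⟩ := ih
    have hfgn : (twistedPower σ hσ n).FG := by
      clear hCb
      induction n with
      | zero => rw [twistedPower_zero]; exact ⟨{1}, by simp⟩
      | succ n ih => rw [twistedPower_succ]; exact ih.mul (hfg.map _)
    obtain ⟨m, g, hg⟩ := Submodule.fg_iff_exists_fin_generating_family.1 hfgn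
    have hg' : Ideal.span (Set.range g) = twistedPower σ hσ n := hg
    have hclosed := isClosed_twistedPower hx (n := n) fun k hk =>
      AddMonoidHomClass.continuous_of_bound _ C (hCb k hk)
    obtain ⟨D, hD, hDb⟩ := exists_bounded_coefficients K hA1 g (by rw [hg']; exact hclosed)
    have hgm : ∀ i, g i ∈ twistedPower σ hσ n := fun i => by
      rw [← hg']; exact Ideal.subset_span ⟨i, rfl⟩
    -- B bounds the projection from P to I^{(n)} that removes the first n terms.
    set B := 1 + ∑ k ∈ Finset.range n, C * ‖xiP σ hσ x k‖
    have hB : 0 ≤ B := by positivity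
    set C' := (∑ i, ‖dualForm hx n (g i)‖ * D) * B
    have hC' : 0 ≤ C' := by positivity
    have key : ∀ p, ‖dualForm hx n p‖ ≤ C' * ‖p‖ := fun p => by
      set p' := p - ∑ k ∈ Finset.range n, inclLeft R A A (dualForm hx k p) * xiP σ hσ x k with hp'
      have hp'B : ‖p'‖ ≤ B * ‖p‖ := by
        rw [add_mul, one_mul, Finset.sum_mul]
        refine (norm_sub_le _ _).trans (add_le_add le_rfl ((norm_sum_le _ _).trans
          (Finset.sum_le_sum fun k hk => ?_)))
        refine (norm_mul_le _ _).trans ?_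
        rw [mul_right_comm]
        exact mul_le_mul_of_nonneg_right ((norm_inclLeft_le hA1 _).trans
          (hCb k (Finset.mem_range.1 hk) p)) (norm_nonneg _)
      have hform : dualForm hx n p = dualForm hx n p' := by
        rw [hp', map_sub, map_sum, Finset.sum_eq_zero, sub_zero]
        intro k hk
        rw [dualForm_inclLeft_mul, dualForm_xiP, if_neg (Finset.mem_range.1 hk).ne, mul_zero]
      obtain ⟨q, hq, hqb⟩ := hDb p' (by rw [hg']; exact sub_sum_dualForm_mem hx n p)
      rw [hform, hq, map_sum]
      have h3 : ∑ i, ‖dualForm hx n (g i)‖ * (D * ‖p'‖) ≤ C' * ‖p‖ := by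
        simp only [← mul_assoc]
        rw [← Finset.sum_mul, mul_assoc]
        exact mul_le_mul_of_nonneg_left hp'B (by positivity)
      refine ((norm_sum_le _ _).trans (Finset.sum_le_sum fun i _ => ?_)).trans h3
      rw [dualForm_mul_of_mem hx (hI σ hσ) (hgm i)]
      exact (norm_mul_le _ _).trans (mul_le_mul_of_nonneg_left
        ((norm_evalAt_le _ _ _).trans (hqb i)) (norm_nonneg _))
    refine ⟨max C C', le_max_of_le_left hC, fun k hk p => ?_⟩
    rcases Nat.lt_succ_iff_lt_or_eq.1 hk with h | rfl
    · exact (hCb k h p).trans (mul_le_mul_of_nonneg_right (le_max_left _ _) (norm_nonneg _))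
    · exact (key p).trans (mul_le_mul_of_nonneg_right (le_max_right _ _) (norm_nonneg _))

theorem continuous_dualForm (hA : IsAffinoid K A) (hA1 : ‖(1 : A)‖ ≤ 1) (k : ℕ) :
    Continuous (dualForm hx k) := by
  obtain ⟨C, -, h⟩ := exists_dualForm_bound hx hA hA1 (k + 1)
  exact AddMonoidHomClass.continuous_of_bound _ C (h k (Nat.lt_succ_self k))

end Continuity

/-! ### The twisted Taylor map -/

section Taylor

universe u v

variable {R : Type v} {A : Type u} [CommRing R] [NormedCommRing A] [IsUltrametricDist A]
  [CompleteSpace A] [Algebra R A] {σ : A →ₐ[R] A} {x : A} {η : ℝ} [hη : Fact (0 < η)]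

/-- Telescope: x - σ^{i+1}(x) = (x - σ(x)) + σ(x - σⁱ(x)). Thus the hypothesis on the first shift
controls them all, as the Newton basis requires. -/
theorem IsConvergent.norm_shift_le (hc : IsConvergent σ x η) (i : ℕ) : ‖shift σ x i‖ ≤ η := by
  induction i with
  | zero => simpa [shift] using hη.out.le
  | succ i ih =>
    have : shift σ x (i + 1) = (x - σ x) + σ (shift σ x i) := by
      rw [shift, shift, pow_succ', map_sub, AlgHom.mul_apply]; ring
    rw [this]
    exact (IsUltrametricDist.norm_add_le_max _ _).trans
      (max_le hc.radius_le ((hc.contractive _).trans ih))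

variable (A η) in
/-- The evaluation of polynomials at `ξ` in `A{ξ/η}`. -/
def evalD : Polynomial A →+* Disk A η := Polynomial.eval₂RingHom (algebraMap A (Disk A η)) Disk.xi

theorem evalD_C (a : A) : evalD A η (Polynomial.C a) = algebraMap A (Disk A η) a :=
  Polynomial.eval₂_C _ _

theorem evalD_X : evalD A η Polynomial.X = Disk.xi := Polynomial.eval₂_X _ _

theorem evalD_polyNewton (y : ℕ → A) (k : ℕ) : evalD A η (polyNewton y k) = newton y k := by
  rw [polyNewton, newton, map_prod]
  exact Finset.prod_congr rfl fun i _ => by rw [map_add, evalD_X, evalD_C]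

variable (hA1 : ‖(1 : A)‖ ≤ 1) (hc : IsConvergent σ x η)

/-- The coordinates of `A{ξ/η}` in the basis `ξ^{(k)}`. -/
abbrev coordD (k : ℕ) : Disk A η →+ A := newtonCoord hA1 hc.norm_shift_le k

/-- The series that are divisible by `ξ^{(n)}`. -/
abbrev idealD (n : ℕ) : Ideal (Disk A η) := newtonIdeal hA1 hc.norm_shift_le n

/-- The linear forms on `P` dual to the basis `ξ^{(k)}`. -/
abbrev formP (k : ℕ) : PP R A →+ A := dualForm hc.coordinate k

theorem coordD_evalD (h : Polynomial A) (k : ℕ) :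
    coordD hA1 hc k (evalD A η h) = formP hc k (evalP R x h) := by
  obtain ⟨n, hn⟩ : ∃ n : ℕ, h.degree < n := ⟨h.natDegree + 1,
    Polynomial.degree_le_natDegree.trans_lt (by exact_mod_cast Nat.lt_succ_self _)⟩
  obtain ⟨a, rfl⟩ := exists_eq_sum_polyNewton (shift σ x) n h hn
  simp only [map_sum, map_mul, evalD_C, evalP_C, evalD_polyNewton,
    evalP_polyNewton σ hc.contractive, newtonCoord_algebraMap_mul, dualForm_inclLeft_mul,
    newtonCoord_newton, dualForm_xiP, eq_comm]

/-- The sum of the Taylor series of `z`. -/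
def taylorFun (z : A) : Disk A η :=
  newtonT hA1 hc.norm_shift_le (Disk.mk _ (hc.convergent z))

theorem coordD_taylorFun (k : ℕ) (z : A) :
    coordD hA1 hc k (taylorFun hA1 hc z) = formP hc k (inclRight R A z) := by
  rw [taylorFun, coordD, newtonCoord_newtonT, Disk.coeff_mk, stdOp_eq hc.coordinate]

/-- To compare the n-th coordinates, replace z and w by polynomials f and g in ξ that represent 1 ⊗
z and 1 ⊗ w modulo I^{(n+1)}. They also represent the Taylor series modulo the (n+1)-st ideal of
A{ξ/η}, and f g has the same n-th coordinate in both rings. -/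
theorem taylorFun_mul (z w : A) :
    taylorFun hA1 hc (z * w) = taylorFun hA1 hc z * taylorFun hA1 hc w := by
  refine newtonCoord_ext hA1 hc.norm_shift_le fun n => ?_
  have hpoly : ∀ z : A, ∃ f : Polynomial A,
      inclRight R A z - evalP R x f ∈ twistedPower σ hc.contractive (n + 1) ∧
      taylorFun hA1 hc z - evalD A η f ∈ idealD hA1 hc (n + 1) := fun z => by
    refine ⟨∑ k ∈ Finset.range (n + 1), Polynomial.C (formP hc k (inclRight R A z)) *
      polyNewton (shift σ x) k, ?_, fun k hk => ?_⟩
    · rw [map_sum]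
      convert sub_sum_dualForm_mem hc.coordinate (n + 1) (inclRight R A z) using 2
      exact Finset.sum_congr rfl fun k _ => by rw [map_mul, evalP_C, evalP_polyNewton σ _]
    · have h := sub_sum_dualForm_mem hc.coordinate (n + 1) (inclRight R A z)
      have h2 := dualForm_eq_zero hc.coordinate hk h
      rw [map_sub, sub_eq_zero] at h2 ⊢
      refine (coordD_taylorFun hA1 hc k z).trans (h2.trans ?_)
      refine Eq.trans ?_ (coordD_evalD hA1 hc _ k).symm
      rw [map_sum (evalP R x)]
      refine congrArg _ (Finset.sum_congr rfl fun k _ => ?_)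
      rw [map_mul, evalP_C, evalP_polyNewton σ hc.contractive]
  obtain ⟨f, hf, hf'⟩ := hpoly z
  obtain ⟨g, hg, hg'⟩ := hpoly w
  have h1 : inclRight R A (z * w) - evalP R x (f * g) ∈
      twistedPower σ hc.contractive (n + 1) := by
    convert add_mem (Ideal.mul_mem_left _ (inclRight R A z) hg)
      (Ideal.mul_mem_right (evalP R x g) _ hf) using 1
    rw [map_mul, map_mul]; ring
  have h2 : taylorFun hA1 hc z * taylorFun hA1 hc w - evalD A η (f * g) ∈
      idealD hA1 hc (n + 1) := by
    convert add_mem (Ideal.mul_mem_left _ (taylorFun hA1 hc z) hg')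
      (Ideal.mul_mem_right (evalD A η g) _ hf') using 1
    rw [map_mul]; ring
  have h3 := dualForm_eq_zero hc.coordinate (Nat.lt_succ_self n) h1
  have h4 := h2 n (Nat.lt_succ_self n)
  rw [map_sub, sub_eq_zero] at h3 h4
  exact (coordD_taylorFun hA1 hc n _).trans
    (h3.trans ((coordD_evalD hA1 hc _ n).symm.trans h4.symm))

theorem formP_inclLeft (k : ℕ) (a : A) :
    formP hc k (inclLeft R A A a) = if k = 0 then a else 0 := by
  have h1 : (1 : PP R A) = xiP σ hc.contractive x 0 := by rw [xiP, Finset.prod_range_zero]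
  rw [← mul_one (inclLeft R A A a), formP, dualForm_inclLeft_mul, h1, dualForm_xiP]
  simp [eq_comm]

theorem coordD_algebraMap (k : ℕ) (a : A) :
    coordD hA1 hc k (algebraMap A (Disk A η) a) = if k = 0 then a else 0 := by
  rw [← mul_one (algebraMap A (Disk A η) a), coordD, newtonCoord_algebraMap_mul,
    ← newton_zero (shift σ x), newtonCoord_newton]
  simp

theorem taylorFun_algebraMap (r : R) :
    taylorFun hA1 hc (algebraMap R A r) = algebraMap A (Disk A η) (algebraMap R A r) := by
  refine newtonCoord_ext hA1 hc.norm_shift_le fun k => (coordD_taylorFun hA1 hc k _).trans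
    (Eq.trans ?_ (coordD_algebraMap hA1 hc k _).symm)
  rw [← inclLeft_algebraMap, formP_inclLeft]

/-- The twisted Taylor map. -/
def taylor : A →ₐ[R] Disk A η where
  toFun := taylorFun hA1 hc
  map_one' := by
    have := taylorFun_algebraMap hA1 hc (1 : R)
    rwa [map_one, map_one] at this
  map_mul' := taylorFun_mul hA1 hc
  map_zero' := by
    have := taylorFun_algebraMap hA1 hc (0 : R)
    rwa [map_zero, map_zero] at this
  map_add' z w := newtonCoord_ext hA1 hc.norm_shift_le fun k => by
    rw [map_add]
    refine (coordD_taylorFun hA1 hc k _).trans ?_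
    rw [map_add, map_add]
    exact (congrArg₂ _ (coordD_taylorFun hA1 hc k z) (coordD_taylorFun hA1 hc k w)).symm
  commutes' r := (taylorFun_algebraMap hA1 hc r).trans
    (IsScalarTower.algebraMap_apply R A (Disk A η) r).symm

theorem coordD_taylor (k : ℕ) (z : A) :
    coordD hA1 hc k (taylor hA1 hc z) = formP hc k (inclRight R A z) :=
  coordD_taylorFun hA1 hc k z

theorem isTaylorMap_taylor : IsTaylorMap σ hc.contractive x (taylor hA1 hc) := fun z => by
  have := hasSum_newton hA1 hc.norm_shift_le (taylor hA1 hc z)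
  convert this using 2 with k
  rw [stdOp_eq hc.coordinate, Algebra.smul_def]
  exact congrArg₂ _ (congrArg _ (coordD_taylor hA1 hc k z).symm) rfl

theorem IsTaylorMap.eq_taylor {θ : A →ₐ[R] Disk A η}
    (hθ : IsTaylorMap σ hc.contractive x θ) : θ = taylor hA1 hc :=
  AlgHom.ext fun z => (hθ z).unique (isTaylorMap_taylor hA1 hc z)

/-- In P one has 1 ⊗ x = x ⊗ 1 + ξ, a polynomial in ξ. Uniqueness of δ, density and independence of
σ all rest on this equality. -/
theorem taylor_coordinate : taylor hA1 hc x = algebraMap A (Disk A η) x + Disk.xi := by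
  have h1 : inclRight R A x = evalP R x (Polynomial.C x + Polynomial.X) := by
    rw [map_add, evalP_C, evalP_X, add_sub_cancel]
  refine newtonCoord_ext hA1 hc.norm_shift_le fun k => (coordD_taylor hA1 hc k _).trans ?_
  rw [h1, ← coordD_evalD hA1 hc, map_add, evalD_C, evalD_X]

end Taylor

/-! ### Boundedness of the Taylor map and its extension to P -/

section Bounded

universe u v

variable {K : Type*} {R : Type v} {A : Type u} [NontriviallyNormedField K] [IsUltrametricDist K]
  [CompleteSpace K] [CommRing R] [Algebra K R] [NormedCommRing A] [IsUltrametricDist A]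
  [CompleteSpace A] [NormedAlgebra K A] [Algebra R A] [IsScalarTower K R A]
  {σ : A →ₐ[R] A} {x : A} {η : ℝ} [hη : Fact (0 < η)]

/-- `A{ξ/η}` is a normed space over `K`. -/
abbrev normedSpaceDisk (K : Type*) {A : Type*} [NontriviallyNormedField K] [NormedCommRing A]
    [IsUltrametricDist A] [NormedAlgebra K A] (η : ℝ) [Fact (0 < η)] (hA1 : ‖(1 : A)‖ ≤ 1) :
    NormedSpace K (Disk A η) where
  norm_smul_le k p := by
    rw [← IsScalarTower.algebraMap_smul A k p, Algebra.smul_def]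
    refine (norm_mul_le _ _).trans (mul_le_mul_of_nonneg_right ?_ (norm_nonneg _))
    rw [Disk.norm_algebraMap, norm_algebraMap]
    exact mul_le_of_le_one_right (norm_nonneg _) hA1

theorem exists_taylor_bound (hA1 : ‖(1 : A)‖ ≤ 1) (hc : IsConvergent σ x η)
    (hA : IsAffinoid K A) : ∃ M : ℝ, 0 ≤ M ∧ ∀ z, ‖taylor hA1 hc z‖ ≤ M * ‖z‖ := by
  let _ := normedSpaceDisk K η hA1
  have hsmul : ∀ (k : K) (f : Disk A η), k • f = algebraMap A (Disk A η) (algebraMap K A k) * f :=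
    fun k f => by rw [← IsScalarTower.algebraMap_smul A k f, Algebra.smul_def]
  let T : A →ₗ[K] Disk A η :=
    { toFun := taylor hA1 hc
      map_add' := map_add _
      map_smul' := fun k z => by
        rw [RingHom.id_apply, hsmul, Algebra.smul_def, map_mul, IsScalarTower.algebraMap_apply K R A,
          AlgHom.commutes, IsScalarTower.algebraMap_apply R A (Disk A η)] }
  -- Closed graph theorem: the coordinates l_k(1 ⊗ z) are continuous in z and determine an element
  -- of A{ξ/η}.
  have hT : Continuous T := T.continuous_of_seq_closed_graph fun w z f hw hf => by
    refine newtonCoord_ext hA1 hc.norm_shift_le fun k => ?_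
    have h1 := ((continuous_newtonCoord hA1 hc.norm_shift_le k).tendsto f).comp hf
    have hcont : Continuous fun z => formP hc k (inclRight R A z) :=
      (continuous_dualForm hc.coordinate hA hA1 k).comp
        (AddMonoidHomClass.continuous_of_bound (inclRight R A : A →+* PP R A) 1
          fun a => by simpa using norm_inclRight_le hA1 a)
    have h2 := (hcont.tendsto z).comp hw
    have e : (newtonCoord hA1 hc.norm_shift_le k ∘ T ∘ w) =
        (fun z => formP hc k (inclRight R A z)) ∘ w :=
      funext fun i => coordD_taylor hA1 hc k (w i)
    rw [e] at h1
    exact (tendsto_nhds_unique h1 h2).trans (coordD_taylor hA1 hc k z).symm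
  exact ⟨‖(⟨T, hT⟩ : A →L[K] Disk A η)‖, norm_nonneg _,
    (⟨T, hT⟩ : A →L[K] Disk A η).le_opNorm⟩

variable (hA1 : ‖(1 : A)‖ ≤ 1) (hc : IsConvergent σ x η) {M : ℝ} (hM : 0 ≤ M)
  (hθ : ∀ z, ‖taylor hA1 hc z‖ ≤ M * ‖z‖)

/-- The ring homomorphism `a ⊗ b ↦ a θ(b)` from `P` to `A{ξ/η}`. -/
def taylorP : PP R A →+* Disk A η :=
  CTensor.lift (algebraMap A (Disk A η)) (taylor hA1 hc : A →+* Disk A η)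
    (fun s => (IsScalarTower.algebraMap_apply R A (Disk A η) s).symm.trans
      ((taylor hA1 hc).commutes s).symm) hM fun b c => by
      refine (norm_mul_le _ _).trans ?_
      rw [Disk.norm_algebraMap, mul_left_comm]
      exact mul_le_mul_of_nonneg_left (hθ c) (norm_nonneg _)

theorem taylorP_ctmul (a b : A) : taylorP hA1 hc hM hθ (ctmul R a b) =
    algebraMap A (Disk A η) a * taylor hA1 hc b :=
  CTensor.lift_ctmul _ _ _ _ _ _ _

theorem continuous_taylorP : Continuous (taylorP hA1 hc hM hθ) :=
  CTensor.continuous_lift _ _ _ _ _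

theorem taylorP_inclLeft (a : A) : taylorP hA1 hc hM hθ (inclLeft R A A a) =
    algebraMap A (Disk A η) a := by
  rw [inclLeft_apply, taylorP_ctmul, map_one, mul_one]

theorem taylorP_inclRight (a : A) : taylorP hA1 hc hM hθ (inclRight R A a) =
    taylor hA1 hc a := by
  rw [inclRight_apply, taylorP_ctmul, map_one, one_mul]

theorem taylorP_evalP (h : Polynomial A) :
    taylorP hA1 hc hM hθ (evalP R x h) = evalD A η h := by
  refine DFunLike.congr_fun (Polynomial.ringHom_ext (f := (taylorP hA1 hc hM hθ).comp (evalP R x))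
    (g := evalD A η) (fun a => ?_) ?_) h
  · rw [RingHom.comp_apply, evalP_C, taylorP_inclLeft, evalD_C]
  · rw [RingHom.comp_apply, evalP_X, map_sub, taylorP_inclLeft, taylorP_inclRight,
      taylor_coordinate, evalD_X, add_sub_cancel_left]

/-- Both sides are continuous and agree on pure tensors. Consequently the extension of θ carries
I^{(n)} into the n-th ideal of A{ξ/η}. -/
theorem coordD_taylorP (hA : IsAffinoid K A) (k : ℕ) (p : PP R A) :
    coordD hA1 hc k (taylorP hA1 hc hM hθ p) = formP hc k p := by
  refine DFunLike.congr_fun (CTensor.addHom_ext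
    (φ := (coordD hA1 hc k).comp (taylorP hA1 hc hM hθ : PP R A →+ Disk A η))
    (ψ := formP hc k)
    ((continuous_newtonCoord hA1 hc.norm_shift_le k).comp (continuous_taylorP hA1 hc hM hθ))
    (continuous_dualForm hc.coordinate hA hA1 k) fun a b => ?_) p
  change coordD hA1 hc k (taylorP hA1 hc hM hθ (ctmul R a b)) = _
  rw [taylorP_ctmul, coordD, newtonCoord_algebraMap_mul, ← inclLeft_mul_inclRight, formP,
    dualForm_inclLeft_mul]
  exact congrArg _ (coordD_taylor hA1 hc k b)

theorem taylorP_mem (hA : IsAffinoid K A) {n : ℕ} {p : PP R A}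
    (hp : p ∈ twistedPower σ hc.contractive n) : taylorP hA1 hc hM hθ p ∈ idealD hA1 hc n :=
  fun k hk => (coordD_taylorP hA1 hc hM hθ hA k p).trans (dualForm_eq_zero hc.coordinate hk hp)

include hM hθ in
-- Modulo the next ideal f is a multiple of ξ^{(n)}, and for ξ^{(n)} the product is the image of an
-- element of I^{(n)} σⁿ(I) = I^{(n+1)}.
theorem mul_taylor_sub_mem (hA : IsAffinoid K A) {n : ℕ} {f : Disk A η}
    (hf : f ∈ idealD hA1 hc n) (b : A) :
    f * (taylor hA1 hc b - algebraMap A (Disk A η) ((σ ^ n) b)) ∈ idealD hA1 hc (n + 1) := by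
  have hN : newton (shift σ x) n * (taylor hA1 hc b - algebraMap A (Disk A η) ((σ ^ n) b)) ∈
      idealD hA1 hc (n + 1) := by
    have h1 : xiP σ hc.contractive x n * (inclRight R A b - inclLeft R A A ((σ ^ n) b)) ∈
        twistedPower σ hc.contractive (n + 1) := by
      rw [twistedPower_succ, ← sigmaP_pow_inclRight_sub σ hc.contractive]
      exact Ideal.mul_mem_mul (xiP_mem _ _ _ _)
        (Ideal.mem_map_of_mem _ (inclRight_sub_inclLeft_mem b))
    have h2 := taylorP_mem hA1 hc hM hθ hA h1
    rwa [map_mul, map_sub, taylorP_inclLeft, taylorP_inclRight,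
      ← evalP_polyNewton σ hc.contractive, taylorP_evalP, evalD_polyNewton] at h2
  have hr : f - algebraMap A (Disk A η) (coordD hA1 hc n f) * newton (shift σ x) n ∈
      idealD hA1 hc (n + 1) := fun k hk => by
    rw [map_sub, newtonCoord_algebraMap_mul, newtonCoord_newton]
    rcases Nat.lt_succ_iff_lt_or_eq.1 hk with h | rfl
    · rw [hf k h, if_neg h.ne, mul_zero, sub_zero]
    · rw [if_pos rfl, mul_one]; exact sub_self _
  convert add_mem (Ideal.mul_mem_right (taylor hA1 hc b - algebraMap A (Disk A η) ((σ ^ n) b)) _ hr)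
    (Ideal.mul_mem_left _ (algebraMap A (Disk A η) (coordD hA1 hc n f)) hN) using 1
  ring

end Bounded

/-! ### Evaluation homomorphisms on A{ξ/η} -/

section DiskLiftRing

variable {A : Type*} [NormedCommRing A] [IsUltrametricDist A] [CompleteSpace A] {η : ℝ}
  [hη : Fact (0 < η)] {B : Type*} [NormedCommRing B] [IsUltrametricDist B] [CompleteSpace B]

theorem norm_pow_le_of_norm_le {t : B} (hB : ‖(1 : B)‖ ≤ 1) (ht : ‖t‖ ≤ η) (k : ℕ) :
    ‖t ^ k‖ ≤ 1 * η ^ k := by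
  rw [one_mul]
  induction k with
  | zero => simpa using hB
  | succ k ih =>
    rw [pow_succ, pow_succ]
    exact (norm_mul_le _ _).trans (mul_le_mul ih ht (norm_nonneg _) (pow_nonneg hη.out.le _))

/-- The ring homomorphism `∑ aₖ ξᵏ ↦ ∑ ι(aₖ) tᵏ`. -/
def Disk.eval (hA1 : ‖(1 : A)‖ ≤ 1) (hB : ‖(1 : B)‖ ≤ 1) (ι : A →+* B) (hι : ∀ a, ‖ι a‖ ≤ ‖a‖)
    {t : B} (ht : ‖t‖ ≤ η) : Disk A η →+* B where
  __ := Disk.lift ι hι (norm_pow_le_of_norm_le hB ht)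
  map_one' := by
    have := Disk.lift_xi_pow ι hι (norm_pow_le_of_norm_le hB ht) 0
    rwa [pow_zero, pow_zero] at this
  map_mul' f g := by
    set L := Disk.lift ι hι (norm_pow_le_of_norm_le hB ht) with hL
    have hLc : Continuous L := Disk.continuous_lift _ _ _
    have hpow : ∀ k, ∀ g, L (Disk.xi ^ k * g) = t ^ k * L g := fun k g =>
      DFunLike.congr_fun (Disk.addHom_ext (φ := L.comp (AddMonoidHom.mulLeft (Disk.xi ^ k)))
        (ψ := (AddMonoidHom.mulLeft (t ^ k)).comp L) hA1
        (hLc.comp (continuous_const_mul _)) ((continuous_const_mul _).comp hLc) fun a j => by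
          simp only [AddMonoidHom.comp_apply, AddMonoidHom.coe_mulLeft]
          rw [mul_left_comm, ← pow_add, hL, Disk.lift_algebraMap_mul_xi_pow,
            Disk.lift_algebraMap_mul_xi_pow, pow_add, mul_left_comm]) g
    exact DFunLike.congr_fun (Disk.addHom_ext (φ := L.comp (AddMonoidHom.mulRight g))
        (ψ := (AddMonoidHom.mulRight (L g)).comp L) hA1
        (hLc.comp (continuous_mul_const _)) ((continuous_mul_const _).comp hLc) fun a j => by
          simp only [AddMonoidHom.comp_apply, AddMonoidHom.coe_mulRight]
          rw [mul_assoc, hL, Disk.lift_algebraMap_mul, ← hL, hpow, hL,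
            Disk.lift_algebraMap_mul_xi_pow, mul_assoc]) f

variable (hA1 : ‖(1 : A)‖ ≤ 1) (hB : ‖(1 : B)‖ ≤ 1) (ι : A →+* B) (hι : ∀ a, ‖ι a‖ ≤ ‖a‖)
    {t : B} (ht : ‖t‖ ≤ η)

theorem Disk.norm_eval_le (f : Disk A η) : ‖Disk.eval hA1 hB ι hι ht f‖ ≤ ‖f‖ :=
  (Disk.norm_lift_le ι hι (norm_pow_le_of_norm_le hB ht) f).trans_eq (one_mul _)

theorem Disk.continuous_eval : Continuous (Disk.eval hA1 hB ι hι ht) :=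
  Disk.continuous_lift ι hι (norm_pow_le_of_norm_le hB ht)

theorem Disk.eval_xi : Disk.eval hA1 hB ι hι ht Disk.xi = t := by
  have := Disk.lift_xi_pow ι hι (norm_pow_le_of_norm_le hB ht) 1
  rwa [pow_one, pow_one] at this

theorem Disk.eval_algebraMap (a : A) :
    Disk.eval hA1 hB ι hι ht (algebraMap A (Disk A η) a) = ι a := by
  have := Disk.lift_algebraMap_mul_xi_pow ι hι (norm_pow_le_of_norm_le hB ht) a 0
  rwa [pow_zero, pow_zero, mul_one, mul_one] at this

end DiskLiftRing

/-! ### The tensor product A{ξ/η} ⊗̂'_A A{ξ/η} and its coordinates -/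

section DiskTensor

universe u v

variable {R : Type v} {A : Type u} [CommRing R] [NormedCommRing A] [IsUltrametricDist A]
  [CompleteSpace A] [Algebra R A] {η : ℝ} [hη : Fact (0 < η)] (θ : A →ₐ[R] Disk A η)

instance : IsUltrametricDist (RightStr (θ : A →+* Disk A η)) :=
  inferInstanceAs (IsUltrametricDist (Disk A η))

/-- The ring homomorphism `f ↦ f ⊗' 1`. -/
def diskLeft : Disk A η →+* DiskTensor θ :=
  (inclLeft A (RightStr (θ : A →+* Disk A η)) (Disk A η)).comp
    (toRight (θ : A →+* Disk A η) : Disk A η →+* RightStr (θ : A →+* Disk A η))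

/-- The ring homomorphism `g ↦ 1 ⊗' g`. -/
def diskRight : Disk A η →+* DiskTensor θ := inclRight A (RightStr (θ : A →+* Disk A η))

theorem diskLeft_mul_diskRight (f g : Disk A η) :
    diskLeft θ f * diskRight θ g = dtmul θ f g :=
  inclLeft_mul_inclRight (S := A) (B := RightStr (θ : A →+* Disk A η)) _ g

theorem diskRight_algebraMap (a : A) :
    diskRight θ (algebraMap A (Disk A η) a) = diskLeft θ (θ a) :=
  (inclLeft_algebraMap (S := A) (B := RightStr (θ : A →+* Disk A η)) (C := Disk A η) a).symm

theorem norm_diskLeft_le (hA1 : ‖(1 : A)‖ ≤ 1) (f : Disk A η) : ‖diskLeft θ f‖ ≤ ‖f‖ :=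
  norm_inclLeft_le (S := A) (B := RightStr (θ : A →+* Disk A η)) (C := Disk A η)
    (Disk.norm_one_le hA1) _

theorem norm_diskRight_le (hA1 : ‖(1 : A)‖ ≤ 1) (f : Disk A η) : ‖diskRight θ f‖ ≤ ‖f‖ :=
  norm_inclRight_le (S := A) (B := RightStr (θ : A →+* Disk A η)) (C := Disk A η)
    (Disk.norm_one_le hA1) _

theorem DiskTensor.addHom_ext {E : Type*} [AddCommGroup E] [TopologicalSpace E] [T2Space E]
    {φ ψ : DiskTensor θ →+ E} (hφ : Continuous φ) (hψ : Continuous ψ)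
    (h : ∀ f g, φ (dtmul θ f g) = ψ (dtmul θ f g)) : φ = ψ :=
  CTensor.addHom_ext hφ hψ h

theorem IsComul.map_algebraMap {θ : A →ₐ[R] Disk A η} {δ : Disk A η →+* DiskTensor θ}
    (hδ : IsComul θ δ) (a : A) : δ (algebraMap A (Disk A η) a) =
      diskLeft θ (algebraMap A (Disk A η) a) := by
  have := hδ.compat a 1
  rwa [map_one, mul_one, ← diskLeft_mul_diskRight, map_one, mul_one] at this

theorem IsComul.map_taylor {θ : A →ₐ[R] Disk A η} {δ : Disk A η →+* DiskTensor θ}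
    (hδ : IsComul θ δ) (a : A) : δ (θ a) = diskRight θ (θ a) := by
  have := hδ.compat 1 a
  rwa [map_one, one_mul, ← diskLeft_mul_diskRight, map_one, one_mul] at this

/-- Compatibility fixes δ on A and on the image of θ, hence on ξ = θ(x) - x; together A and ξ
generate a dense subring. -/
theorem IsComul.unique (hA1 : ‖(1 : A)‖ ≤ 1) {θ : A →ₐ[R] Disk A η} {x : A}
    (hx : θ x = algebraMap A (Disk A η) x + Disk.xi)
    {δ δ' : Disk A η →+* DiskTensor θ} (hδ : IsComul θ δ) (hδ' : IsComul θ δ') : δ = δ' := by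
  have hxi : δ Disk.xi = δ' Disk.xi := by
    have e : (Disk.xi : Disk A η) = θ x - algebraMap A (Disk A η) x := by
      rw [hx, add_sub_cancel_left]
    rw [e, map_sub, map_sub, hδ.map_algebraMap, hδ.map_taylor, hδ'.map_algebraMap, hδ'.map_taylor]
  have := Disk.addHom_ext (φ := (δ : Disk A η →+ DiskTensor θ))
    (ψ := (δ' : Disk A η →+ DiskTensor θ)) hA1 hδ.continuous hδ'.continuous fun a k => by
      change δ (algebraMap A (Disk A η) a * Disk.xi ^ k) = δ' (algebraMap A (Disk A η) a * Disk.xi ^ k)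
      rw [map_mul, map_mul, map_pow, map_pow, hxi, hδ.map_algebraMap, hδ'.map_algebraMap]
  exact RingHom.ext fun f => DFunLike.congr_fun this f

section IdTensor

variable {θ} {M C : ℝ} (hM : 0 ≤ M) (hθ : ∀ z, ‖θ z‖ ≤ M * ‖z‖) {Ψ : Dual A η} (hC : 0 ≤ C)
  (hΨ : ∀ g, ‖Ψ g‖ ≤ C * ‖g‖)

include hM hθ hC hΨ in
theorem norm_preIdTensor_le (t : RightStr (θ : A →+* Disk A η) ⊗[A] Disk A η) :
    ‖preIdTensor θ Ψ t‖ ≤ M * C * tensorSeminorm t := by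
  refine norm_le_mul_tensorSeminorm (preIdTensor θ Ψ).toAddMonoidHom (mul_nonneg hM hC)
    (fun f g => ?_) t
  change ‖f * algebraMap A (RightStr (θ : A →+* Disk A η)) (Ψ g)‖ ≤ _
  refine (norm_mul_le _ _).trans ?_
  have h1 : ‖algebraMap A (RightStr (θ : A →+* Disk A η)) (Ψ g)‖ ≤ M * (C * ‖g‖) :=
    (hθ (Ψ g)).trans (mul_le_mul_of_nonneg_left (hΨ g) hM)
  refine (mul_le_mul_of_nonneg_left h1 (norm_nonneg _)).trans_eq (by ring)

/-- `Id ⊗' Ψ` on the seminormed tensor product. -/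
def preIdTensorHom (θ : A →ₐ[R] Disk A η) (Ψ : Dual A η) :
    PreTensor A (RightStr (θ : A →+* Disk A η)) (Disk A η) →+ Disk A η :=
  ((toRight (θ : A →+* Disk A η)).symm : RightStr (θ : A →+* Disk A η) →+ Disk A η).comp
    ((preIdTensor θ Ψ).toAddMonoidHom.comp
      ((toPre A (RightStr (θ : A →+* Disk A η)) (Disk A η)).symm : _ →+ _))

include hM hθ hC hΨ in
theorem continuous_preIdTensorHom : Continuous (preIdTensorHom θ Ψ) :=
  AddMonoidHomClass.continuous_of_bound _ (M * C) (norm_preIdTensor_le hM hθ hC hΨ)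

/-- `Id ⊗' Ψ` as an additive map. -/
def idTensorHom : DiskTensor θ →+ Disk A η :=
  (preIdTensorHom θ Ψ).extension (continuous_preIdTensorHom hM hθ hC hΨ)

theorem continuous_idTensorHom : Continuous (idTensorHom hM hθ hC hΨ) :=
  UniformSpace.Completion.continuous_extension

theorem idTensorHom_coe (t : PreTensor A (RightStr (θ : A →+* Disk A η)) (Disk A η)) :
    idTensorHom hM hθ hC hΨ t = preIdTensorHom θ Ψ t :=
  AddMonoidHom.extension_coe _ (continuous_preIdTensorHom hM hθ hC hΨ) t

theorem idTensorHom_dtmul (f g : Disk A η) :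
    idTensorHom hM hθ hC hΨ (dtmul θ f g) = f * θ (Ψ g) :=
  idTensorHom_coe hM hθ hC hΨ _

theorem norm_idTensorHom_le (w : DiskTensor θ) :
    ‖idTensorHom hM hθ hC hΨ w‖ ≤ M * C * ‖w‖ := by
  induction w using UniformSpace.Completion.induction_on with
  | hp =>
    exact isClosed_le (continuous_idTensorHom hM hθ hC hΨ).norm
      (continuous_const.mul continuous_norm)
  | ih t =>
    rw [idTensorHom_coe, UniformSpace.Completion.norm_coe]
    exact norm_preIdTensor_le hM hθ hC hΨ t

theorem idTensorHom_diskLeft_mul (f : Disk A η) (w : DiskTensor θ) :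
    idTensorHom hM hθ hC hΨ (diskLeft θ f * w) = f * idTensorHom hM hθ hC hΨ w := by
  refine DFunLike.congr_fun (DiskTensor.addHom_ext θ
    (φ := (idTensorHom hM hθ hC hΨ).comp (AddMonoidHom.mulLeft (diskLeft θ f)))
    (ψ := (AddMonoidHom.mulLeft f).comp (idTensorHom hM hθ hC hΨ))
    ((continuous_idTensorHom hM hθ hC hΨ).comp (continuous_const_mul _))
    ((continuous_const_mul _).comp (continuous_idTensorHom hM hθ hC hΨ)) fun f' g => ?_) w
  simp only [AddMonoidHom.comp_apply, AddMonoidHom.coe_mulLeft]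
  rw [idTensorHom_dtmul, ← diskLeft_mul_diskRight, ← mul_assoc, ← map_mul, diskLeft_mul_diskRight,
    idTensorHom_dtmul, mul_assoc]

end IdTensor

section Injectivity

variable {θ} {M : ℝ} (hM : 0 ≤ M) (hθ : ∀ z, ‖θ z‖ ≤ M * ‖z‖) (hA1 : ‖(1 : A)‖ ≤ 1)
  {y : ℕ → A} (hy : ∀ i, ‖y i‖ ≤ η)

/-- The Newton coordinates as continuous linear forms. -/
def newtonDual (k : ℕ) : Dual A η where
  toFun := newtonCoord hA1 hy k
  map_add' := map_add _
  map_smul' a f := by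
    rw [Algebra.smul_def, newtonCoord_algebraMap_mul, RingHom.id_apply, smul_eq_mul]
  cont := continuous_newtonCoord hA1 hy k

theorem newtonDual_apply (k : ℕ) (f : Disk A η) :
    newtonDual hA1 hy k f = newtonCoord hA1 hy k f := rfl

theorem norm_newtonDual_le (k : ℕ) (f : Disk A η) :
    ‖newtonDual hA1 hy k f‖ ≤ (η ^ k)⁻¹ * ‖f‖ := by
  rw [← div_eq_inv_mul, le_div_iff₀ (pow_pos hη.out k)]
  exact norm_newtonCoord_le hA1 hy k f

theorem inv_eta_pow_nonneg (k : ℕ) : 0 ≤ (η ^ k)⁻¹ := inv_nonneg.2 (pow_nonneg hη.out.le k)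

/-- `Id ⊗' c` for the Newton coordinates `c`. -/
abbrev tensorCoord (k : ℕ) : DiskTensor θ →+ Disk A η :=
  idTensorHom hM hθ (inv_eta_pow_nonneg k) (norm_newtonDual_le hA1 hy k)

/-- Expand g in the Newton basis and move its coefficients across the tensor sign, where they act on
f through θ. -/
theorem hasSum_tensorCoord_dtmul (f g : Disk A η) :
    HasSum (fun m => diskLeft θ (tensorCoord hM hθ hA1 hy m (dtmul θ f g)) *
      diskRight θ (newton y m)) (dtmul θ f g) := by
  let L : Disk A η →+ DiskTensor θ :=
    (AddMonoidHom.mulLeft (diskLeft θ f)).comp (diskRight θ : Disk A η →+ DiskTensor θ)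
  have hL : Continuous L := (continuous_const_mul _).comp
    (AddMonoidHomClass.continuous_of_bound (diskRight θ) 1 fun g => by
      simpa using norm_diskRight_le θ hA1 g)
  have h := (hasSum_newton hA1 hy g).map L hL
  have e : L g = dtmul θ f g := diskLeft_mul_diskRight θ f g
  rw [e] at h
  convert h using 2 with m
  rw [idTensorHom_dtmul, newtonDual_apply, map_mul (diskLeft θ), ← diskRight_algebraMap, mul_assoc,
    ← map_mul (diskRight θ)]
  rfl

theorem hasSum_tensorCoord (t : PreTensor A (RightStr (θ : A →+* Disk A η)) (Disk A η)) :
    HasSum (fun m => diskLeft θ (tensorCoord hM hθ hA1 hy m t) * diskRight θ (newton y m))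
      (t : DiskTensor θ) := by
  change RightStr (θ : A →+* Disk A η) ⊗[A] Disk A η at t
  induction t using TensorProduct.induction_on with
  | zero =>
    have e : (((0 : PreTensor A (RightStr (θ : A →+* Disk A η)) (Disk A η)) : DiskTensor θ)) = 0 :=
      UniformSpace.Completion.coe_zero
    change HasSum (fun m => diskLeft θ (tensorCoord hM hθ hA1 hy m
      ((0 : PreTensor A (RightStr (θ : A →+* Disk A η)) (Disk A η)) : DiskTensor θ)) *
        diskRight θ (newton y m))
      ((0 : PreTensor A (RightStr (θ : A →+* Disk A η)) (Disk A η)) : DiskTensor θ)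
    rw [e]
    simp only [map_zero, zero_mul]
    exact hasSum_zero
  | tmul f g =>
    exact hasSum_tensorCoord_dtmul hM hθ hA1 hy ((toRight (θ : A →+* Disk A η)).symm f) g
  | add t u ht hu =>
    have e : ((toPre A (RightStr (θ : A →+* Disk A η)) (Disk A η) (t + u) : PreTensor A _ _) :
        DiskTensor θ) = ((toPre A (RightStr (θ : A →+* Disk A η)) (Disk A η) t : PreTensor A _ _) :
        DiskTensor θ) + ((toPre A (RightStr (θ : A →+* Disk A η)) (Disk A η) u :
          PreTensor A _ _) : DiskTensor θ) := by
      rw [map_add, UniformSpace.Completion.coe_add]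
    change HasSum (fun m => diskLeft θ (tensorCoord hM hθ hA1 hy m
      ((toPre A (RightStr (θ : A →+* Disk A η)) (Disk A η) (t + u) : PreTensor A _ _) :
        DiskTensor θ)) * diskRight θ (newton y m))
        ((toPre A (RightStr (θ : A →+* Disk A η)) (Disk A η) (t + u) : PreTensor A _ _) :
        DiskTensor θ)
    rw [e]
    simp only [map_add, add_mul]
    exact ht.add hu

include hM hθ in
-- The expansion is available only for algebraic tensors t. If all coordinates of w vanish, those of
-- t are, up to sign, those of w - t, whence ‖t‖ ≤ M ‖w - t‖ and ‖w‖ ≤ (1 + M) ‖w - t‖. By density t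
-- may be replaced by w itself.
theorem eq_zero_of_tensorCoord {w : DiskTensor θ}
    (hw : ∀ m, tensorCoord hM hθ hA1 hy m w = 0) : w = 0 := by
  have key : ∀ v : DiskTensor θ, ‖w‖ ≤ (1 + M) * ‖w - v‖ := fun v => by
    induction v using UniformSpace.Completion.induction_on with
    | hp => exact isClosed_le continuous_const (by fun_prop)
    | ih t =>
      have h1 : ‖(t : DiskTensor θ)‖ ≤ M * ‖w - t‖ := by
        refine le_of_eq_of_le (congrArg norm (hasSum_tensorCoord hM hθ hA1 hy t).tsum_eq.symm) ?_
        refine IsUltrametricDist.norm_tsum_le_of_forall_le_of_nonneg (by positivity) fun m => ?_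
        -- The m-th coordinate costs a factor η^{-m}, which the norm of the m-th Newton product
        -- compensates; so the bound is uniform in m.
        have hpos : 0 < η ^ m := pow_pos hη.out m
        have e : tensorCoord hM hθ hA1 hy m (t : DiskTensor θ) =
            - tensorCoord hM hθ hA1 hy m (w - t) := by
          rw [map_sub, hw, zero_sub, neg_neg]
        have h2 : ‖tensorCoord hM hθ hA1 hy m (t : DiskTensor θ)‖ ≤
            M * (η ^ m)⁻¹ * ‖w - t‖ := by
          rw [e, norm_neg]
          exact norm_idTensorHom_le _ _ _ _ _
        have h3 : ‖(newton y m : Disk A η)‖ ≤ η ^ m := by simpa using norm_newton_le hA1 hy m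
        calc _ ≤ ‖diskLeft θ (tensorCoord hM hθ hA1 hy m (t : DiskTensor θ))‖ *
              ‖diskRight θ (newton y m)‖ := norm_mul_le _ _
          _ ≤ (M * (η ^ m)⁻¹ * ‖w - t‖) * η ^ m :=
              mul_le_mul ((norm_diskLeft_le θ hA1 _).trans h2)
                ((norm_diskRight_le θ hA1 _).trans h3) (norm_nonneg _) (by positivity)
          _ = M * ‖w - t‖ := by field_simp
      have h4 : ‖w‖ ≤ ‖w - t‖ + ‖(t : DiskTensor θ)‖ := by
        simpa using norm_add_le (w - t) (t : DiskTensor θ)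
      linarith
  have := key w
  rw [sub_self, norm_zero, mul_zero] at this
  exact norm_le_zero_iff.1 this

end Injectivity

end DiskTensor

/-! ### The comultiplication -/

section Comul

universe u v

variable {K : Type*} {R : Type v} {A : Type u} [NontriviallyNormedField K] [IsUltrametricDist K]
  [CompleteSpace K] [CommRing R] [Algebra K R] [NormedCommRing A] [IsUltrametricDist A]
  [CompleteSpace A] [NormedAlgebra K A] [Algebra R A] [IsScalarTower K R A]
  {σ : A →ₐ[R] A} {x : A} {η : ℝ} [hη : Fact (0 < η)]

theorem norm_one_diskTensor_le (θ : A →ₐ[R] Disk A η) (hA1 : ‖(1 : A)‖ ≤ 1) :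
    ‖(1 : DiskTensor θ)‖ ≤ 1 := by
  rw [← map_one (diskLeft θ)]
  exact (norm_diskLeft_le θ hA1 1).trans (Disk.norm_one_le hA1)

theorem norm_xi_add_xi_le (θ : A →ₐ[R] Disk A η) (hA1 : ‖(1 : A)‖ ≤ 1) :
    ‖diskLeft θ Disk.xi + diskRight θ Disk.xi‖ ≤ η :=
  (IsUltrametricDist.norm_add_le_max _ _).trans
    (max_le ((norm_diskLeft_le θ hA1 _).trans (Disk.norm_xi_le hA1))
      ((norm_diskRight_le θ hA1 _).trans (Disk.norm_xi_le hA1)))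

theorem norm_diskLeft_algebraMap_le (θ : A →ₐ[R] Disk A η) (hA1 : ‖(1 : A)‖ ≤ 1) (a : A) :
    ‖(diskLeft θ).comp (algebraMap A (Disk A η)) a‖ ≤ ‖a‖ :=
  (norm_diskLeft_le θ hA1 _).trans (norm_algebraMap_le a)

/-- The ring homomorphism `∑ aₖ ξᵏ ↦ ∑ aₖ (ξ ⊗' 1 + 1 ⊗' ξ)ᵏ`. -/
def comul (θ : A →ₐ[R] Disk A η) (hA1 : ‖(1 : A)‖ ≤ 1) : Disk A η →+* DiskTensor θ :=
  Disk.eval hA1 (norm_one_diskTensor_le θ hA1) ((diskLeft θ).comp (algebraMap A (Disk A η)))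
    (norm_diskLeft_algebraMap_le θ hA1) (norm_xi_add_xi_le θ hA1)

theorem comul_xi (θ : A →ₐ[R] Disk A η) (hA1 : ‖(1 : A)‖ ≤ 1) :
    comul θ hA1 Disk.xi = diskLeft θ Disk.xi + diskRight θ Disk.xi :=
  Disk.eval_xi _ _ _ _ _

theorem comul_algebraMap (θ : A →ₐ[R] Disk A η) (hA1 : ‖(1 : A)‖ ≤ 1) (a : A) :
    comul θ hA1 (algebraMap A (Disk A η) a) = diskLeft θ (algebraMap A (Disk A η) a) :=
  Disk.eval_algebraMap _ _ _ _ _ _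

theorem continuous_comul (θ : A →ₐ[R] Disk A η) (hA1 : ‖(1 : A)‖ ≤ 1) :
    Continuous (comul θ hA1) :=
  Disk.continuous_eval _ _ _ _ _

theorem norm_comul_le (θ : A →ₐ[R] Disk A η) (hA1 : ‖(1 : A)‖ ≤ 1) (f : Disk A η) :
    ‖comul θ hA1 f‖ ≤ ‖f‖ :=
  Disk.norm_eval_le _ _ _ _ _ _

variable (hA1 : ‖(1 : A)‖ ≤ 1) (hc : IsConvergent σ x η) {M : ℝ} (hM : 0 ≤ M)
  (hθ : ∀ z, ‖taylor hA1 hc z‖ ≤ M * ‖z‖)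

/-- The ring homomorphism `a ⊗ b ↦ a ⊗' θ(b)` from `P` to `A{ξ/η} ⊗̂'_A A{ξ/η}`. -/
def pairP : PP R A →+* DiskTensor (taylor hA1 hc) :=
  CTensor.lift ((diskLeft (taylor hA1 hc)).comp (algebraMap A (Disk A η)))
    ((diskRight (taylor hA1 hc)).comp (taylor hA1 hc : A →+* Disk A η))
    (fun s => by
      have h : taylor hA1 hc (algebraMap R A s) = algebraMap A (Disk A η) (algebraMap R A s) := by
        rw [AlgHom.commutes, IsScalarTower.algebraMap_apply R A (Disk A η)]
      change diskLeft (taylor hA1 hc) (algebraMap A (Disk A η) (algebraMap R A s)) =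
        diskRight (taylor hA1 hc) (taylor hA1 hc (algebraMap R A s))
      rw [h, diskRight_algebraMap, h])
    hM fun b c => by
      refine (norm_mul_le _ _).trans ?_
      rw [mul_left_comm]
      exact mul_le_mul (norm_diskLeft_algebraMap_le _ hA1 b)
        ((norm_diskRight_le _ hA1 _).trans (hθ c)) (norm_nonneg _) (norm_nonneg _)

theorem pairP_ctmul (a b : A) : pairP hA1 hc hM hθ (ctmul R a b) =
    diskLeft (taylor hA1 hc) (algebraMap A (Disk A η) a) * diskRight (taylor hA1 hc) (taylor hA1 hc b) :=
  CTensor.lift_ctmul _ _ _ _ _ _ _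

theorem pairP_inclLeft (a : A) : pairP hA1 hc hM hθ (inclLeft R A A a) =
    diskLeft (taylor hA1 hc) (algebraMap A (Disk A η) a) := by
  rw [inclLeft_apply, pairP_ctmul, map_one, map_one, mul_one]

theorem pairP_inclRight (a : A) : pairP hA1 hc hM hθ (inclRight R A a) =
    diskRight (taylor hA1 hc) (taylor hA1 hc a) := by
  rw [inclRight_apply, pairP_ctmul, map_one, map_one, one_mul]

/-- For h = ξ this says ξ ⊗' 1 + 1 ⊗' ξ = 1 ⊗' θ(x) - x ⊗' 1, which follows from θ(x) = x + ξ and 1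
⊗' x = θ(x) ⊗' 1. -/
theorem comul_evalD (h : Polynomial A) :
    comul (taylor hA1 hc) hA1 (evalD A η h) = pairP hA1 hc hM hθ (evalP R x h) := by
  refine DFunLike.congr_fun (Polynomial.ringHom_ext
    (f := (comul (taylor hA1 hc) hA1).comp (evalD A η))
    (g := (pairP hA1 hc hM hθ).comp (evalP R x)) (fun a => ?_) ?_) h
  · rw [RingHom.comp_apply, RingHom.comp_apply, evalP_C, pairP_inclLeft, evalD_C, comul_algebraMap]
  · rw [RingHom.comp_apply, RingHom.comp_apply, evalP_X, map_sub, pairP_inclLeft, pairP_inclRight,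
      taylor_coordinate, evalD_X, comul_xi, map_add, diskRight_algebraMap, taylor_coordinate,
      map_add]
    ring

/-- The ideal generated by the `f ⊗' g` with `f` divisible by `ξ^{(n)}` and `g` by `ξ^{(m)}`, for
`n + m = N`. -/
def tensorIdeal (N : ℕ) : Ideal (DiskTensor (taylor hA1 hc)) :=
  Ideal.span {w | ∃ n m, n + m = N ∧ ∃ f ∈ idealD hA1 hc n, ∃ g ∈ idealD hA1 hc m,
    w = diskLeft (taylor hA1 hc) f * diskRight (taylor hA1 hc) g}

/-- Insert 1 ⊗' σᵐ(b) = θ(σᵐ(b)) ⊗' 1 between 1 ⊗' θ(b) and σ^{n+m}(b) ⊗' 1. By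
`mul_taylor_sub_mem`, one half raises the order of the right factor and the other that of the left
factor. -/
theorem pairP_sigmaP_pow (n m : ℕ) (b : A) :
    pairP hA1 hc hM hθ ((sigmaP σ hc.contractive ^ (n + m))
        (inclRight R A b - inclLeft R A A b)) =
      diskRight (taylor hA1 hc) (taylor hA1 hc b - algebraMap A (Disk A η) ((σ ^ m) b)) +
      diskLeft (taylor hA1 hc) (taylor hA1 hc ((σ ^ m) b) - algebraMap A (Disk A η) ((σ ^ n) ((σ ^ m) b))) := by
  have h : (σ ^ (n + m)) b = (σ ^ n) ((σ ^ m) b) := by rw [pow_add, AlgHom.mul_apply]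
  rw [sigmaP_pow_inclRight_sub, h, map_sub (pairP hA1 hc hM hθ), pairP_inclLeft, pairP_inclRight,
    map_sub (diskLeft (taylor hA1 hc)), map_sub (diskRight (taylor hA1 hc)), diskRight_algebraMap]
  ring

include hM hθ in
theorem mul_pairP_mem_tensorIdeal (hA : IsAffinoid K A) {n m : ℕ} {f g : Disk A η}
    (hf : f ∈ idealD hA1 hc n) (hg : g ∈ idealD hA1 hc m) (b : A) :
    diskLeft (taylor hA1 hc) f * diskRight (taylor hA1 hc) g * pairP hA1 hc hM hθ
      ((sigmaP σ hc.contractive ^ (n + m)) (inclRight R A b - inclLeft R A A b)) ∈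
        tensorIdeal hA1 hc (n + m + 1) := by
  have h1 : diskLeft (taylor hA1 hc) f *
      diskRight (taylor hA1 hc) (g * (taylor hA1 hc b - algebraMap A (Disk A η) ((σ ^ m) b))) ∈
      tensorIdeal hA1 hc (n + m + 1) :=
    Ideal.subset_span ⟨n, m + 1, rfl, f, hf, _, mul_taylor_sub_mem hA1 hc hM hθ hA hg b, rfl⟩
  have h2 : diskLeft (taylor hA1 hc) (f * (taylor hA1 hc ((σ ^ m) b) -
      algebraMap A (Disk A η) ((σ ^ n) ((σ ^ m) b)))) * diskRight (taylor hA1 hc) g ∈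
      tensorIdeal hA1 hc (n + m + 1) :=
    Ideal.subset_span ⟨n + 1, m, by ring, _, mul_taylor_sub_mem hA1 hc hM hθ hA hf ((σ ^ m) b),
      g, hg, rfl⟩
  rw [map_mul] at h1 h2
  rw [pairP_sigmaP_pow, mul_add]
  refine add_mem ?_ ?_
  · rwa [mul_assoc]
  · rwa [mul_right_comm]

theorem map_pairP_twistedPower_le (hA : IsAffinoid K A) (N : ℕ) :
    (twistedPower σ hc.contractive N).map (pairP hA1 hc hM hθ) ≤ tensorIdeal hA1 hc N := by
  obtain ⟨r, t, ht, -⟩ := IsAffinoid.exists_span_diagIdeal (R := R) hA hA1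
  induction N with
  | zero =>
    have : (1 : DiskTensor (taylor hA1 hc)) ∈ tensorIdeal hA1 hc 0 :=
      Ideal.subset_span ⟨0, 0, rfl, 1, fun k hk => by omega, 1, fun k hk => by omega, by
        rw [map_one, map_one, mul_one]⟩
    rw [(Ideal.eq_top_iff_one _).2 this]
    exact le_top
  | succ N ih =>
    rw [twistedPower_succ, Ideal.map_mul, ht, Ideal.map_span, Ideal.map_span]
    refine (Ideal.mul_mono_left ih).trans ?_
    rw [tensorIdeal, Ideal.span_mul_span', Ideal.span_le]
    rintro _ ⟨_, ⟨n, m, rfl, f, hf, g, hg, rfl⟩, _, ⟨_, ⟨_, ⟨j, rfl⟩, rfl⟩, rfl⟩, rfl⟩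
    exact mul_pairP_mem_tensorIdeal hA1 hc hM hθ hA hf hg (t j)

/-- The coordinates on `A{ξ/η} ⊗̂'_A A{ξ/η}`. -/
def tensorCoord₂ (n m : ℕ) : DiskTensor (taylor hA1 hc) →+ A :=
  (coordD hA1 hc n).comp (tensorCoord hM hθ hA1 hc.norm_shift_le m)

theorem continuous_tensorCoord₂ (n m : ℕ) : Continuous (tensorCoord₂ hA1 hc hM hθ n m) :=
  (continuous_newtonCoord hA1 hc.norm_shift_le n).comp (continuous_idTensorHom _ _ _ _)

theorem tensorCoord₂_mul_dtmul_eq_zero {i j n m : ℕ} (h : n + m < i + j) {f g : Disk A η}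
    (hf : f ∈ idealD hA1 hc i) (hg : g ∈ idealD hA1 hc j) (f' g' : Disk A η) :
    tensorCoord₂ hA1 hc hM hθ n m (diskLeft (taylor hA1 hc) f * diskRight (taylor hA1 hc) g * dtmul (taylor hA1 hc) f' g') = 0 := by
  rw [← diskLeft_mul_diskRight, mul_mul_mul_comm, ← map_mul (diskLeft (taylor hA1 hc)), ← map_mul (diskRight (taylor hA1 hc)),
    diskLeft_mul_diskRight, tensorCoord₂, AddMonoidHom.comp_apply, idTensorHom_dtmul,
    newtonDual_apply]
  by_cases hm : m < j
  · have e : newtonCoord hA1 hc.norm_shift_le m (g * g') = 0 :=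
      (idealD hA1 hc j).mul_mem_right g' hg m hm
    rw [e, map_zero, mul_zero, map_zero]
  · exact (idealD hA1 hc i).mul_mem_right _ ((idealD hA1 hc i).mul_mem_right f' hf) n (by omega)

theorem tensorCoord₂_mul_eq_zero {i j n m : ℕ} (h : n + m < i + j) {f g : Disk A η}
    (hf : f ∈ idealD hA1 hc i) (hg : g ∈ idealD hA1 hc j) (v : DiskTensor (taylor hA1 hc)) :
    tensorCoord₂ hA1 hc hM hθ n m (diskLeft (taylor hA1 hc) f * diskRight (taylor hA1 hc) g * v) = 0 :=
  DFunLike.congr_fun (DiskTensor.addHom_ext (taylor hA1 hc) (φ := (tensorCoord₂ hA1 hc hM hθ n m).comp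
    (AddMonoidHom.mulLeft (diskLeft (taylor hA1 hc) f * diskRight (taylor hA1 hc) g))) (ψ := 0)
    ((continuous_tensorCoord₂ hA1 hc hM hθ n m).comp (continuous_const_mul _)) continuous_const
    (tensorCoord₂_mul_dtmul_eq_zero hA1 hc hM hθ h hf hg)) v

theorem tensorCoord₂_eq_zero {N : ℕ} {w : DiskTensor (taylor hA1 hc)}
    (hw : w ∈ tensorIdeal hA1 hc N) {n m : ℕ} (h : n + m < N) :
    tensorCoord₂ hA1 hc hM hθ n m w = 0 := by
  -- The coordinates are not linear over the tensor product, so the induction on the span carries an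
  -- arbitrary multiplier v.
  have H : ∀ v, tensorCoord₂ hA1 hc hM hθ n m (w * v) = 0 := by
    induction hw using Submodule.span_induction with
    | mem w hw =>
      obtain ⟨i, j, rfl, f, hf, g, hg, rfl⟩ := hw
      exact tensorCoord₂_mul_eq_zero hA1 hc hM hθ h hf hg
    | zero => intro v; rw [zero_mul, map_zero]
    | add a b _ _ ha hb => intro v; rw [add_mul, map_add, ha, hb, add_zero]
    | smul a b _ hb =>
      intro v
      rw [smul_eq_mul, mul_comm a b, mul_assoc]
      exact hb _
  have := H 1
  rwa [mul_one] at this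

theorem tensorCoord₂_comul_eq_zero (hA : IsAffinoid K A) {N : ℕ} {f : Disk A η}
    (hf : f ∈ idealD hA1 hc N) {n m : ℕ} (h : n + m < N) :
    tensorCoord₂ hA1 hc hM hθ n m (comul (taylor hA1 hc) hA1 f) = 0 := by
  have h1 := (hasSum_newton hA1 hc.norm_shift_le f).map
    ((tensorCoord₂ hA1 hc hM hθ n m).comp (comul (taylor hA1 hc) hA1 : Disk A η →+ _))
    ((continuous_tensorCoord₂ hA1 hc hM hθ n m).comp (continuous_comul (taylor hA1 hc) hA1))
  refine h1.unique ?_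
  convert hasSum_zero with k
  change tensorCoord₂ hA1 hc hM hθ n m (comul (taylor hA1 hc) hA1 (algebraMap A (Disk A η)
    (coordD hA1 hc k f) * newton (shift σ x) k)) = 0
  by_cases hk : k < N
  · rw [hf k hk, map_zero, zero_mul, map_zero, map_zero]
  · refine tensorCoord₂_eq_zero hA1 hc hM hθ (N := k) ?_ (by omega)
    rw [map_mul, ← evalD_polyNewton, comul_evalD hA1 hc hM hθ,
      evalP_polyNewton σ hc.contractive]
    exact Ideal.mul_mem_left _ _ (map_pairP_twistedPower_le hA1 hc hM hθ hA k
      (Ideal.mem_map_of_mem _ (xiP_mem _ _ _ _)))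

include hM hθ in
-- For given n and m, approximate 1 ⊗ z by a polynomial h in ξ modulo I^{(n+m+1)}. The two sides
-- agree on h by `comul_evalD`, and both images of the remainder have vanishing (n, m)-coordinate.
theorem comul_taylor (hA : IsAffinoid K A) (z : A) :
    comul (taylor hA1 hc) hA1 (taylor hA1 hc z) = diskRight (taylor hA1 hc) (taylor hA1 hc z) := by
  rw [← sub_eq_zero]
  refine eq_zero_of_tensorCoord hM hθ hA1 hc.norm_shift_le fun m =>
    newtonCoord_ext hA1 hc.norm_shift_le fun n => ?_
  rw [map_zero]
  change tensorCoord₂ hA1 hc hM hθ n m (comul (taylor hA1 hc) hA1 (taylor hA1 hc z) -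
    diskRight (taylor hA1 hc) (taylor hA1 hc z)) = 0
  set N := n + m + 1
  obtain ⟨h, hp⟩ : ∃ h : Polynomial A, inclRight R A z - evalP R x h ∈
      twistedPower σ hc.contractive N := by
    refine ⟨∑ k ∈ Finset.range N, Polynomial.C (formP hc k (inclRight R A z)) *
      polyNewton (shift σ x) k, ?_⟩
    rw [map_sum]
    convert sub_sum_dualForm_mem hc.coordinate N (inclRight R A z) using 2
    exact Finset.sum_congr rfl fun k _ => by
      rw [map_mul, evalP_C, evalP_polyNewton σ hc.contractive]
  have e : comul (taylor hA1 hc) hA1 (taylor hA1 hc z) - diskRight (taylor hA1 hc) (taylor hA1 hc z) =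
      comul (taylor hA1 hc) hA1 (taylorP hA1 hc hM hθ (inclRight R A z - evalP R x h)) -
      pairP hA1 hc hM hθ (inclRight R A z - evalP R x h) := by
    rw [map_sub, map_sub, map_sub, taylorP_inclRight, taylorP_evalP, comul_evalD hA1 hc hM hθ,
      pairP_inclRight, sub_sub_sub_cancel_right]
  rw [e, map_sub, tensorCoord₂_comul_eq_zero hA1 hc hM hθ hA
    (taylorP_mem hA1 hc hM hθ hA hp) (Nat.lt_succ_self _),
    tensorCoord₂_eq_zero hA1 hc hM hθ (map_pairP_twistedPower_le hA1 hc hM hθ hA N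
      (Ideal.mem_map_of_mem _ hp)) (Nat.lt_succ_self _), sub_zero]

include hM hθ in
theorem isComul_comul (hA : IsAffinoid K A) :
    IsComul (taylor hA1 hc) (comul (taylor hA1 hc) hA1) where
  continuous := continuous_comul (taylor hA1 hc) hA1
  compat z₁ z₂ := by
    rw [map_mul, comul_algebraMap, comul_taylor hA1 hc hM hθ hA, diskLeft_mul_diskRight]

end Comul

/-! ### An equivalent submultiplicative norm -/

section BanachAlgebra

theorem IsBanachModule.zero {S E : Type*} [NormedCommRing S] [AddCommGroup E] [Module S E]
    {N : E → ℝ} (hN : IsBanachModule S N) : N 0 = 0 := (hN.eq_zero_iff 0).2 rfl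

theorem IsBanachModule.comp_linearEquiv {S E F : Type*} [NormedCommRing S] [AddCommGroup E]
    [Module S E] [AddCommGroup F] [Module S F] {N : E → ℝ} (hN : IsBanachModule S N)
    (e : F ≃ₗ[S] E) : IsBanachModule S fun u => N (e u) where
  nonneg u := hN.nonneg _
  eq_zero_iff u := by rw [hN.eq_zero_iff, e.map_eq_zero_iff]
  neg u := by rw [map_neg, hN.neg]
  add_le u v := by rw [map_add]; exact hN.add_le _ _
  smul_le s u := by rw [map_smul]; exact hN.smul_le _ _
  complete w hw := by
    obtain ⟨u, hu⟩ := hN.complete (fun n => e (w n)) (by simpa only [map_sub] using hw)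
    exact ⟨e.symm u, by simpa only [map_sub, e.apply_symm_apply] using hu⟩

/-- A Banach module with a continuous unital associative product carries an equivalent norm that
makes it a Banach algebra: the norm of the operators of left multiplication. -/
theorem IsBanachModule.exists_isBanachAlgebra {S E : Type*} [NormedCommRing S] [AddCommGroup E]
    [Module S E] {N : E → ℝ} (hN : IsBanachModule S N) {mul : E → E → E} {one : E}
    (add_mul : ∀ u v w, mul (u + v) w = mul u w + mul v w)
    (mul_add : ∀ u v w, mul u (v + w) = mul u v + mul u w)
    (smul_mul : ∀ (s : S) (u v : E), mul (s • u) v = s • mul u v)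
    (mul_smul : ∀ (s : S) (u v : E), mul u (s • v) = s • mul u v)
    (assoc : ∀ u v w, mul (mul u v) w = mul u (mul v w))
    (one_mul : ∀ u, mul one u = u) (mul_one : ∀ u, mul u one = u)
    {M : ℝ} (hM : 0 ≤ M) (h : ∀ u v, N (mul u v) ≤ M * (N u * N v)) :
    ∃ ν : E → ℝ, EquivNorms ν N ∧ IsBanachAlgebra S mul one ν := by
  let ν : E → ℝ := fun u => ⨆ v, N (mul u v) / N v
  have hbdd : ∀ u, BddAbove (Set.range fun v => N (mul u v) / N v) := fun u => by
    refine ⟨M * N u, ?_⟩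
    rintro _ ⟨v, rfl⟩
    refine div_le_of_le_mul₀ (hN.nonneg v) (mul_nonneg hM (hN.nonneg u)) ?_
    rw [mul_assoc]
    exact h u v
  have hν0 : ∀ u, 0 ≤ ν u := fun u =>
    Real.iSup_nonneg fun v => div_nonneg (hN.nonneg _) (hN.nonneg _)
  have hmul_zero : ∀ u, mul u 0 = 0 := fun u => by
    have := mul_add u 0 0
    rwa [add_zero, left_eq_add] at this
  have hle : ∀ u v, N (mul u v) ≤ ν u * N v := fun u v => by
    rcases (hN.nonneg v).eq_or_lt with h0 | h0
    · rw [(hN.eq_zero_iff v).1 h0.symm, hmul_zero, hN.zero, mul_zero]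
    · rw [← div_le_iff₀ h0]
      exact le_ciSup (hbdd u) v
  have hνle : ∀ u C, 0 ≤ C → (∀ v, N (mul u v) ≤ C * N v) → ν u ≤ C := fun u C hC hv =>
    ciSup_le fun v => div_le_of_le_mul₀ (hN.nonneg v) hC (hv v)
  have hνN : ∀ u, ν u ≤ M * N u := fun u =>
    hνle u _ (mul_nonneg hM (hN.nonneg u)) fun v => by rw [mul_assoc]; exact h u v
  have hNν : ∀ u, N u ≤ N one * ν u := fun u => by
    have := hle u one
    rwa [mul_one, mul_comm] at this
  have h1 := hN.nonneg one
  -- M bounds ν by N; evaluating left multiplication at the unit bounds N by N one times ν. Adding 1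
  -- keeps the constant positive.
  refine ⟨ν, ⟨M + N one + 1, by positivity, fun u => ⟨?_, ?_⟩⟩, ?_⟩
  · refine (hνN u).trans (mul_le_mul_of_nonneg_right ?_ (hN.nonneg u)); linarith
  · refine (hNν u).trans (mul_le_mul_of_nonneg_right ?_ (hν0 u)); linarith
  · exact
    { nonneg := hν0
      eq_zero_iff := fun u => by
        refine ⟨fun hu => (hN.eq_zero_iff u).1 (le_antisymm ?_ (hN.nonneg u)), fun hu => ?_⟩
        · simpa [hu] using hNν u
        · refine le_antisymm ((hνN u).trans_eq ?_) (hν0 u)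
          rw [hu, hN.zero, mul_zero]
      neg := fun u => by
        have e : ∀ v, mul (-u) v = - mul u v := fun v => by
          have := add_mul (-u) u v
          rw [neg_add_cancel] at this
          have h0 := add_mul 0 0 v
          rw [add_zero, left_eq_add] at h0
          rw [h0] at this
          exact eq_neg_of_add_eq_zero_left this.symm
        simp only [ν, e, hN.neg]
      add_le := fun u v => hνle _ _ (le_max_of_le_left (hν0 u)) fun w => by
        rw [add_mul, max_mul_of_nonneg _ _ (hN.nonneg w)]
        exact (hN.add_le _ _).trans (max_le_max (hle u w) (hle v w))
      smul_le := fun s u => hνle _ _ (mul_nonneg (norm_nonneg s) (hν0 u)) fun v => by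
        rw [smul_mul, mul_assoc]
        exact (hN.smul_le _ _).trans (mul_le_mul_of_nonneg_left (hle u v) (norm_nonneg s))
      complete := fun w hw => by
        obtain ⟨u, hu⟩ := hN.complete w fun ε hε => by
          obtain ⟨n, hn⟩ := hw (ε / (N one + 1)) (by positivity)
          refine ⟨n, fun i hi j hj => (hNν _).trans_lt ?_⟩
          have h2 := hn i hi j hj
          rw [lt_div_iff₀ (by positivity)] at h2
          nlinarith [hν0 (w i - w j)]
        refine ⟨u, squeeze_zero (fun n => hν0 _) (fun n => hνN _) ?_⟩
        simpa using hu.const_mul M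
      add_mul := add_mul
      mul_add := mul_add
      smul_mul := smul_mul
      mul_smul := mul_smul
      assoc := assoc
      one_mul := one_mul
      mul_one := mul_one
      norm_one_le := hνle _ _ zero_le_one fun v => by rw [one_mul, _root_.one_mul]
      norm_mul_le := fun u v => hνle _ _ (mul_nonneg (hν0 u) (hν0 v)) fun w => by
        rw [assoc, mul_assoc]
        exact (hle _ _).trans (mul_le_mul_of_nonneg_left (hle v w) (hν0 u)) }

end BanachAlgebra

/-! ### The norm of the dual of A{ξ/η} -/

section DualNorm

variable {A : Type*} [NormedCommRing A] [IsUltrametricDist A] {η : ℝ} [hη : Fact (0 < η)]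

/-- A continuous form is K-linear, and over a nontrivially valued field continuity gives
boundedness. Hence the supremum in `dualNorm` is over a bounded set. -/
theorem exists_dual_bound (K : Type*) [NontriviallyNormedField K] [NormedAlgebra K A]
    (hA1 : ‖(1 : A)‖ ≤ 1) (Φ : Dual A η) : ∃ C : ℝ, 0 ≤ C ∧ ∀ f, ‖Φ f‖ ≤ C * ‖f‖ := by
  let _ := normedSpaceDisk K η hA1
  let T : Disk A η →L[K] A :=
    { toFun := Φ
      map_add' := map_add Φ
      map_smul' := fun k f => by
        rw [RingHom.id_apply, ← IsScalarTower.algebraMap_smul A k f, map_smul,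
          IsScalarTower.algebraMap_smul]
      cont := Φ.cont }
  exact ⟨‖T‖, norm_nonneg _, T.le_opNorm⟩

theorem dualNorm_nonneg (Φ : Dual A η) : 0 ≤ dualNorm Φ :=
  Real.iSup_nonneg fun _ => div_nonneg (norm_nonneg _) (norm_nonneg _)

theorem dualNorm_le {Φ : Dual A η} {C : ℝ} (hC : 0 ≤ C) (h : ∀ f, ‖Φ f‖ ≤ C * ‖f‖) :
    dualNorm Φ ≤ C :=
  ciSup_le fun f => div_le_of_le_mul₀ (norm_nonneg _) hC (h f)

theorem norm_le_dualNorm_mul (K : Type*) [NontriviallyNormedField K] [NormedAlgebra K A]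
    (hA1 : ‖(1 : A)‖ ≤ 1) (Φ : Dual A η) (f : Disk A η) : ‖Φ f‖ ≤ dualNorm Φ * ‖f‖ := by
  obtain ⟨C, hC, h⟩ := exists_dual_bound K hA1 Φ
  rcases (norm_nonneg f).eq_or_lt with h0 | h0
  · rw [norm_eq_zero.1 h0.symm, map_zero, norm_zero, norm_zero, mul_zero]
  · rw [← div_le_iff₀ h0]
    refine le_ciSup (f := fun f : Disk A η => ‖Φ f‖ / ‖f‖) ⟨C, ?_⟩ f
    rintro _ ⟨g, rfl⟩
    exact div_le_of_le_mul₀ (norm_nonneg _) hC (h g)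

/-- Limits are taken pointwise. The scalar ring S is left free because the statement is used over A,
for the module isomorphism, and over R, for the algebra structure. -/
theorem isBanachModule_dualNorm [CompleteSpace A] {S : Type*} [NormedCommRing S] [Module S A]
    [SMulCommClass A S A] [ContinuousConstSMul S A]
    (hS : ∀ (s : S) (a : A), ‖s • a‖ ≤ ‖s‖ * ‖a‖)
    (hD : ∀ (Φ : Dual A η) f, ‖Φ f‖ ≤ dualNorm Φ * ‖f‖) :
    IsBanachModule S (dualNorm (A := A) (η := η)) where
  nonneg := dualNorm_nonneg
  eq_zero_iff Φ := by
    refine ⟨fun h => ContinuousLinearMap.ext fun f => ?_, fun h => ?_⟩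
    · have := hD Φ f
      rw [h, zero_mul] at this
      exact norm_le_zero_iff.1 this
    · rw [h]
      exact le_antisymm (dualNorm_le le_rfl fun f => by simp) (dualNorm_nonneg _)
  neg Φ := by
    have h : ∀ f, (-Φ) f = - Φ f := fun _ => rfl
    simp only [dualNorm, h, norm_neg]
  add_le Φ Ψ := dualNorm_le (le_max_of_le_left (dualNorm_nonneg Φ)) fun f => by
    rw [max_mul_of_nonneg _ _ (norm_nonneg f)]
    exact (IsUltrametricDist.norm_add_le_max (Φ f) (Ψ f)).trans (max_le_max (hD Φ f) (hD Ψ f))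
  smul_le s Φ := dualNorm_le (mul_nonneg (norm_nonneg s) (dualNorm_nonneg Φ)) fun f => by
    rw [mul_assoc]
    exact (hS s (Φ f)).trans (mul_le_mul_of_nonneg_left (hD Φ f) (norm_nonneg s))
  complete w hw := by
    have hdiff : ∀ m n f, ‖w m f - w n f‖ ≤ dualNorm (w m - w n) * ‖f‖ := fun m n f =>
      hD (w m - w n) f
    have hcauchy : ∀ f, CauchySeq fun n => w n f := fun f => Metric.cauchySeq_iff.2 fun ε hε => by
      obtain ⟨n, hn⟩ := hw (ε / (‖f‖ + 1)) (by positivity)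
      refine ⟨n, fun i hi j hj => ?_⟩
      rw [dist_eq_norm]
      refine (hdiff i j f).trans_lt ?_
      have h2 := hn i hi j hj
      rw [lt_div_iff₀ (by positivity)] at h2
      nlinarith [dualNorm_nonneg (w i - w j)]
    choose u hu using fun f => cauchySeq_tendsto_of_complete (hcauchy f)
    have hclose : ∀ ε > 0, ∃ n, ∀ m ≥ n, ∀ f, ‖w m f - u f‖ ≤ ε * ‖f‖ := fun ε hε => by
      obtain ⟨n, hn⟩ := hw ε hε
      refine ⟨n, fun m hm f => ?_⟩
      refine le_of_tendsto ((hu f).const_sub (w m f)).norm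
        (eventually_atTop.2 ⟨n, fun j hj => (hdiff m j f).trans ?_⟩)
      exact mul_le_mul_of_nonneg_right (hn m hm j hj).le (norm_nonneg f)
    let U₀ : Disk A η →ₗ[A] A :=
      { toFun := u
        map_add' := fun f g => tendsto_nhds_unique (hu (f + g)) (by
          simpa only [map_add] using (hu f).add (hu g))
        map_smul' := fun a f => tendsto_nhds_unique (hu (a • f)) (by
          simpa only [map_smul, smul_eq_mul, RingHom.id_apply] using (hu f).const_mul a) }
    have hcont : Continuous U₀ := by
      obtain ⟨n, hn⟩ := hclose 1 one_pos
      refine AddMonoidHomClass.continuous_of_bound U₀ (dualNorm (w n) + 1) fun f => ?_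
      have h1 := hn n le_rfl f
      have h2 := hD (w n) f
      have h3 : ‖u f‖ ≤ ‖w n f‖ + ‖w n f - u f‖ := by
        simpa using norm_sub_le (w n f) (w n f - u f)
      change ‖u f‖ ≤ _
      linarith
    refine ⟨⟨U₀, hcont⟩, Metric.tendsto_atTop.2 fun ε hε => ?_⟩
    obtain ⟨n, hn⟩ := hclose (ε / 2) (half_pos hε)
    refine ⟨n, fun m hm => ?_⟩
    rw [Real.dist_0_eq_abs, abs_of_nonneg (dualNorm_nonneg _)]
    exact (dualNorm_le (half_pos hε).le (hn m hm)).trans_lt (half_lt_self hε)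

end DualNorm

/-! ### Density: operators of level η and the dual -/

section DualExt

universe u v

variable {R : Type v} {A : Type u} [CommRing R] [NormedCommRing A] [IsUltrametricDist A]
  [CompleteSpace A] [Algebra R A] {η : ℝ} [hη : Fact (0 < η)]

/-- Since ξᵏ = (θ(x) - x)ᵏ is an A-linear combination of the θ(xⁿ), A-linearity fixes the form on
all a ξᵏ, and continuity does the rest. -/
theorem dual_ext (hA1 : ‖(1 : A)‖ ≤ 1) {θ : A →ₐ[R] Disk A η} {x : A}
    (hx : θ x = algebraMap A (Disk A η) x + Disk.xi) {Φ Ψ : Dual A η}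
    (h : ∀ z, Φ (θ z) = Ψ (θ z)) : Φ = Ψ := by
  have hpoly : ∀ p : Polynomial A, Φ (Polynomial.eval₂ (algebraMap A (Disk A η)) (θ x) p) =
      Ψ (Polynomial.eval₂ (algebraMap A (Disk A η)) (θ x) p) := fun p => by
    induction p using Polynomial.induction_on' with
    | add p q hp hq => rw [Polynomial.eval₂_add, map_add, map_add, hp, hq]
    | monomial n a =>
      rw [Polynomial.eval₂_monomial, ← map_pow, ← Algebra.smul_def, map_smul, map_smul, h]
  have hxi : ∀ k, (Disk.xi ^ k : Disk A η) = Polynomial.eval₂ (algebraMap A (Disk A η)) (θ x)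
      ((Polynomial.X - Polynomial.C x) ^ k) := fun k => by
    rw [Polynomial.eval₂_pow, Polynomial.eval₂_sub, Polynomial.eval₂_X, Polynomial.eval₂_C, hx,
      add_sub_cancel_left]
  have := Disk.addHom_ext (φ := Φ.toLinearMap.toAddMonoidHom) (ψ := Ψ.toLinearMap.toAddMonoidHom)
    hA1 Φ.cont Ψ.cont fun a k => by
      change Φ (algebraMap A (Disk A η) a * Disk.xi ^ k) =
        Ψ (algebraMap A (Disk A η) a * Disk.xi ^ k)
      rw [← Algebra.smul_def, map_smul, map_smul, hxi, hpoly]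
  exact ContinuousLinearMap.ext fun f => DFunLike.congr_fun this f

/-- Restriction along `θ`, from the dual of `A{ξ/η}` to the operators of level `η`. -/
def dualToLevel (θ : A →ₐ[R] Disk A η) : Dual A η →ₗ[A] LevelOps θ where
  toFun Φ := ⟨(Φ.toLinearMap.restrictScalars R) ∘ₗ θ.toLinearMap, Φ, fun _ => rfl⟩
  map_add' _ _ := rfl
  map_smul' _ _ := rfl

theorem dualToLevel_apply (θ : A →ₐ[R] Disk A η) (Φ : Dual A η) (z : A) :
    (dualToLevel θ Φ).1 z = Φ (θ z) := rfl

theorem bijective_dualToLevel (hA1 : ‖(1 : A)‖ ≤ 1) {θ : A →ₐ[R] Disk A η} {x : A}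
    (hx : θ x = algebraMap A (Disk A η) x + Disk.xi) :
    Function.Bijective (dualToLevel θ) := by
  refine ⟨fun Φ Ψ h => dual_ext hA1 hx fun z => ?_, fun φ => ?_⟩
  · exact DFunLike.congr_fun (congrArg Subtype.val h) z
  · obtain ⟨Φ, hΦ⟩ := φ.2
    exact ⟨Φ, Subtype.ext (LinearMap.ext fun z => (hΦ z).symm)⟩

/-- The isomorphism from the operators of level `η` to the dual of `A{ξ/η}`. -/
def levelEquiv (hA1 : ‖(1 : A)‖ ≤ 1) {θ : A →ₐ[R] Disk A η} {x : A}
    (hx : θ x = algebraMap A (Disk A η) x + Disk.xi) : LevelOps θ ≃ₗ[A] Dual A η :=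
  (LinearEquiv.ofBijective (dualToLevel θ) (bijective_dualToLevel hA1 hx)).symm

theorem levelEquiv_apply (hA1 : ‖(1 : A)‖ ≤ 1) {θ : A →ₐ[R] Disk A η} {x : A}
    (hx : θ x = algebraMap A (Disk A η) x + Disk.xi) (φ : LevelOps θ) (z : A) :
    φ.1 z = levelEquiv hA1 hx φ (θ z) := by
  rw [← dualToLevel_apply]
  exact congrArg (fun ψ : LevelOps θ => ψ.1 z)
    ((LinearEquiv.ofBijective (dualToLevel θ) (bijective_dualToLevel hA1 hx)).apply_symm_apply
      φ).symm

theorem levelEquiv_eq (hA1 : ‖(1 : A)‖ ≤ 1) {θ : A →ₐ[R] Disk A η} {x : A}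
    (hx : θ x = algebraMap A (Disk A η) x + Disk.xi) {φ : LevelOps θ} {Φ : Dual A η}
    (h : ∀ z, φ.1 z = Φ (θ z)) : levelEquiv hA1 hx φ = Φ :=
  dual_ext hA1 hx fun z => by rw [← levelEquiv_apply, h]

theorem dualNorm_levelEquiv (hA1 : ‖(1 : A)‖ ≤ 1) {θ : A →ₐ[R] Disk A η} {x : A}
    (hx : θ x = algebraMap A (Disk A η) x + Disk.xi) (φ : LevelOps θ) :
    dualNorm (levelEquiv hA1 hx φ) = levelNorm θ φ := by
  have : {c | ∃ Φ : Dual A η, (∀ z, φ.1 z = Φ (θ z)) ∧ c = dualNorm Φ} =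
      {dualNorm (levelEquiv hA1 hx φ)} := by
    refine Set.eq_singleton_iff_unique_mem.2 ⟨⟨_, levelEquiv_apply hA1 hx φ, rfl⟩, ?_⟩
    rintro _ ⟨Φ, hΦ, rfl⟩
    rw [levelEquiv_eq hA1 hx hΦ]
  rw [levelNorm, this, csInf_singleton]

/-- The product `Φ ∘ (Id ⊗' Ψ) ∘ δ`. -/
def dualMul {θ : A →ₐ[R] Disk A η} {M : ℝ} (hM : 0 ≤ M) (hθ : ∀ z, ‖θ z‖ ≤ M * ‖z‖)
    (hD : ∀ (Φ : Dual A η) f, ‖Φ f‖ ≤ dualNorm Φ * ‖f‖)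
    {δ : Disk A η →+* DiskTensor θ} (hδ : IsComul θ δ) (Φ Ψ : Dual A η) : Dual A η where
  toFun f := Φ (idTensorHom hM hθ (dualNorm_nonneg Ψ) (hD Ψ) (δ f))
  map_add' f g := by rw [map_add, map_add, map_add]
  map_smul' a f := by
    rw [Algebra.smul_def, map_mul, hδ.map_algebraMap, idTensorHom_diskLeft_mul, ← Algebra.smul_def,
      map_smul, RingHom.id_apply]
  cont := Φ.cont.comp ((continuous_idTensorHom hM hθ _ _).comp hδ.continuous)

/-- By δ(θ(z)) = 1 ⊗' θ(z), the product of forms restricts along θ to the composite of the two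
operators. -/
theorem dualMul_taylor {θ : A →ₐ[R] Disk A η} {M : ℝ} (hM : 0 ≤ M) (hθ : ∀ z, ‖θ z‖ ≤ M * ‖z‖)
    (hD : ∀ (Φ : Dual A η) f, ‖Φ f‖ ≤ dualNorm Φ * ‖f‖)
    {δ : Disk A η →+* DiskTensor θ} (hδ : IsComul θ δ) (Φ Ψ : Dual A η) (z : A) :
    dualMul hM hθ hD hδ Φ Ψ (θ z) = Φ (θ (Ψ (θ z))) := by
  change Φ (idTensorHom hM hθ (dualNorm_nonneg Ψ) (hD Ψ) (δ (θ z))) = _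
  rw [hδ.map_taylor, ← one_mul (diskRight θ (θ z)), ← map_one (diskLeft θ), diskLeft_mul_diskRight,
    idTensorHom_dtmul, one_mul]

end DualExt

/-! ### The unit of the dual algebra -/

section Unit

universe u v

variable {R : Type v} {A : Type u} [CommRing R] [NormedCommRing A] [IsUltrametricDist A]
  [CompleteSpace A] [Algebra R A] {σ : A →ₐ[R] A} {x : A} {η : ℝ} [hη : Fact (0 < η)]

theorem coordD_zero_taylor (hA1 : ‖(1 : A)‖ ≤ 1) (hc : IsConvergent σ x η) (z : A) :
    coordD hA1 hc 0 (taylor hA1 hc z) = z := by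
  have h : inclRight R A z - inclLeft R A A z ∈ twistedPower σ hc.contractive 1 := by
    rw [twistedPower_succ, twistedPower_zero, Ideal.top_mul]
    exact Ideal.mem_map_of_mem (sigmaP σ hc.contractive ^ 0) (inclRight_sub_inclLeft_mem z)
  have h0 := dualForm_eq_zero hc.coordinate zero_lt_one h
  rw [map_sub, sub_eq_zero] at h0
  refine (coordD_taylor hA1 hc 0 z).trans (h0.trans ((formP_inclLeft hc 0 z).trans ?_))
  rw [if_pos rfl]

/-- The unit of the dual algebra: the coordinate of index `0`. -/
def dualOne (hA1 : ‖(1 : A)‖ ≤ 1) (hc : IsConvergent σ x η) : Dual A η :=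
  newtonDual hA1 hc.norm_shift_le 0

theorem dualOne_taylor (hA1 : ‖(1 : A)‖ ≤ 1) (hc : IsConvergent σ x η) (z : A) :
    dualOne hA1 hc (taylor hA1 hc z) = z :=
  coordD_zero_taylor hA1 hc z

end Unit

/-! ### Independence of σ for an étale coordinate -/

section Independence

universe u v

variable {K : Type*} {R : Type v} {A : Type u} [NontriviallyNormedField K] [IsUltrametricDist K]
  [CompleteSpace K] [CommRing R] [Algebra K R] [NormedCommRing A] [IsUltrametricDist A]
  [CompleteSpace A] [NormedAlgebra K A] [Algebra R A] [IsScalarTower K R A]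
  {σ τ : A →ₐ[R] A} {x : A} {η : ℝ} [hη : Fact (0 < η)]

/-- The 0-th shift x - x vanishes, so ξ divides every ξ^{(k)} with k > 0, and the constant term
equals the Newton coordinate of index 0. -/
theorem coeff_zero_newton {y : ℕ → A} (hy0 : y 0 = 0) (k : ℕ) :
    PowerSeries.coeff 0 ((newton y k : Disk A η) : PowerSeries A) = if k = 0 then 1 else 0 := by
  cases k with
  | zero =>
    rw [newton_zero, if_pos rfl]
    exact PowerSeries.coeff_zero_one
  | succ k =>
    have h : (newton y (k + 1) : Disk A η) =
        (∏ i ∈ Finset.range k, (Disk.xi + algebraMap A (Disk A η) (y (i + 1)))) * Disk.xi := by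
      rw [newton, Finset.prod_range_succ', hy0, map_zero, add_zero]
    rw [h, if_neg k.succ_ne_zero]
    exact PowerSeries.coeff_zero_mul_X _

theorem coeff_zero_eq_newtonCoord (hA1 : ‖(1 : A)‖ ≤ 1) {y : ℕ → A} (hy : ∀ i, ‖y i‖ ≤ η)
    (hy0 : y 0 = 0) (f : Disk A η) :
    PowerSeries.coeff 0 (f : PowerSeries A) = newtonCoord hA1 hy 0 f := by
  have h := (hasSum_newton hA1 hy f).map (Disk.coeffHom (A := A) (η := η) 0)
    (Disk.continuous_coeffHom 0)
  have e : (Disk.coeffHom (A := A) (η := η) 0 ∘ fun k =>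
      algebraMap A (Disk A η) (newtonCoord hA1 hy k f) * newton y k) =
      fun k => newtonCoord hA1 hy k f * if k = 0 then 1 else 0 := funext fun k => by
    rw [Function.comp_apply, Disk.coeffHom_apply, Disk.coeff_algebraMap_mul, coeff_zero_newton hy0]
  rw [e] at h
  have h2 := hasSum_single (f := fun k => newtonCoord hA1 hy k f * if k = 0 then 1 else 0) 0
    fun k hk => by simp only [if_neg hk, mul_zero]
  refine (h.unique h2).trans ?_
  simp only [if_true, mul_one]

theorem coeff_zero_taylor (hA1 : ‖(1 : A)‖ ≤ 1) (hc : IsConvergent σ x η) (z : A) :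
    PowerSeries.coeff 0 (taylor hA1 hc z : PowerSeries A) = z :=
  (coeff_zero_eq_newtonCoord hA1 hc.norm_shift_le (by simp [shift]) _).trans
    (coordD_zero_taylor hA1 hc z)

theorem sigmaP_id : sigmaP (AlgHom.id R A) contractive_id = RingHom.id (PP R A) :=
  CTensor.ringHom_ext (continuous_sigmaP _ _) continuous_id fun a b => sigmaP_ctmul _ _ a b

section

variable (hA1 : ‖(1 : A)‖ ≤ 1) (hc : IsConvergent σ x η) {M : ℝ} (hM : 0 ≤ M)
  (hθ : ∀ z, ‖taylor hA1 hc z‖ ≤ M * ‖z‖)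

theorem coeff_zero_taylorP (p : PP R A) :
    PowerSeries.coeff 0 (taylorP hA1 hc hM hθ p : PowerSeries A) =
      evalAt (AlgHom.id R A) contractive_id p :=
  DFunLike.congr_fun (CTensor.addHom_ext
    (φ := (Disk.coeffHom 0).comp (taylorP hA1 hc hM hθ : PP R A →+ Disk A η))
    (ψ := (evalAt (AlgHom.id R A) contractive_id : PP R A →+ A))
    ((Disk.continuous_coeffHom 0).comp (continuous_taylorP hA1 hc hM hθ))
    (continuous_evalAt (AlgHom.id R A) contractive_id) fun a b => by
      change PowerSeries.coeff 0 (taylorP hA1 hc hM hθ (ctmul R a b) : PowerSeries A) =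
        evalAt (AlgHom.id R A) contractive_id (ctmul R a b)
      rw [taylorP_ctmul, Disk.coeff_algebraMap_mul, coeff_zero_taylor, evalAt_ctmul]
      rfl) p

/-- For the identity the twisted power is Iⁿ. The constant term of θ(z) is z, so I maps into (ξ),
hence Iⁿ into (ξⁿ), whichever σ was used to build θ. -/
theorem coeff_taylorP_eq_zero {n : ℕ} {p : PP R A}
    (hp : p ∈ twistedPower (AlgHom.id R A) contractive_id n) {k : ℕ} (hk : k < n) :
    PowerSeries.coeff k (taylorP hA1 hc hM hθ p : PowerSeries A) = 0 := by
  set ι : PP R A →+* PowerSeries A :=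
    ((diskSubalgebra A η).val : Disk A η →+* PowerSeries A).comp (taylorP hA1 hc hM hθ) with hι
  have h1 : diagIdeal R A ≤ (Ideal.span {PowerSeries.X}).comap ι := fun q hq => by
    rw [Ideal.mem_comap, Ideal.mem_span_singleton, PowerSeries.X_dvd_iff,
      ← PowerSeries.coeff_zero_eq_constantCoeff_apply]
    exact (coeff_zero_taylorP hA1 hc hM hθ q).trans (mem_diagIdeal_iff.1 hq)
  have h2 : twistedPower (AlgHom.id R A) contractive_id n = diagIdeal R A ^ n := by
    rw [twistedPower, Finset.prod_congr rfl fun i _ => ?_, Finset.prod_const, Finset.card_range]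
    rw [sigmaP_id]
    change (diagIdeal R A).map ((1 : PP R A →+* PP R A) ^ i) = _
    rw [one_pow]
    exact Ideal.map_id _
  rw [h2] at hp
  have h3 := Ideal.le_comap_pow ι n (Ideal.pow_right_mono h1 n hp)
  rw [Ideal.mem_comap, Ideal.span_singleton_pow, Ideal.mem_span_singleton,
    PowerSeries.X_pow_dvd_iff] at h3
  exact h3 k hk

include hM hθ in
theorem coeff_taylor_eq {n : ℕ} {h : Polynomial A} {z : A}
    (hz : inclRight R A z - evalP R x h ∈ twistedPower (AlgHom.id R A) contractive_id n)
    {k : ℕ} (hk : k < n) : PowerSeries.coeff k (taylor hA1 hc z : PowerSeries A) =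
      PowerSeries.coeff k (evalD A η h : PowerSeries A) := by
  have := coeff_taylorP_eq_zero hA1 hc hM hθ hz hk
  rwa [map_sub, taylorP_inclRight, taylorP_evalP, Disk.coeff_sub, sub_eq_zero] at this

end

/-- The twisted Taylor map does not depend on the endomorphism. -/
theorem taylor_eq_taylor (hA : IsAffinoid K A) (hA1 : ‖(1 : A)‖ ≤ 1)
    (hid : IsTwistedCoordinate (AlgHom.id R A) contractive_id x)
    (hσ : IsConvergent σ x η) (hτ : IsConvergent τ x η) : taylor hA1 hσ = taylor hA1 hτ := by
  obtain ⟨M, hM, hθ⟩ := exists_taylor_bound hA1 hσ hA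
  obtain ⟨M', hM', hθ'⟩ := exists_taylor_bound hA1 hτ hA
  refine AlgHom.ext fun z => Disk.ext_coeff fun k => ?_
  obtain ⟨h, hz⟩ : ∃ h : Polynomial A, inclRight R A z - evalP R x h ∈
      twistedPower (AlgHom.id R A) contractive_id (k + 1) := by
    refine ⟨∑ j ∈ Finset.range (k + 1), Polynomial.C (dualForm hid j (inclRight R A z)) *
      polyNewton (shift (AlgHom.id R A) x) j, ?_⟩
    rw [map_sum]
    convert sub_sum_dualForm_mem hid (k + 1) (inclRight R A z) using 2
    exact Finset.sum_congr rfl fun j _ => by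
      rw [map_mul, evalP_C, evalP_polyNewton _ contractive_id]
  rw [coeff_taylor_eq hA1 hσ hM hθ hz k.lt_succ_self, coeff_taylor_eq hA1 hτ hM' hθ' hz
    k.lt_succ_self]

end Independence

/-! ### Norm of a product of forms -/

section DualAlgebra

universe u v

variable {R : Type v} {A : Type u} [CommRing R] [NormedCommRing A] [IsUltrametricDist A]
  [CompleteSpace A] [Algebra R A] {η : ℝ} [hη : Fact (0 < η)]

theorem eq_zero_of_norm_le_neg_mul {θ : A → Disk A η} {M : ℝ}
    (hM : M < 0) (hθ : ∀ z, ‖θ z‖ ≤ M * ‖z‖) (z : A) : z = 0 := by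
  have := (norm_nonneg _).trans (hθ z)
  exact norm_le_zero_iff.1 (by nlinarith [norm_nonneg z])

theorem dualNorm_dualMul_le {θ : A →ₐ[R] Disk A η} {M : ℝ} (hM : 0 ≤ M)
    (hθ : ∀ z, ‖θ z‖ ≤ M * ‖z‖) (hD : ∀ (Φ : Dual A η) f, ‖Φ f‖ ≤ dualNorm Φ * ‖f‖)
    {δ : Disk A η →+* DiskTensor θ} (hδ : IsComul θ δ) (hδ1 : ∀ f, ‖δ f‖ ≤ ‖f‖) {M' : ℝ}
    (hM' : ∀ z, ‖θ z‖ ≤ M' * ‖z‖) (Φ Ψ : Dual A η) :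
    dualNorm (dualMul hM hθ hD hδ Φ Ψ) ≤ M' * (dualNorm Φ * dualNorm Ψ) := by
  rcases le_or_gt 0 M' with h0 | h0
  · refine dualNorm_le (mul_nonneg h0 (mul_nonneg (dualNorm_nonneg Φ) (dualNorm_nonneg Ψ)))
      fun f => ?_
    -- The constants serve only to prove continuity of Id ⊗' Ψ; the map is the same for M and M', so
    -- the bound by M' applies to the given product.
    have h1 : ‖idTensorHom h0 hM' (dualNorm_nonneg Ψ) (hD Ψ) (δ f)‖ ≤ M' * dualNorm Ψ * ‖f‖ :=
      (norm_idTensorHom_le h0 hM' (dualNorm_nonneg Ψ) (hD Ψ) _).trans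
        (mul_le_mul_of_nonneg_left (hδ1 f) (mul_nonneg h0 (dualNorm_nonneg Ψ)))
    refine (hD Φ (idTensorHom h0 hM' (dualNorm_nonneg Ψ) (hD Ψ) (δ f))).trans ?_
    refine (mul_le_mul_of_nonneg_left h1 (dualNorm_nonneg Φ)).trans_eq (by ring)
  -- A negative M' forces A = 0, and every norm vanishes.
  · have hz : ∀ Φ : Dual A η, dualNorm Φ = 0 := fun Φ =>
      le_antisymm (dualNorm_le le_rfl fun f => by
        rw [eq_zero_of_norm_le_neg_mul h0 hM' (Φ f), norm_zero, zero_mul])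
        (dualNorm_nonneg Φ)
    rw [hz, hz, hz, mul_zero, mul_zero]

end DualAlgebra

end Twisted

end

/-! ### Assembly of the theorem -/

open Twisted in
theorem mainTheorem7 {K R A : Type*}
    [NontriviallyNormedField K] [IsUltrametricDist K] [CompleteSpace K]
    [NormedCommRing R] [IsUltrametricDist R] [CompleteSpace R] [NormedAlgebra K R]
    [NormedCommRing A] [IsUltrametricDist A] [CompleteSpace A] [NormedAlgebra K A]
    [Algebra R A] [IsScalarTower K R A] [IsBoundedSMul R A]
    (hR : IsAffinoid K R) (hA : IsAffinoid K A) (hA1 : ‖(1 : A)‖ ≤ 1)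
    (x : A) (η : ℝ) [Fact (0 < η)] :
    -- density, and the Banach algebra structure of the dual
    (∀ (σ : A →ₐ[R] A) (hσ : IsConvergent σ x η),
      ∃ θ : A →ₐ[R] Disk A η, IsTaylorMap σ hσ.contractive x θ ∧
        (∃ M : ℝ, ∀ z, ‖θ z‖ ≤ M * ‖z‖) ∧
      ∃ δ : Disk A η →+* DiskTensor θ, IsComul θ δ ∧ (∀ δ', IsComul θ δ' → δ' = δ) ∧
      ∃ (mul : Dual A η → Dual A η → Dual A η) (one : Dual A η), IsDualProduct θ δ mul ∧
        IsBanachModule A (dualNorm (A := A) (η := η)) ∧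
        (∃ ν : Dual A η → ℝ, EquivNorms ν dualNorm ∧ IsBanachAlgebra R mul one ν) ∧
        (∀ M : ℝ, (∀ z, ‖θ z‖ ≤ M * ‖z‖) → ∀ Φ Ψ : Dual A η,
          dualNorm (mul Φ Ψ) ≤ M * (dualNorm Φ * dualNorm Ψ)) ∧
        IsBanachModule A (levelNorm θ) ∧
      ∃ e : LevelOps θ ≃ₗ[A] Dual A η,
        (∀ (φ : LevelOps θ) (z : A), φ.1 z = e φ (θ z)) ∧
        (∀ φ : LevelOps θ, dualNorm (e φ) = levelNorm θ φ) ∧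
        (∀ φ : LevelOps θ, Continuous φ.1) ∧
        (∃ h : LinearMap.id ∈ LevelOps θ, e ⟨LinearMap.id, h⟩ = one) ∧
        (∀ φ ψ : LevelOps θ, ∃ h : φ.1 ∘ₗ ψ.1 ∈ LevelOps θ,
          e ⟨φ.1 ∘ₗ ψ.1, h⟩ = mul (e φ) (e ψ))) ∧
    -- independence of the endomorphism
    (IsTwistedCoordinate (AlgHom.id R A) contractive_id x →
      ∀ (σ τ : A →ₐ[R] A) (hσ : IsConvergent σ x η) (hτ : IsConvergent τ x η)
        (θ θ' : A →ₐ[R] Disk A η) (δ : Disk A η →+* DiskTensor θ)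
        (δ' : Disk A η →+* DiskTensor θ') (mul mul' : Dual A η → Dual A η → Dual A η),
        IsTaylorMap σ hσ.contractive x θ → IsTaylorMap τ hτ.contractive x θ' →
        IsComul θ δ → IsComul θ' δ' → IsDualProduct θ δ mul → IsDualProduct θ' δ' mul' →
        mul = mul') := by
  refine ⟨fun σ hσ => ?_, fun hid σ τ hσ hτ θ θ' δ δ' mul mul' hθ hθ' hδ hδ' hmul hmul' => ?_⟩
  · obtain ⟨M, hM, hθ⟩ := exists_taylor_bound hA1 hσ hA
    have hx := taylor_coordinate hA1 hσ
    have hδ := isComul_comul hA1 hσ hM hθ hA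
    have hD : ∀ (Φ : Dual A η) f, ‖Φ f‖ ≤ dualNorm Φ * ‖f‖ := norm_le_dualNorm_mul K hA1
    have hBA : IsBanachModule A (dualNorm (A := A) (η := η)) :=
      isBanachModule_dualNorm norm_mul_le hD
    have hBR : IsBanachModule R (dualNorm (A := A) (η := η)) :=
      isBanachModule_dualNorm norm_smul_le hD
    have hmul := dualMul_taylor hM hθ hD hδ
    have hone := dualOne_taylor hA1 hσ
    have hnorm := fun (M' : ℝ) (hM' : ∀ z, ‖taylor hA1 hσ z‖ ≤ M' * ‖z‖) =>
      dualNorm_dualMul_le hM hθ hD hδ (norm_comul_le (taylor hA1 hσ) hA1) hM'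
    refine ⟨taylor hA1 hσ, isTaylorMap_taylor hA1 hσ, ⟨M, hθ⟩, comul (taylor hA1 hσ) hA1, hδ,
      fun δ' hδ' => IsComul.unique hA1 hx hδ' hδ, dualMul hM hθ hD hδ, dualOne hA1 hσ,
      fun Φ Ψ f => rfl, hBA, ?_, hnorm, ?_, levelEquiv hA1 hx, levelEquiv_apply hA1 hx,
      dualNorm_levelEquiv hA1 hx, fun φ => ?_, ?_, fun φ ψ => ?_⟩
    -- By density each axiom is checked on the image of θ, where it becomes the corresponding law
    -- for composition of operators.
    · refine hBR.exists_isBanachAlgebra (fun Φ Φ' Ψ => ?_) (fun Φ Ψ Ψ' => ?_) (fun r Φ Ψ => ?_)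
        (fun r Φ Ψ => ?_) (fun Φ Ψ Ω => ?_) (fun Φ => ?_) (fun Φ => ?_) hM (hnorm M hθ) <;>
        refine dual_ext hA1 hx fun z => ?_
      · simp only [add_apply, hmul]
      · simp only [add_apply, hmul, map_add]
      · simp only [smul_apply, hmul]
      · have h : ∀ a : A, Φ (taylor hA1 hσ (r • a)) = r • Φ (taylor hA1 hσ a) := fun a => by
          rw [map_smul, ← IsScalarTower.algebraMap_smul A r, map_smul,
            IsScalarTower.algebraMap_smul]
        simp only [smul_apply, hmul, h]
      · simp only [hmul]
      · simp only [hmul, hone]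
      · simp only [hmul, hone]
    · have := hBA.comp_linearEquiv (F := LevelOps (taylor hA1 hσ)) (levelEquiv hA1 hx)
      rwa [funext (dualNorm_levelEquiv hA1 hx)] at this
    · have h1 : Continuous (taylor hA1 hσ) :=
        AddMonoidHomClass.continuous_of_bound (taylor hA1 hσ) M hθ
      exact ((levelEquiv hA1 hx φ).cont.comp h1).congr fun z =>
        (levelEquiv_apply hA1 hx φ z).symm
    · exact ⟨⟨dualOne hA1 hσ, fun z => (hone z).symm⟩,
        levelEquiv_eq hA1 hx fun z => (hone z).symm⟩
    · have h : ∀ z, (φ.1 ∘ₗ ψ.1) z = dualMul hM hθ hD hδ (levelEquiv hA1 hx φ)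
          (levelEquiv hA1 hx ψ) (taylor hA1 hσ z) := fun z => by
        rw [hmul, ← levelEquiv_apply, ← levelEquiv_apply, LinearMap.comp_apply]
      exact ⟨⟨_, h⟩, levelEquiv_eq hA1 hx h⟩
  -- The product is determined by θ and δ; θ is the same for σ and τ, and δ is unique once θ is
  -- given.
  · obtain rfl := hθ.eq_taylor hA1 hσ
    obtain rfl : taylor hA1 hσ = θ' :=
      (taylor_eq_taylor hA hA1 hid hσ hτ).trans (hθ'.eq_taylor hA1 hτ).symm
    obtain rfl := IsComul.unique hA1 (taylor_coordinate hA1 hσ) hδ hδ'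
    exact funext fun Φ => funext fun Ψ => ContinuousLinearMap.ext fun f =>
      (hmul Φ Ψ f).trans (hmul' Φ Ψ f).symm
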